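/- **Theorem.** In the Directed Maximum Leaf Spanning Tree problem the input is a directed graph $G=(V,A)$ with $n=|V|\ge 2$ vertices, given by its adjacency matrix, and the task is to output a directed spanning tree (out-branching) of $G$ that has the maximum number of leaves among all directed spanning trees of $G$ (over all possible roots), or to report that $G$ has none. Here a directed spanning tree with root $r$ is a set $T\subseteq A$ such that no arc of $T$ enters $r$, exactly one arc of $T$ enters every other vertex, and every vertex can be reached from $r$ along arcs of $T$; its leaves are the vertices of out-degree zero in $T$. There is a deterministic algorithm, on a random access machine with logarithmic cost, that solves this problem on every such graph in time $\mathcal{O}^*(1.8139^n)$ while consuming $\mathcal{O}^*(1.6563^n)$ space, where $\mathcal{O}^*$ suppresses factors polynomial in $n$: there are polynomials $p,q$ such that on every directed graph with $n\ge 2$ vertices the algorithm runs in time at most $p(n)\cdot 1.8139^n$ and, in the same run, in space at most $q(n)\cdot 1.6563^n$. Time is the total bit length of the operands (including memory addresses) of the instructions executed, plus one per instruction; space is the maximum over the run of the total bit length of the registers and of all memory cells used, each cell being charged for its address and its content (plus one per register and per cell). -/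

import Mathlib

/-! ### The problem: directed spanning trees with many leaves -/

/-- `T` is a directed spanning tree (out-branching) of the digraph `G` with root `r`: its arcs are
arcs of `G`, no arc enters `r`, exactly one arc enters every other vertex (from its parent), and
every vertex is reached from `r` along arcs of `T`. -/
structure IsOutBranching {V : Type*} (G T : Digraph V) (r : V) : Prop where
  arcs_subset : ∀ u v, T.Adj u v → G.Adj u v
  root_no_parent : ∀ u, ¬ T.Adj u r
  unique_parent : ∀ v, v ≠ r → ∃! u, T.Adj u v
  reachable : ∀ v, Relation.ReflTransGen T.Adj r v

/-- The leaves of a directed tree: the vertices of out-degree zero. -/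
def treeLeaves {V : Type*} (T : Digraph V) : Set V :=
  {v | ∀ w, ¬ T.Adj v w}

/-- `T` is a directed spanning tree of `G` with the maximum number of leaves, over all directed
spanning trees and all roots. -/
def IsMaxLeafOutBranching {V : Type*} (G T : Digraph V) : Prop :=
  (∃ r, IsOutBranching G T r) ∧
    ∀ T' r', IsOutBranching G T' r' → (treeLeaves T').ncard ≤ (treeLeaves T).ncard

/-! ### The machine model: a random access machine with logarithmic cost -/

namespace RAM

/-- Instructions of a random access machine with `m` registers and an unbounded memory, all of whose
cells hold natural numbers. `load` and `store` address the memory through a register. -/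
inductive Instr (m : ℕ) : Type
  /-- `R d := c` -/
  | const (d : Fin m) (c : ℕ)
  /-- `R d := R a + R b` -/
  | add (d a b : Fin m)
  /-- `R d := max (R a - R b) 0` -/
  | sub (d a b : Fin m)
  /-- `R d := R a * R b` -/
  | mul (d a b : Fin m)
  /-- `R d := ⌊R a / R b⌋`, and `0` if `R b = 0` -/
  | div (d a b : Fin m)
  /-- `R d := M [R a]` -/
  | load (d a : Fin m)
  /-- `M [R a] := R b` -/
  | store (a b : Fin m)
  /-- go to line `l` if `R a = 0` -/
  | jz (a : Fin m) (l : ℕ)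
  /-- go to line `l` -/
  | jmp (l : ℕ)

/-- A program is a finite list of instructions; its lines are numbered from `0`. -/
abbrev Program (m : ℕ) : Type := List (Instr m)

/-- Configurations: program counter, registers, memory. -/
@[ext] structure Config (m : ℕ) : Type where
  pc : ℕ
  reg : Fin m → ℕ
  mem : ℕ → ℕ

variable {m : ℕ}

/-- The effect of one instruction. -/
def Instr.exec (I : Instr m) (s : Config m) : Config m :=
  match I with
  | .const d c => ⟨s.pc + 1, Function.update s.reg d c, s.mem⟩
  | .add d a b => ⟨s.pc + 1, Function.update s.reg d (s.reg a + s.reg b), s.mem⟩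
  | .sub d a b => ⟨s.pc + 1, Function.update s.reg d (s.reg a - s.reg b), s.mem⟩
  | .mul d a b => ⟨s.pc + 1, Function.update s.reg d (s.reg a * s.reg b), s.mem⟩
  | .div d a b => ⟨s.pc + 1, Function.update s.reg d (s.reg a / s.reg b), s.mem⟩
  | .load d a => ⟨s.pc + 1, Function.update s.reg d (s.mem (s.reg a)), s.mem⟩
  | .store a b => ⟨s.pc + 1, s.reg, Function.update s.mem (s.reg a) (s.reg b)⟩
  | .jz a l => ⟨if s.reg a = 0 then l else s.pc + 1, s.reg, s.mem⟩
  | .jmp l => ⟨l, s.reg, s.mem⟩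

/-- The logarithmic cost of one instruction: one plus the binary lengths of its operands (for memory
accesses, of the address and of the transferred number). -/
def Instr.cost (I : Instr m) (s : Config m) : ℕ :=
  match I with
  | .const _ c => 1 + c.size
  | .add _ a b => 1 + (s.reg a).size + (s.reg b).size
  | .sub _ a b => 1 + (s.reg a).size + (s.reg b).size
  | .mul _ a b => 1 + (s.reg a).size + (s.reg b).size
  | .div _ a b => 1 + (s.reg a).size + (s.reg b).size
  | .load _ a => 1 + (s.reg a).size + (s.mem (s.reg a)).size
  | .store a b => 1 + (s.reg a).size + (s.reg b).size
  | .jz a _ => 1 + (s.reg a).size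
  | .jmp _ => 1

/-- The memory cells that an instruction reads or writes. -/
def Instr.accessed (I : Instr m) (s : Config m) : Finset ℕ :=
  match I with
  | .load _ a => {s.reg a}
  | .store a _ => {s.reg a}
  | _ => ∅

/-- A configuration is halting if its program counter points to no line of the program. -/
def Halted (P : Program m) (s : Config m) : Prop := P[s.pc]? = none

/-- One step of the machine; a halting configuration stays as it is. -/
def step (P : Program m) (s : Config m) : Config m :=
  match P[s.pc]? with
  | some I => I.exec s
  | none => s

/-- The cost of the step that leaves the configuration `s`. -/
def stepCost (P : Program m) (s : Config m) : ℕ :=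
  match P[s.pc]? with
  | some I => I.cost s
  | none => 0

/-- The memory cells accessed in the step that leaves the configuration `s`. -/
def stepAccessed (P : Program m) (s : Config m) : Finset ℕ :=
  match P[s.pc]? with
  | some I => I.accessed s
  | none => ∅

/-- The initial configuration: line `0`, registers zero, the input in the first memory cells and
zero in all others. -/
def init (m : ℕ) (input : List ℕ) : Config m :=
  ⟨0, fun _ => 0, fun a => input.getD a 0⟩

/-- The configuration after `k` steps on the given input. -/
def conf (P : Program m) (input : List ℕ) (k : ℕ) : Config m :=
  (step P)^[k] (init m input)

/-- The running time of the first `K` steps: their total logarithmic cost. -/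
def time (P : Program m) (input : List ℕ) (K : ℕ) : ℕ :=
  ∑ k ∈ Finset.range K, stepCost P (conf P input k)

/-- The memory cells used in the first `K` steps: those of the input and all cells accessed. -/
def cellsUsed (P : Program m) (input : List ℕ) (K : ℕ) : Finset ℕ :=
  Finset.range input.length ∪
    (Finset.range K).biUnion fun k => stepAccessed P (conf P input k)

/-- The space consumed in the first `K` steps: the maximum over these steps of the total number of
bits in the registers and in all used cells, where a used cell is charged for its address and its
content (and one extra, so that cells holding zero count as well). -/
def space (P : Program m) (input : List ℕ) (K : ℕ) : ℕ :=
  (Finset.range (K + 1)).sup fun k =>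
    (∑ i : Fin m, (1 + ((conf P input k).reg i).size)) +
      ∑ a ∈ cellsUsed P input K, (1 + a.size + ((conf P input k).mem a).size)

end RAM

/-! ### Algorithms for the problem -/

open Classical in
/-- A digraph on `n` vertices as input: the number `n`, then the adjacency matrix row by row, so
that the entry for the pair `(i, j)` is in memory cell `1 + i * n + j`. -/
noncomputable def encodeDigraph {n : ℕ} (G : Digraph (Fin n)) : List ℕ :=
  n :: (List.finRange n).flatMap fun i =>
    (List.finRange n).map fun j => if G.Adj i j then 1 else 0

/-- The memory `M` holds a correct answer for `G`: either cell `0` holds `0` and `G` has no directed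
spanning tree, or cell `0` holds `1` and the cells `1 + i * n + j` hold the adjacency matrix of a
directed spanning tree of `G` with the maximum number of leaves. -/
def IsCorrectAnswer {n : ℕ} (G : Digraph (Fin n)) (M : ℕ → ℕ) : Prop :=
  (M 0 = 0 ∧ ¬ ∃ T r, IsOutBranching G T r) ∨
  (M 0 = 1 ∧ ∃ T, IsMaxLeafOutBranching G T ∧
    ∀ i j : Fin n, (T.Adj i j → M (1 + i * n + j) = 1) ∧ (¬ T.Adj i j → M (1 + i * n + j) = 0))

/-- The program `P` solves the directed maximum leaf spanning tree problem on all digraphs with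
`n ≥ 2` vertices, in time at most `t n` and space at most `s n`. -/
def SolvesDMLST {m : ℕ} (P : RAM.Program m) (t s : ℕ → ℝ) : Prop :=
  ∀ n : ℕ, 2 ≤ n → ∀ G : Digraph (Fin n), ∃ K : ℕ,
    RAM.Halted P (RAM.conf P (encodeDigraph G) K) ∧
    IsCorrectAnswer G (RAM.conf P (encodeDigraph G) K).mem ∧
    (RAM.time P (encodeDigraph G) K : ℝ) ≤ t n ∧
    (RAM.space P (encodeDigraph G) K : ℝ) ≤ s n

/-! A tree with inner vertex set I has n - |I| leaves (`card_inner`), so |I| has to be minimised.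
The only property of I used for the lower bound is `Spans`: every proper vertex set containing the
root is left by an arc whose tail belongs to I.

Put k = ⌊n/6⌋. A code consists of a root r and n - k bits. It drives a search from r: the queue
lists the reached vertices with their parents, and the bit of a queue position says whether its
vertex is expanded, that is, whether all its unreached out-neighbours are appended. If the bits
follow a spanning set I, at most k vertices stay unreached: either the queue has at least n - k
entries, or all its entries have been treated and `Spans` forces it to contain every vertex
(`exists_faithful`, `exists_code`).

The set X of the at most k unreached vertices is finished off by a table. Its entry for X is the
least number of further expansions, each by a vertex outside the current set, until nothing is left;
this is dynamic programming, since an expansion replaces X by a subset. By `TabOK.le_card` the entry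
is at most the number of vertices of I that have an out-neighbour in X. These are disjoint from the
vertices of I expanded before, so the best code costs at most |I|, for every spanning I
(`Best.le_card`). Conversely, replaying the best code and then following the table yields an
out-branching with at most that many inner vertices (`sim_sound`, `WF.isMax`).

There are n·2^(n-k) codes, and 2^(5/6) < 1.8139. The table has at most 5^n / 4^(n-k) entries
(`card_lowMasks`), and (5/4)·4^(1/6) < 1.6563. Entries are addressed by the bit mask of X: addresses
range up to about 2^n, but only accessed cells are charged. To fill the table without running
through all 2^n masks, the walk leaves a mask with k + 1 bits by adding its lowest set bit, which
jumps only over masks with more than k bits. Hence it visits only masks with at most k + 1 bits,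
fewer than 4·2^(n-k) of them (`card_lowMasks_lt`).

The program is written in a language of bounded loops. Its weakest precondition `Cmd.wp` asks at
once for the result, for bounds on stored values and numbers of rounds, and for the permitted memory
cells. `Cmd.comp_spec` and `Cmd.prog_spec` carry all this over to the machine, and `Cmd.time_le`
reads the running time off the nesting of loops. -/

namespace Loop

/-! ### A small language of bounded loops -/

/-- States of the loop language: variables and memory. -/
structure St : Type where
  reg : ℕ → ℕ
  mem : ℕ → ℕ

/-- The arithmetic operations of the machine. -/
inductive Op : Type
  | add | sub | mul | div

@[simp] def Op.ap : Op → ℕ → ℕ → ℕ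
  | .add, a, b => a + b
  | .sub, a, b => a - b
  | .mul, a, b => a * b
  | .div, a, b => a / b

/-- Expressions over variables, numerals and memory cells. -/
inductive Ex : Type
  | num (c : ℕ)
  | var (x : ℕ)
  | bin (o : Op) (a b : Ex)
  | load (a : Ex)

namespace Ex

@[simp] def eval (s : St) : Ex → ℕ
  | num c => c
  | var x => s.reg x
  | bin o a b => o.ap (a.eval s) (b.eval s)
  | load a => s.mem (a.eval s)

/-- All memory cells read by the expression belong to `S`. -/
@[simp] def ok (S : Finset ℕ) (s : St) : Ex → Prop
  | num _ => True
  | var _ => True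
  | bin _ a b => a.ok S s ∧ b.ok S s
  | load a => a.ok S s ∧ a.eval s ∈ S

/-- The number of temporary registers needed. -/
def tmp : Ex → ℕ
  | num _ => 1
  | var _ => 1
  | bin _ a b => max a.tmp (b.tmp + 1)
  | load a => a.tmp

/-- A bound for the exponent of the values in terms of the values of variables. -/
def deg : Ex → ℕ
  | num _ => 1
  | var _ => 1
  | bin _ a b => a.deg + b.deg
  | load a => a.deg + 1

/-- The numerals stop at `8` because the bound for values is only assumed to be at least `8`. -/
def wf : Ex → Bool
  | num c => decide (c ≤ 8)
  | var x => decide (x < 32)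
  | bin _ a b => a.wf && b.wf
  | load a => a.wf

/-- With `31` temporaries an expression still fits into the `80` registers when evaluated from
register `49` on, as a store requires; degree `64` keeps intermediate values below the 64th power of
the bound for variables. -/
def good (e : Ex) : Bool := e.wf && decide (e.tmp ≤ 31) && decide (e.deg ≤ 64)

/-- The number of instructions of the compiled expression. -/
def len : Ex → ℕ
  | num _ => 1
  | var _ => 2
  | bin _ a b => a.len + b.len + 1
  | load a => a.len + 1

end Ex

/-- Commands: assignment to a variable or a memory cell, sequence, conditional execution if the
value of an expression is not zero, and repetition as often as the value of an expression says. The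
tag of a repetition selects a bound for the number of rounds. -/
inductive Cmd : Type
  | assign (x : ℕ) (e : Ex)
  | store (a e : Ex)
  | seq (c d : Cmd)
  | cond (e : Ex) (c : Cmd)
  | rep (tag : Bool) (e : Ex) (c : Cmd)

/-- The limits within which a command has to run: a bound for all values, the memory cells that may
be accessed, and bounds for the number of rounds of loops. -/
structure Lim : Type where
  M : ℕ
  S : Finset ℕ
  bd : Bool → ℕ

/-- Weakest precondition of an `N`-fold iteration. -/
def wpIter (f : St → (St → Prop) → Prop) : ℕ → St → (St → Prop) → Prop
  | 0, s, Q => Q s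
  | N + 1, s, Q => f s fun s' => wpIter f N s' Q

namespace Cmd

/-- Weakest precondition: the command runs within the limits and its final state satisfies `Q`. -/
def wp (K : Lim) : Cmd → St → (St → Prop) → Prop
  | assign x e, s, Q => e.ok K.S s ∧ e.eval s ≤ K.M ∧ Q ⟨Function.update s.reg x (e.eval s), s.mem⟩
  | store a e, s, Q => a.ok K.S s ∧ e.ok K.S s ∧ a.eval s ∈ K.S ∧ e.eval s ≤ K.M ∧
      Q ⟨s.reg, Function.update s.mem (a.eval s) (e.eval s)⟩
  | seq c d, s, Q => c.wp K s fun s' => d.wp K s' Q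
  | cond e c, s, Q => e.ok K.S s ∧ (e.eval s = 0 → Q s) ∧ (e.eval s ≠ 0 → c.wp K s Q)
  | rep tag e c, s, Q => e.ok K.S s ∧ e.eval s ≤ K.bd tag ∧ wpIter (c.wp K) (e.eval s) s Q

def wf : Cmd → ℕ → Bool
  | assign x e, _ => decide (x < 32) && e.good
  | store a e, _ => a.good && e.good
  | seq c d, k => c.wf k && d.wf k
  | cond e c, k => e.good && c.wf k
  | rep _ e c, k => e.good && decide (k < 16) && c.wf (k + 1)

/-- The number of instructions of the compiled command. -/
def len : Cmd → ℕ
  | assign _ e => e.len + 2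
  | store a e => a.len + e.len + 1
  | seq c d => c.len + d.len
  | cond e c => e.len + 1 + c.len
  | rep _ e c => e.len + 2 + (1 + c.len + 3)

/-- A bound for the number of steps of the compiled command. -/
def time (bd : Bool → ℕ) : Cmd → ℕ
  | assign _ e => e.len + 2
  | store a e => a.len + e.len + 1
  | seq c d => c.time bd + d.time bd
  | cond e c => e.len + 1 + c.time bd
  | rep tag e c => e.len + 2 + (bd tag * (1 + c.time bd + 3) + 1)

end Cmd

theorem wpIter_inv {f : St → (St → Prop) → Prop}
    (hf : ∀ s (Q Q' : St → Prop), (∀ s, Q s → Q' s) → f s Q → f s Q')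
    (I : ℕ → St → Prop) {N : ℕ} {Q : St → Prop}
    (step : ∀ i s, i < N → I i s → f s (I (i + 1))) (last : ∀ s, I N s → Q s) :
    ∀ s, I 0 s → wpIter f N s Q := by
  have key : ∀ j i s, i + j = N → I i s → wpIter f j s Q := by
    intro j
    induction j with
    | zero => intro i s h hi; exact last s (by simpa [← h] using hi)
    | succ j ih =>
      intro i s h hi
      exact hf _ _ _ (fun s' hs' => ih (i + 1) s' (by omega) hs') (step i s (by omega) hi)
  exact fun s h => key N 0 s (by omega) h

theorem wpIter_mono {f : St → (St → Prop) → Prop}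
    (hf : ∀ s (Q Q' : St → Prop), (∀ s, Q s → Q' s) → f s Q → f s Q') {Q Q' : St → Prop}
    (h : ∀ s, Q s → Q' s) : ∀ (N : ℕ) (s : St), wpIter f N s Q → wpIter f N s Q'
  | 0, _, h1 => h _ h1
  | N + 1, _, h1 => hf _ _ _ (fun s' h2 => wpIter_mono hf h N s' h2) h1

theorem Cmd.wp_mono (K : Lim) : ∀ (c : Cmd) (s : St) (Q Q' : St → Prop), (∀ s, Q s → Q' s) →
    c.wp K s Q → c.wp K s Q'
  | assign _ _, _, _, _, h => fun ⟨h1, h2, h3⟩ => ⟨h1, h2, h _ h3⟩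
  | store _ _, _, _, _, h => fun ⟨h1, h2, h3, h4, h5⟩ => ⟨h1, h2, h3, h4, h _ h5⟩
  | seq c d, _, _, _, h => fun h1 =>
      wp_mono K c _ _ _ (fun s' h2 => wp_mono K d s' _ _ h h2) h1
  | cond _ c, _, _, _, h => fun ⟨h1, h2, h3⟩ =>
      ⟨h1, fun h0 => h _ (h2 h0), fun h0 => wp_mono K c _ _ _ h (h3 h0)⟩
  | rep _ _ c, _, _, _, h => fun ⟨h1, h2, h3⟩ =>
      ⟨h1, h2, wpIter_mono (wp_mono K c) h _ _ h3⟩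

/-- The loop rule. -/
theorem Cmd.wp_rep {K : Lim} {tag : Bool} {e : Ex} {c : Cmd} {s : St} {Q : St → Prop} {N : ℕ}
    (hN : e.eval s = N) (h1 : e.ok K.S s) (h2 : N ≤ K.bd tag) (I : ℕ → St → Prop) (h0 : I 0 s)
    (step : ∀ i s, i < N → I i s → c.wp K s (I (i + 1))) (last : ∀ s, I N s → Q s) :
    (rep tag e c).wp K s Q :=
  ⟨h1, hN ▸ h2, hN ▸ wpIter_inv (Cmd.wp_mono K c) I step last s h0⟩

/-! ### Compilation -/

/-- Register numbers: `0` to `31` for variables, `32` to `47` for loop counters, the others for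
temporary values. -/
def rg (i : ℕ) : Fin 80 := Fin.ofNat 80 i

theorem rg_inj {i j : ℕ} (hi : i < 80) (hj : j < 80) : rg i = rg j ↔ i = j := by
  simp [rg, Fin.ext_iff, Nat.mod_eq_of_lt hi, Nat.mod_eq_of_lt hj]

def Op.instr (o : Op) (d a b : Fin 80) : RAM.Instr 80 :=
  match o with
  | .add => .add d a b
  | .sub => .sub d a b
  | .mul => .mul d a b
  | .div => .div d a b

def Ex.comp : Ex → ℕ → RAM.Program 80
  | num c, t => [.const (rg t) c]
  | var x, t => [.const (rg t) 0, .add (rg t) (rg t) (rg x)]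
  | bin o a b, t => a.comp t ++ (b.comp (t + 1) ++ [o.instr (rg t) (rg t) (rg (t + 1))])
  | load a, t => a.comp t ++ [.load (rg t) (rg t)]

/-- The code of a command that starts at line `o`, inside of `k` loops. -/
def Cmd.comp : Cmd → ℕ → ℕ → RAM.Program 80
  | assign x e, _, _ => e.comp 48 ++ [.const (rg 49) 0, .add (rg x) (rg 48) (rg 49)]
  | store a e, _, _ => a.comp 48 ++ (e.comp 49 ++ [.store (rg 48) (rg 49)])
  | seq c d, o, k => c.comp o k ++ d.comp (o + c.len) k
  | cond e c, o, k =>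
      e.comp 48 ++ (.jz (rg 48) (o + e.len + 1 + c.len) :: c.comp (o + e.len + 1) k)
  | rep _ e c, o, k =>
      e.comp 48 ++ (.const (rg 49) 0 :: .add (rg (32 + k)) (rg 48) (rg 49) ::
        .jz (rg (32 + k)) (o + e.len + 2 + 1 + c.len + 3) ::
        (c.comp (o + e.len + 2 + 1) (k + 1) ++
          [.const (rg 48) 1, .sub (rg (32 + k)) (rg (32 + k)) (rg 48), .jmp (o + e.len + 2)]))

theorem Ex.length_comp (e : Ex) (t : ℕ) : (e.comp t).length = e.len := by
  induction e generalizing t with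
  | num c => rfl
  | var x => rfl
  | bin o a b iha ihb => simp [comp, len, iha, ihb]; omega
  | load a ih => simp [comp, len, ih]

theorem Cmd.length_comp (c : Cmd) (o k : ℕ) : (c.comp o k).length = c.len := by
  induction c generalizing o k with
  | assign x e => simp [comp, len, Ex.length_comp]
  | store a e => simp [comp, len, Ex.length_comp]; omega
  | seq c d ihc ihd => simp [comp, len, ihc, ihd]
  | cond e c ih => simp [comp, len, ih, Ex.length_comp]; omega
  | rep tag e c ih => simp [comp, len, ih, Ex.length_comp]; omega

/-! ### Code placement and resource-bounded runs of the machine. -/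

/-- The lines of `P` from line `o` on start with `l`. -/
def CodeAt (P : RAM.Program 80) (o : ℕ) (l : List (RAM.Instr 80)) : Prop :=
  ∀ i, i < l.length → P[o + i]? = l[i]?

theorem CodeAt.left {P : RAM.Program 80} {o : ℕ} {l l' : List (RAM.Instr 80)}
    (h : CodeAt P o (l ++ l')) : CodeAt P o l := fun i hi => by
  rw [h i (by simp; omega), List.getElem?_append_left hi]

theorem CodeAt.right {P : RAM.Program 80} {o o' : ℕ} {l l' : List (RAM.Instr 80)}
    (h : CodeAt P o (l ++ l')) (ho : o' = o + l.length) : CodeAt P o' l' := fun i hi => by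
  rw [ho, Nat.add_assoc, h _ (by simp; omega), List.getElem?_append_right (by omega)]
  simp

theorem CodeAt.head {P : RAM.Program 80} {o : ℕ} {I : RAM.Instr 80} {l : List (RAM.Instr 80)}
    (h : CodeAt P o (I :: l)) : P[o]? = some I := by
  simpa using h 0 (by simp)

theorem CodeAt.tail {P : RAM.Program 80} {o o' : ℕ} {I : RAM.Instr 80} {l : List (RAM.Instr 80)}
    (h : CodeAt P o (I :: l)) (ho : o' = o + 1) : CodeAt P o' l :=
  CodeAt.right (l := [I]) h ho

/-- All registers and memory cells are at most `B`. -/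
def Bd (B : ℕ) (c : RAM.Config 80) : Prop := (∀ i, c.reg i ≤ B) ∧ ∀ a, c.mem a ≤ B

/-- `Runs P B S k c c'`: in `k` steps, the program `P` goes from `c` to `c'`, with all values at
most `B` on the way and all accessed cells in `S`. -/
inductive Runs (P : RAM.Program 80) (B : ℕ) (S : Finset ℕ) :
    ℕ → RAM.Config 80 → RAM.Config 80 → Prop
  | refl (c) : Runs P B S 0 c c
  | head {k : ℕ} {c c' : RAM.Config 80} {I : RAM.Instr 80} (hI : P[c.pc]? = some I) (hB : Bd B c)
      (hS : I.accessed c ⊆ S) (hc : I.cost c ≤ 1 + 2 * B.size) (h : Runs P B S k (I.exec c) c') :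
      Runs P B S (k + 1) c c'

section
variable {P : RAM.Program 80} {B : ℕ} {S : Finset ℕ}

theorem Runs.trans {k l : ℕ} {c c' c'' : RAM.Config 80} (h : Runs P B S k c c')
    (h' : Runs P B S l c' c'') : Runs P B S (k + l) c c'' := by
  induction h with
  | refl c => simpa using h'
  | head hI hB hS hc _ ih => rw [Nat.add_right_comm]; exact .head hI hB hS hc (ih h')

theorem Runs.spec {k : ℕ} {c c' : RAM.Config 80} (h : Runs P B S k c c') :
    (RAM.step P)^[k] c = c' ∧ ∀ j < k, Bd B ((RAM.step P)^[j] c) ∧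
      RAM.stepAccessed P ((RAM.step P)^[j] c) ⊆ S ∧
      RAM.stepCost P ((RAM.step P)^[j] c) ≤ 1 + 2 * B.size := by
  induction h with
  | refl c => simp
  | @head k c c' I hI hB hS hc _ ih =>
    have hs : RAM.step P c = I.exec c := by simp [RAM.step, hI]
    refine ⟨by rw [Function.iterate_succ_apply, hs]; exact ih.1, fun j hj => ?_⟩
    cases j with
    | zero => simpa [RAM.stepAccessed, RAM.stepCost, hI] using ⟨hB, hS, hc⟩
    | succ j => rw [Function.iterate_succ_apply, hs]; exact ih.2 j (by omega)

theorem Runs.one {c : RAM.Config 80} {I : RAM.Instr 80} (hI : P[c.pc]? = some I) (hB : Bd B c)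
    (hS : I.accessed c ⊆ S) (hc : I.cost c ≤ 1 + 2 * B.size) : Runs P B S 1 c (I.exec c) :=
  .head hI hB hS hc (.refl _)

theorem Bd.size (h : Bd B c) (i : Fin 80) : (c.reg i).size ≤ B.size := Nat.size_le_size (h.1 i)

theorem Bd.set {c : RAM.Config 80} (h : Bd B c) {i : Fin 80} {v pc : ℕ} (hv : v ≤ B) :
    Bd B ⟨pc, Function.update c.reg i v, c.mem⟩ := by
  refine ⟨fun j => ?_, h.2⟩
  by_cases hj : j = i
  · subst hj; simpa using hv
  · simpa [hj] using h.1 j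

theorem Runs.const {c : RAM.Config 80} {d : Fin 80} {v : ℕ} (hI : P[c.pc]? = some (.const d v))
    (hB : Bd B c) (hv : v ≤ B) :
    Runs P B S 1 c ⟨c.pc + 1, Function.update c.reg d v, c.mem⟩ :=
  Runs.one hI hB (by simp [RAM.Instr.accessed])
    (by have := Nat.size_le_size hv; simp [RAM.Instr.cost]; omega)

theorem Runs.bin {c : RAM.Config 80} {o : Op} {d a b : Fin 80}
    (hI : P[c.pc]? = some (o.instr d a b)) (hB : Bd B c) :
    Runs P B S 1 c ⟨c.pc + 1, Function.update c.reg d (o.ap (c.reg a) (c.reg b)), c.mem⟩ := by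
  have ha := hB.size a
  have hb := hB.size b
  have := Runs.one (S := S) hI hB (by cases o <;> simp [Op.instr, RAM.Instr.accessed])
    (by cases o <;> simp [Op.instr, RAM.Instr.cost] <;> omega)
  cases o <;> exact this

theorem Runs.load {c : RAM.Config 80} {d a : Fin 80} (hI : P[c.pc]? = some (.load d a))
    (hB : Bd B c) (hS : c.reg a ∈ S) :
    Runs P B S 1 c ⟨c.pc + 1, Function.update c.reg d (c.mem (c.reg a)), c.mem⟩ :=
  Runs.one hI hB (by simpa [RAM.Instr.accessed] using hS)
    (by have := hB.size a; have := Nat.size_le_size (hB.2 (c.reg a)); simp [RAM.Instr.cost]; omega)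

theorem Runs.store {c : RAM.Config 80} {a b : Fin 80} (hI : P[c.pc]? = some (.store a b))
    (hB : Bd B c) (hS : c.reg a ∈ S) :
    Runs P B S 1 c ⟨c.pc + 1, c.reg, Function.update c.mem (c.reg a) (c.reg b)⟩ :=
  Runs.one hI hB (by simpa [RAM.Instr.accessed] using hS)
    (by have := hB.size a; have := hB.size b; simp [RAM.Instr.cost]; omega)

theorem Runs.jz {c : RAM.Config 80} {a : Fin 80} {l : ℕ} (hI : P[c.pc]? = some (.jz a l))
    (hB : Bd B c) :
    Runs P B S 1 c ⟨if c.reg a = 0 then l else c.pc + 1, c.reg, c.mem⟩ :=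
  Runs.one hI hB (by simp [RAM.Instr.accessed])
    (by have := hB.size a; simp [RAM.Instr.cost]; omega)

theorem Runs.jmp {c : RAM.Config 80} {l : ℕ} (hI : P[c.pc]? = some (.jmp l)) (hB : Bd B c) :
    Runs P B S 1 c ⟨l, c.reg, c.mem⟩ :=
  Runs.one hI hB (by simp [RAM.Instr.accessed]) (by simp [RAM.Instr.cost])

end

/-- The machine configuration `c` represents the state `s`. -/
def Rel (s : St) (c : RAM.Config 80) : Prop := (∀ x < 32, c.reg (rg x) = s.reg x) ∧ c.mem = s.mem

/-- The variables and the memory cells are at most `M`. -/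
def Bs (M : ℕ) (s : St) : Prop := (∀ x < 32, s.reg x ≤ M) ∧ ∀ a, s.mem a ≤ M

/-- Both powers are at least `2`, so their product dominates their sum as well; thus degrees may be
added whatever the operation. -/
theorem Op.ap_le (o : Op) {M a b i j : ℕ} (hM : 2 ≤ M) (hi : 0 < i) (hj : 0 < j) (ha : a ≤ M ^ i)
    (hb : b ≤ M ^ j) : o.ap a b ≤ M ^ (i + j) := by
  have h1 : 2 ≤ M ^ i := hM.trans (Nat.le_self_pow hi.ne' M)
  have h2 : 2 ≤ M ^ j := hM.trans (Nat.le_self_pow hj.ne' M)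
  have h3 : M ^ i ≤ M ^ i * M ^ j := Nat.le_mul_of_pos_right _ (by omega)
  rw [pow_add]
  cases o with
  | add => simp only [Op.ap]; nlinarith
  | sub => exact (Nat.sub_le _ _).trans (ha.trans h3)
  | mul => exact Nat.mul_le_mul ha hb
  | div => exact (Nat.div_le_self _ _).trans (ha.trans h3)

theorem Ex.deg_pos (e : Ex) : 0 < e.deg := by
  induction e <;> simp [deg]; omega

theorem Ex.eval_le (e : Ex) {M : ℕ} (hM : 8 ≤ M) {s : St} (hs : Bs M s) (hw : e.wf = true) :
    e.eval s ≤ M ^ e.deg := by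
  induction e with
  | num c => simp [wf] at hw; simp [deg]; omega
  | var x => simp [wf] at hw; simpa [deg] using hs.1 x hw
  | bin o a b iha ihb =>
    simp [wf] at hw
    exact o.ap_le (by omega) a.deg_pos b.deg_pos (iha hw.1) (ihb hw.2)
  | load a _ => exact (hs.2 _).trans (Nat.le_self_pow (by simp [deg]) M)

/-- The registers from `t` on form an evaluation stack. The clause on registers below `t` keeps the
left operand alive while the right one is computed, and protects variables and loop counters. -/
theorem Ex.comp_spec {P : RAM.Program 80} {S : Finset ℕ} {M D : ℕ} (hM : 8 ≤ M) {s : St}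
    (hs : Bs M s) (e : Ex) : ∀ (t : ℕ) (c : RAM.Config 80), CodeAt P c.pc (e.comp t) → Rel s c →
    Bd (M ^ D) c → 48 ≤ t → t + e.tmp ≤ 80 → e.wf = true → e.deg ≤ D → e.ok S s →
    ∃ c', Runs P (M ^ D) S e.len c c' ∧ c'.pc = c.pc + e.len ∧ Rel s c' ∧ Bd (M ^ D) c' ∧
      c'.reg (rg t) = e.eval s ∧ ∀ i < t, c'.reg (rg i) = c.reg (rg i) := by
  induction e with
  | num v =>
    intro t c hc hr hb ht ht' hw hd hok
    simp only [wf, decide_eq_true_eq] at hw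
    simp only [tmp] at ht'
    have hv : v ≤ M ^ D := (hw.trans hM).trans (Nat.le_self_pow (by simp [deg] at hd; omega) M)
    refine ⟨_, Runs.const hc.head hb hv, rfl, ⟨fun x hx => ?_, hr.2⟩, hb.set hv, by simp,
      fun i hi => ?_⟩
    · simpa [rg_inj (i := x) (j := t) (by omega) (by omega), show x ≠ t by omega] using hr.1 x hx
    · simp [rg_inj (i := i) (j := t) (by omega) (by omega), show i ≠ t by omega]
  | var x =>
    intro t c hc hr hb ht ht' hw hd hok
    simp only [wf, decide_eq_true_eq] at hw
    simp only [tmp] at ht'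
    have h1 : Runs P (M ^ D) S 1 c _ := Runs.const hc.head hb (Nat.zero_le _)
    have hb1 := hb.set (i := rg t) (pc := c.pc + 1) (Nat.zero_le (M ^ D))
    have h2 := h1.trans (Runs.bin (o := .add) (hc.tail rfl).head hb1)
    refine ⟨_, h2, rfl, ⟨fun y hy => ?_, hr.2⟩, ?_, ?_, fun i hi => ?_⟩
    · simpa [rg_inj (i := y) (j := t) (by omega) (by omega), show y ≠ t by omega] using hr.1 y hy
    · refine hb1.set ?_
      simpa [Op.ap, rg_inj (i := x) (j := t) (by omega) (by omega), show x ≠ t by omega]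
        using hb.1 _
    · simpa [Op.ap, rg_inj (i := x) (j := t) (by omega) (by omega), show x ≠ t by omega]
        using hr.1 x hw
    · simp [rg_inj (i := i) (j := t) (by omega) (by omega), show i ≠ t by omega]
  | bin o a b iha ihb =>
    intro t c hc hr hb ht ht' hw hd hok
    have hle := (bin o a b).eval_le hM hs hw
    simp only [wf, Bool.and_eq_true] at hw
    simp only [tmp] at ht'
    have hda : a.deg ≤ D ∧ b.deg ≤ D := by simp only [deg] at hd; omega
    obtain ⟨c1, r1, p1, l1, b1, e1, f1⟩ := iha t c hc.left hr hb ht (by omega) hw.1 hda.1 hok.1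
    have hc1 : CodeAt P c1.pc _ := hc.right (by rw [p1, a.length_comp])
    obtain ⟨c2, r2, p2, l2, b2, e2, f2⟩ := ihb (t + 1) c1 hc1.left l1 b1 (by omega) (by omega)
      hw.2 hda.2 hok.2
    have hc2 : CodeAt P c2.pc _ := hc1.right (by rw [p2, b.length_comp])
    have hv : o.ap (c2.reg (rg t)) (c2.reg (rg (t + 1))) = (bin o a b).eval s := by
      rw [e2, f2 t (by omega), e1]; rfl
    have r3 := Runs.bin (S := S) hc2.head b2
    rw [hv] at r3
    refine ⟨_, (r1.trans r2).trans r3, by simp [len, p2, p1]; omega, ⟨fun x hx => ?_, l2.2⟩,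
      b2.set (hle.trans (Nat.pow_le_pow_right (by omega) hd)), by simp, fun i hi => ?_⟩
    · simpa [rg_inj (i := x) (j := t) (by omega) (by omega), show x ≠ t by omega] using l2.1 x hx
    · simp [rg_inj (i := i) (j := t) (by omega) (by omega), show i ≠ t by omega, f1 i hi,
        f2 i (by omega)]
  | load a iha =>
    intro t c hc hr hb ht ht' hw hd hok
    simp only [tmp] at ht'
    have hda : a.deg ≤ D ∧ 1 ≤ D := by simp only [deg] at hd; omega
    obtain ⟨c1, r1, p1, l1, b1, e1, f1⟩ := iha t c hc.left hr hb ht (by omega) hw hda.1 hok.1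
    have hc1 : CodeAt P c1.pc _ := hc.right (by rw [p1, a.length_comp])
    have r2 := Runs.load (S := S) hc1.head b1 (by rw [e1]; exact hok.2)
    have hv : c1.mem (c1.reg (rg t)) = (load a).eval s := by rw [e1, l1.2]; rfl
    rw [hv] at r2
    have ht2 : t < 80 := by
      have : 0 < a.tmp := by
        clear * -
        induction a with
        | num | var => simp [tmp]
        | bin o a b iha ihb => simp [tmp]
        | load a ih => simpa [tmp] using ih
      omega
    refine ⟨_, r1.trans r2, by simp [len, p1]; omega, ⟨fun x hx => ?_, l1.2⟩,
      b1.set (hv ▸ b1.2 _), by simp, fun i hi => ?_⟩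
    · simpa [rg_inj (i := x) (j := t) (by omega) (by omega), show x ≠ t by omega] using l1.1 x hx
    · simp [rg_inj (i := i) (j := t) (by omega) (by omega), show i ≠ t by omega, f1 i hi]

end Loop

/-! ### Correctness of the compiled commands. -/

namespace Loop

theorem Ex.good_spec {e : Ex} (h : e.good = true) : e.wf = true ∧ e.tmp ≤ 31 ∧ e.deg ≤ 64 := by
  simpa [good, and_assoc] using h

/-- The machine has no copy instruction; adding the cleared register `49` takes its place. -/
theorem Runs.move {P : RAM.Program 80} {B : ℕ} {S : Finset ℕ} {c : RAM.Config 80} {d : ℕ}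
    {l : List (RAM.Instr 80)} (hd : d < 48)
    (hc : CodeAt P c.pc (.const (rg 49) 0 :: .add (rg d) (rg 48) (rg 49) :: l)) (hb : Bd B c) :
    ∃ c', Runs P B S 2 c c' ∧ c'.pc = c.pc + 2 ∧ c'.mem = c.mem ∧ Bd B c' ∧
      c'.reg (rg d) = c.reg (rg 48) ∧ ∀ i < 48, i ≠ d → c'.reg (rg i) = c.reg (rg i) := by
  have hb1 := hb.set (i := rg 49) (pc := c.pc + 1) (Nat.zero_le B)
  have h2 := (Runs.const (S := S) hc.head hb (Nat.zero_le _)).trans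
    (Runs.bin (o := .add) (hc.tail rfl).head hb1)
  have h48 : rg 48 ≠ rg 49 := by simp [rg_inj]
  refine ⟨_, h2, rfl, rfl, ?_, ?_, fun i hi hid => ?_⟩
  · refine hb1.set ?_
    simpa [Op.ap, h48] using hb.1 _
  · simp [Op.ap, h48]
  · simp [rg_inj (i := i) (j := d) (by omega) (by omega), hid,
      rg_inj (i := i) (j := 49) (by omega) (by omega), show i ≠ 49 by omega]

theorem Rel.set {s : St} {c c' : RAM.Config 80} {x v : ℕ} (h : Rel s c) (hx : x < 32)
    (hm : c'.mem = c.mem) (hv : c'.reg (rg x) = v)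
    (hr : ∀ i < 48, i ≠ x → c'.reg (rg i) = c.reg (rg i)) :
    Rel ⟨Function.update s.reg x v, s.mem⟩ c' := by
  refine ⟨fun y hy => ?_, hm.trans h.2⟩
  by_cases hyx : y = x
  · subst hyx; simpa using hv
  · simpa [hyx] using (hr y (by omega) hyx).trans (h.1 y hy)

theorem Rel.of_eq {s : St} {c c' : RAM.Config 80} (h : Rel s c) (hm : c'.mem = c.mem)
    (hr : ∀ i < 32, c'.reg (rg i) = c.reg (rg i)) : Rel s c' :=
  ⟨fun x hx => (hr x hx).trans (h.1 x hx), hm.trans h.2⟩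

/-- The compiled command does what the command does. -/
theorem Cmd.comp_spec {P : RAM.Program 80} {K : Lim} (hM : 8 ≤ K.M) (cmd : Cmd) :
    ∀ (k : ℕ) (c : RAM.Config 80) (s : St) (Q : St → Prop), CodeAt P c.pc (cmd.comp c.pc k) →
    k ≤ 16 → Rel s c → Bs K.M s → Bd (K.M ^ 64) c → cmd.wf k = true → cmd.wp K s Q →
    ∃ t c' s', t ≤ cmd.time K.bd ∧ Runs P (K.M ^ 64) K.S t c c' ∧ c'.pc = c.pc + cmd.len ∧
      Rel s' c' ∧ Bs K.M s' ∧ Bd (K.M ^ 64) c' ∧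
      (∀ i < k, c'.reg (rg (32 + i)) = c.reg (rg (32 + i))) ∧ Q s' := by
  induction cmd with
  | assign x e =>
    intro k c s Q hc hk hr hs hb hw ⟨hok, hv, hQ⟩
    simp only [wf, Bool.and_eq_true, decide_eq_true_eq] at hw
    obtain ⟨g1, g2, g3⟩ := e.good_spec hw.2
    obtain ⟨c1, r1, p1, l1, b1, e1, f1⟩ := e.comp_spec hM hs 48 c hc.left hr hb le_rfl (by omega)
      g1 g3 hok
    have hc1 : CodeAt P c1.pc _ := hc.right (by rw [p1, e.length_comp])
    obtain ⟨c2, r2, p2, m2, b2, e2, f2⟩ := Runs.move (S := K.S) (by omega) hc1 b1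
    refine ⟨_, c2, _, le_rfl, r1.trans r2, by rw [p2, p1]; simp [len]; omega,
      l1.set hw.1 m2 (e2.trans e1) f2, ⟨fun y hy => ?_, hs.2⟩, b2, fun i hi => ?_, hQ⟩
    · by_cases h : y = x
      · subst h; simpa using hv
      · simpa [h] using hs.1 y hy
    · rw [f2 _ (by omega) (by omega), f1 _ (by omega)]
  | store a e =>
    intro k c s Q hc hk hr hs hb hw ⟨hoka, hok, hS, hv, hQ⟩
    simp only [wf, Bool.and_eq_true] at hw
    obtain ⟨g1, g2, g3⟩ := a.good_spec hw.1
    obtain ⟨g4, g5, g6⟩ := e.good_spec hw.2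
    obtain ⟨c1, r1, p1, l1, b1, e1, f1⟩ := a.comp_spec hM hs 48 c hc.left hr hb le_rfl (by omega)
      g1 g3 hoka
    have hc1 : CodeAt P c1.pc _ := hc.right (by rw [p1, a.length_comp])
    obtain ⟨c2, r2, p2, l2, b2, e2, f2⟩ := e.comp_spec hM hs 49 c1 hc1.left l1 b1 (by omega)
      (by omega) g4 g6 hok
    have hc2 : CodeAt P c2.pc _ := hc1.right (by rw [p2, e.length_comp])
    have e3 : c2.reg (rg 48) = a.eval s := by rw [f2 _ (by omega), e1]
    have r3 := Runs.store (S := K.S) hc2.head b2 (e3 ▸ hS)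
    rw [e3, e2, l2.2] at r3
    have hv' := hv.trans (Nat.le_self_pow (n := 64) (by omega) K.M)
    refine ⟨_, _, ⟨s.reg, Function.update s.mem (a.eval s) (e.eval s)⟩, le_rfl,
      (r1.trans r2).trans r3, by simp [len, p1, p2]; omega,
      ⟨l2.1, rfl⟩, ⟨hs.1, fun b => ?_⟩, ⟨b2.1, fun b => ?_⟩, fun i hi => ?_, hQ⟩
    · by_cases h : b = a.eval s
      · subst h; simpa using hv
      · simpa [h] using hs.2 b
    · by_cases h : b = a.eval s
      · subst h; simpa using hv'
      · simpa [h] using (l2.2 ▸ b2.2 b : s.mem b ≤ _)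
    · show c2.reg _ = _
      rw [f2 _ (by omega), f1 _ (by omega)]
  | seq x y ihx ihy =>
    intro k c s Q hc hk hr hs hb hw hwp
    simp only [wf, Bool.and_eq_true] at hw
    obtain ⟨t1, c1, s1, ht1, r1, p1, l1, bs1, b1, f1, q1⟩ :=
      ihx k c s _ hc.left hk hr hs hb hw.1 hwp
    have hc1 : CodeAt P c1.pc (y.comp c1.pc k) := by
      have := hc.right (o' := c1.pc) (by rw [p1, x.length_comp])
      rwa [← p1] at this
    obtain ⟨t2, c2, s2, ht2, r2, p2, l2, bs2, b2, f2, q2⟩ :=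
      ihy k c1 s1 _ hc1 hk l1 bs1 b1 hw.2 q1
    refine ⟨_, c2, s2, Nat.add_le_add ht1 ht2, r1.trans r2, by rw [p2, p1]; simp [len]; omega,
      l2, bs2, b2, fun i hi => by rw [f2 i hi, f1 i hi], q2⟩
  | cond e x ih =>
    intro k c s Q hc hk hr hs hb hw ⟨hok, h0, h1⟩
    simp only [wf, Bool.and_eq_true] at hw
    obtain ⟨g1, g2, g3⟩ := e.good_spec hw.1
    obtain ⟨c1, r1, p1, l1, b1, e1, f1⟩ := e.comp_spec hM hs 48 c hc.left hr hb le_rfl (by omega)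
      g1 g3 hok
    have hc1 : CodeAt P c1.pc _ := hc.right (by rw [p1, e.length_comp])
    have r2 := Runs.jz (S := K.S) hc1.head b1
    by_cases hv : e.eval s = 0
    · rw [if_pos (e1.trans hv)] at r2
      refine ⟨_, _, s, ?_, r1.trans r2, by simp [len]; omega, ⟨l1.1, l1.2⟩, hs, ⟨b1.1, b1.2⟩,
        fun i hi => f1 _ (by omega), h0 hv⟩
      simp [time]
    · rw [if_neg (by rw [e1]; exact hv)] at r2
      obtain ⟨t3, c3, s3, ht3, r3, p3, l3, bs3, b3, f3, q3⟩ := ih k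
        ⟨c1.pc + 1, c1.reg, c1.mem⟩ s Q (by
          have := hc1.tail rfl
          rwa [p1] at this ⊢) hk ⟨l1.1, l1.2⟩ hs ⟨b1.1, b1.2⟩ hw.2 (h1 hv)
      refine ⟨_, c3, s3, ?_, (r1.trans r2).trans r3, by rw [p3]; simp [len, p1]; omega, l3, bs3,
        b3, fun i hi => by rw [f3 i hi]; exact f1 _ (by omega), q3⟩
      simp [time]; omega
  | rep tag e x ih =>
    intro k c s Q hc hk hr hs hb hw ⟨hok, hN, hit⟩
    simp only [wf, Bool.and_eq_true, decide_eq_true_eq] at hw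
    obtain ⟨g1, g2, g3⟩ := e.good_spec hw.1.1
    obtain ⟨c1, r1, p1, l1, b1, e1, f1⟩ := e.comp_spec hM hs 48 c hc.left hr hb le_rfl (by omega)
      g1 g3 hok
    have hc1 : CodeAt P c1.pc _ := hc.right (by rw [p1, e.length_comp])
    obtain ⟨c2, r2, p2, m2, b2, e2, f2⟩ := Runs.move (S := K.S) (by omega) hc1 b1
    have hc2 : CodeAt P (c.pc + e.len + 2) _ :=
      (hc1.tail rfl).tail (o' := c.pc + e.len + 2) (by rw [p1])
    have l2 := l1.of_eq m2 fun i hi => f2 i (by omega) (by omega)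
    have hp2 : c2.pc = c.pc + e.len + 2 := by rw [p2, p1]
    rw [e1] at e2
    generalize e.eval s = N at hN hit e2
    -- Register `32 + k` holds the number of remaining rounds. The body is compiled at depth `k + 1`
    -- and so leaves this register alone, which permits induction on its value.
    have hloop : ∀ (N : ℕ) (d : RAM.Config 80) (s : St), d.pc = c.pc + e.len + 2 → Rel s d →
        Bs K.M s → Bd (K.M ^ 64) d → d.reg (rg (32 + k)) = N → wpIter (x.wp K) N s Q →
        ∃ t d' s', t ≤ N * (1 + x.time K.bd + 3) + 1 ∧ Runs P (K.M ^ 64) K.S t d d' ∧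
          d'.pc = c.pc + e.len + 2 + 1 + x.len + 3 ∧ Rel s' d' ∧ Bs K.M s' ∧ Bd (K.M ^ 64) d' ∧
          (∀ i < k, d'.reg (rg (32 + i)) = d.reg (rg (32 + i))) ∧ Q s' := by
      intro N
      induction N with
      | zero =>
        intro d s hd hr hs hb hv hit
        rw [← hd] at hc2
        have r := Runs.jz (S := K.S) hc2.head hb
        rw [if_pos hv] at r
        exact ⟨_, _, s, by omega, r, by simp [hd], ⟨hr.1, hr.2⟩, hs, ⟨hb.1, hb.2⟩,
          fun i hi => rfl, hit⟩
      | succ N ihN =>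
        intro d s hd hr hs hb hv hit
        have hc3 := hc2
        rw [← hd] at hc3
        have r := Runs.jz (S := K.S) hc3.head hb
        rw [if_neg (by rw [hv]; omega)] at r
        have hc4 := hc3.tail rfl
        obtain ⟨t3, c3, s3, ht3, r3, p3, l3, bs3, b3, f3, q3⟩ := ih (k + 1)
          ⟨d.pc + 1, d.reg, d.mem⟩ s _ hc4.left (by omega) ⟨hr.1, hr.2⟩ hs ⟨hb.1, hb.2⟩ hw.2 hit
        have hc5 : CodeAt P c3.pc _ := hc4.right (by rw [p3, x.length_comp])
        have hone : 1 ≤ K.M ^ 64 := Nat.one_le_pow _ _ (by omega)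
        have r4 := Runs.const (S := K.S) hc5.head b3 hone
        have b4 := b3.set (i := rg 48) (pc := c3.pc + 1) hone
        have r5 := Runs.bin (S := K.S) (o := .sub) (hc5.tail rfl).head b4
        have hk48 : rg (32 + k) ≠ rg 48 := by
          rw [Ne, rg_inj (by omega) (by omega)]; omega
        have hval : Op.sub.ap (Function.update c3.reg (rg 48) 1 (rg (32 + k)))
            (Function.update c3.reg (rg 48) 1 (rg 48)) = N := by
          have := (f3 k (by omega)).trans hv
          simp [Op.ap, hk48, this]
        simp only [hval] at r5
        have hNle : N ≤ K.M ^ 64 := by have := hb.1 (rg (32 + k)); omega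
        have b5 := b4.set (i := rg (32 + k)) (pc := c3.pc + 1 + 1) hNle
        have r6 := Runs.jmp (S := K.S) ((hc5.tail rfl).tail rfl).head b5
        have hreg : ∀ i < 48, i ≠ 32 + k → Function.update (Function.update c3.reg (rg 48) 1)
            (rg (32 + k)) N (rg i) = c3.reg (rg i) := fun i hi hik => by
          simp [rg_inj (i := i) (j := 32 + k) (by omega) (by omega), hik,
            rg_inj (i := i) (j := 48) (by omega) (by omega), show i ≠ 48 by omega]
        obtain ⟨t7, c7, s7, ht7, r7, p7, l7, bs7, b7, f7, q7⟩ := ihN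
          ⟨c.pc + e.len + 2, Function.update (Function.update c3.reg (rg 48) 1) (rg (32 + k)) N,
            c3.mem⟩ s3 rfl
          ⟨fun y hy => (hreg y (by omega) (by omega)).trans (l3.1 y hy), l3.2⟩ bs3
          ⟨b5.1, b5.2⟩ (by simp) q3
        rw [hd] at r6
        refine ⟨_, c7, s7, ?_, ((((r.trans r3).trans r4).trans r5).trans r6).trans r7, p7, l7, bs7,
          b7, fun i hi => ?_, q7⟩
        · rw [Nat.succ_mul]; omega
        · exact (f7 i hi).trans ((hreg _ (by omega) (by omega)).trans (f3 i (by omega)))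
    obtain ⟨t3, c3, s3, ht3, r3, p3, l3, bs3, b3, f3, q3⟩ := hloop N c2 s hp2 l2 hs b2 e2 hit
    refine ⟨_, c3, s3, ?_, (r1.trans r2).trans r3, by rw [p3]; simp [len]; omega, l3, bs3, b3,
      fun i hi => ?_, q3⟩
    · have := Nat.mul_le_mul_right (1 + x.time K.bd + 3) hN
      simp only [time]; omega
    · rw [f3 i hi, f2 _ (by omega) (by omega), f1 _ (by omega)]

end Loop

/-! ### Time and space of compiled programs. -/

namespace Loop

/-- The machine program of a command. -/
def Cmd.prog (c : Cmd) : RAM.Program 80 := c.comp 0 0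

/-- Resources of the compiled program. -/
theorem Cmd.prog_spec {K : Lim} (hM : 8 ≤ K.M) (cmd : Cmd) (hw : cmd.wf 0 = true) (input : List ℕ)
    (hin : ∀ v ∈ input, v ≤ K.M) (hS : Finset.range input.length ⊆ K.S) (hS' : ∀ a ∈ K.S, a ≤ K.M)
    (R : (ℕ → ℕ) → Prop) (hwp : cmd.wp K ⟨fun _ => 0, fun a => input.getD a 0⟩ fun s => R s.mem) :
    ∃ k, RAM.Halted cmd.prog (RAM.conf cmd.prog input k) ∧ R (RAM.conf cmd.prog input k).mem ∧
      RAM.time cmd.prog input k ≤ cmd.time K.bd * (1 + 2 * (K.M ^ 64).size) ∧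
      RAM.space cmd.prog input k ≤ (80 + K.S.card) * (1 + 2 * (K.M ^ 64).size) := by
  have hMB : K.M ≤ K.M ^ 64 := Nat.le_self_pow (by omega) _
  have hmem : ∀ a, input.getD a 0 ≤ K.M := fun a => by
    by_cases h : a < input.length
    · rw [List.getD_eq_getElem _ _ h]; exact hin _ (List.getElem_mem h)
    · rw [List.getD_eq_default _ _ (not_lt.mp h)]; exact Nat.zero_le _
  obtain ⟨t, c, s, ht, hr, hpc, hrel, -, hb, -, hR⟩ := cmd.comp_spec (P := cmd.prog) hM 0
    (RAM.init 80 input) ⟨fun _ => 0, fun a => input.getD a 0⟩ _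
    (fun i _ => by simp [RAM.init, prog]) (by omega) ⟨fun _ _ => rfl, rfl⟩
    ⟨fun _ _ => Nat.zero_le _, hmem⟩ ⟨fun _ => Nat.zero_le _, fun a => (hmem a).trans hMB⟩ hw hwp
  obtain ⟨h1, h2⟩ := hr.spec
  have hc : RAM.conf cmd.prog input t = c := h1
  refine ⟨t, ?_, by rw [hc, hrel.2]; exact hR, ?_, ?_⟩
  · rw [hc, RAM.Halted, hpc]
    simp [RAM.init, prog, Cmd.length_comp]
  · refine (Finset.sum_le_card_nsmul _ _ _ fun j hj => (h2 j (Finset.mem_range.mp hj)).2.2).trans ?_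
    rw [Finset.card_range, smul_eq_mul]
    exact Nat.mul_le_mul_right _ ht
  · refine Finset.sup_le fun j hj => ?_
    have hbj : Bd (K.M ^ 64) (RAM.conf cmd.prog input j) := by
      rcases (Nat.lt_succ_iff_lt_or_eq.mp (Finset.mem_range.mp hj)) with h | h
      · exact (h2 j h).1
      · rw [h, hc]; exact hb
    have hcells : RAM.cellsUsed cmd.prog input t ⊆ K.S :=
      Finset.union_subset hS (Finset.biUnion_subset.mpr fun i hi =>
        (h2 i (Finset.mem_range.mp hi)).2.1)
    have e1 : ∑ i : Fin 80, (1 + ((RAM.conf cmd.prog input j).reg i).size) ≤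
        80 * (1 + 2 * (K.M ^ 64).size) := by
      refine (Finset.sum_le_card_nsmul _ _ (1 + 2 * (K.M ^ 64).size) fun i _ => ?_).trans (by simp)
      have := hbj.size i
      omega
    have e2 : ∑ a ∈ RAM.cellsUsed cmd.prog input t,
        (1 + a.size + ((RAM.conf cmd.prog input j).mem a).size) ≤
        K.S.card * (1 + 2 * (K.M ^ 64).size) := by
      refine (Finset.sum_le_sum_of_subset hcells).trans
        ((Finset.sum_le_card_nsmul _ _ (1 + 2 * (K.M ^ 64).size) fun a ha => ?_).trans (by simp))
      have := Nat.size_le_size ((hS' a ha).trans hMB)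
      have := Nat.size_le_size (hbj.2 a)
      omega
    rw [Nat.add_mul]
    exact Nat.add_le_add e1 e2

/-- The nesting depth of the loops with a given tag. -/
def Cmd.depth (tag : Bool) : Cmd → ℕ
  | assign _ _ => 0
  | store _ _ => 0
  | seq c d => max (c.depth tag) (d.depth tag)
  | cond _ c => c.depth tag
  | rep t _ c => c.depth tag + if t = tag then 1 else 0

/-- In a loop, `7` is the sum of the three steps spent once besides evaluating `e` and the four
overhead steps of each round. -/
def Cmd.weight : Cmd → ℕ
  | assign _ e => e.len + 2
  | store a e => a.len + e.len + 1
  | seq c d => c.weight + d.weight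
  | cond e c => e.len + 1 + c.weight
  | rep _ e c => e.len + 7 + c.weight

/-- Each enclosing loop contributes one factor. The `+ 1` in the factors pays for the code outside
the body and makes the product monotone in the depths, as the maximum in a sequence requires. -/
theorem Cmd.time_le (bd : Bool → ℕ) (c : Cmd) :
    c.time bd ≤ c.weight * ((bd false + 1) ^ c.depth false * (bd true + 1) ^ c.depth true) := by
  have hpos : ∀ i j, 1 ≤ (bd false + 1) ^ i * (bd true + 1) ^ j := fun i j =>
    Nat.one_le_iff_ne_zero.mpr (by positivity)
  have hmono : ∀ {i i' j j'}, i ≤ i' → j ≤ j' → (bd false + 1) ^ i * (bd true + 1) ^ j ≤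
      (bd false + 1) ^ i' * (bd true + 1) ^ j' := fun hi hj =>
    Nat.mul_le_mul (Nat.pow_le_pow_right (by omega) hi) (Nat.pow_le_pow_right (by omega) hj)
  induction c with
  | assign x e => simp [time, weight, depth]
  | store a e => simp [time, weight, depth]
  | seq c d ihc ihd =>
    rw [time, weight, Nat.add_mul]
    exact Nat.add_le_add
      (ihc.trans (Nat.mul_le_mul_left _ (hmono (le_max_left _ _) (le_max_left _ _))))
      (ihd.trans (Nat.mul_le_mul_left _ (hmono (le_max_right _ _) (le_max_right _ _))))
  | cond e c ih =>
    rw [time, weight, Nat.add_mul]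
    exact Nat.add_le_add (Nat.le_mul_of_pos_right _ (hpos _ _)) ih
  | rep t e c ih =>
    have h : (bd false + 1) ^ (rep t e c).depth false * (bd true + 1) ^ (rep t e c).depth true =
        (bd t + 1) * ((bd false + 1) ^ c.depth false * (bd true + 1) ^ c.depth true) := by
      cases t <;> simp [depth, pow_succ] <;> ring
    rw [h, time, weight]
    have := hpos (c.depth false) (c.depth true)
    generalize (bd false + 1) ^ c.depth false * (bd true + 1) ^ c.depth true = X at *
    generalize bd t = b
    nlinarith [Nat.mul_le_mul_left b ih, Nat.zero_le (b * c.weight * X), Nat.zero_le (b * X),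
      Nat.mul_le_mul_left b this, Nat.mul_le_mul_left (e.len * b) this, Nat.zero_le (e.len * b),
      Nat.mul_le_mul_left e.len this, Nat.zero_le (c.weight * X)]

end Loop

namespace Loop

/-! ### Sets of natural numbers as bit masks -/

/-- The bit of `x` at position `i`, as a number. -/
def bt (x i : ℕ) : ℕ := x / 2 ^ i % 2

/-- The mask of a set. -/
def enc (X : Finset ℕ) : ℕ := ∑ i ∈ X, 2 ^ i

/-- The number of set bits at the positions below `n`. -/
def pop (n x : ℕ) : ℕ := ∑ i ∈ Finset.range n, bt x i

theorem bt_le (x i : ℕ) : bt x i ≤ 1 := Nat.lt_succ_iff.mp (Nat.mod_lt _ (by norm_num))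

theorem sum_bt (x n : ℕ) : ∑ i ∈ Finset.range n, bt x i * 2 ^ i = x % 2 ^ n := by
  induction n with
  | zero => simp [Nat.mod_one]
  | succ n ih => rw [Finset.sum_range_succ, ih, Nat.mod_pow_succ, bt, mul_comm]

theorem enc_lt {n : ℕ} {X : Finset ℕ} (h : X ⊆ Finset.range n) : enc X < 2 ^ n := by
  have h1 : enc X ≤ ∑ i ∈ Finset.range n, 2 ^ i := Finset.sum_le_sum_of_subset h
  rw [Nat.geomSum_eq le_rfl] at h1
  have := Nat.one_le_two_pow (n := n)
  simp at h1
  omega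

theorem enc_range (n : ℕ) : enc (Finset.range n) = 2 ^ n - 1 := by
  rw [enc, Nat.geomSum_eq le_rfl]; simp

theorem enc_insert {X : Finset ℕ} {i : ℕ} (h : i ∉ X) : enc (insert i X) = enc X + 2 ^ i := by
  rw [enc, Finset.sum_insert h, add_comm]; rfl

theorem enc_sdiff {n : ℕ} {X : Finset ℕ} (h : X ⊆ Finset.range n) :
    2 ^ n - 1 - enc X = enc (Finset.range n \ X) := by
  rw [← enc_range, enc, enc, enc, ← Finset.sum_sdiff h]; simp

/-- The elements below `i` contribute less than `2 ^ i`, the others a multiple of it; modulo `2`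
only the term of `i` itself survives in the quotient. -/
theorem bt_enc (X : Finset ℕ) (i : ℕ) : bt (enc X) i = if i ∈ X then 1 else 0 := by
  have hlow : enc (X.filter (· < i)) < 2 ^ i := enc_lt fun j hj => by
    simpa using (Finset.mem_filter.mp hj).2
  have hsplit : enc X = enc (X.filter (· < i)) + ∑ j ∈ X.filter (¬ · < i), 2 ^ j :=
    (Finset.sum_filter_add_sum_filter_not _ _ _).symm
  have hhigh : ∑ j ∈ X.filter (¬ · < i), 2 ^ j =
      2 ^ i * ∑ j ∈ X.filter (¬ · < i), 2 ^ (j - i) := by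
    rw [Finset.mul_sum]
    refine Finset.sum_congr rfl fun j hj => ?_
    rw [← pow_add, Nat.add_sub_cancel' (by simpa using (Finset.mem_filter.mp hj).2)]
  rw [bt, hsplit, hhigh, Nat.add_mul_div_left _ _ (by positivity), Nat.div_eq_of_lt hlow, zero_add,
    Finset.sum_nat_mod]
  rw [Finset.sum_congr rfl (g := fun j => if j = i then 1 else 0)]
  · rw [Finset.sum_ite_eq']
    simp
    split_ifs <;> simp
  · intro j hj
    have hj' : i ≤ j := by simpa using (Finset.mem_filter.mp hj).2
    by_cases h : j = i
    · simp [h]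
    · obtain ⟨d, hd⟩ : ∃ d, j - i = d + 1 := ⟨j - i - 1, by omega⟩
      simp [h, hd, pow_succ]

theorem enc_injective : Function.Injective enc := fun X Y h => by
  ext i
  have := bt_enc X i
  rw [h, bt_enc] at this
  by_cases h1 : i ∈ X <;> by_cases h2 : i ∈ Y <;> simp_all

theorem exists_enc {n x : ℕ} (h : x < 2 ^ n) : ∃ X ⊆ Finset.range n, enc X = x := by
  refine ⟨(Finset.range n).filter (bt x · = 1), Finset.filter_subset _ _, ?_⟩
  rw [enc, Finset.sum_filter]
  conv_rhs => rw [← Nat.mod_eq_of_lt h, ← sum_bt]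
  refine Finset.sum_congr rfl fun i _ => ?_
  rcases Nat.le_one_iff_eq_zero_or_eq_one.mp (bt_le x i) with h | h <;> simp [h]

theorem pop_enc {n : ℕ} {X : Finset ℕ} (h : X ⊆ Finset.range n) : pop n (enc X) = X.card := by
  rw [pop, Finset.sum_congr rfl fun i _ => bt_enc X i, Finset.sum_ite_mem,
    Finset.inter_eq_right.mpr h]
  simp

/-- The left side is what the inner loop of `fillC` accumulates, with a row of the adjacency matrix
for `f`. -/
theorem enc_filter {n : ℕ} {X : Finset ℕ} (h : X ⊆ Finset.range n) (f : ℕ → ℕ)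
    (hf : ∀ i < n, f i ≤ 1) :
    ∑ i ∈ Finset.range n, bt (enc X) i * (1 - f i) * 2 ^ i = enc (X.filter (f · = 0)) := by
  have : X.filter (f · = 0) = (Finset.range n).filter fun i => i ∈ X ∧ f i = 0 := by
    ext i
    simp only [Finset.mem_filter]
    exact ⟨fun ⟨h1, h2⟩ => ⟨h h1, h1, h2⟩, fun ⟨_, h1, h2⟩ => ⟨h1, h2⟩⟩
  rw [this, show enc (Finset.filter _ _) = _ from Finset.sum_filter _ _]
  refine Finset.sum_congr rfl fun i hi => ?_
  rw [bt_enc]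
  rcases Nat.le_one_iff_eq_zero_or_eq_one.mp (hf i (Finset.mem_range.mp hi)) with h | h <;>
    by_cases hX : i ∈ X <;> simp [h, hX]

/-- Binary addition with incoming carry `c`: at each position, output digit plus outgoing carry
never exceed the sum of the inputs. -/
theorem pop_add (n a b c : ℕ) (hc : c ≤ 1) : pop n (a + b + c) ≤ pop n a + pop n b + c := by
  have hs : ∀ n x, pop (n + 1) x = pop n (x / 2) + x % 2 := fun n x => by
    simp only [pop, Finset.sum_range_succ', bt, Nat.pow_succ', Nat.div_div_eq_div_mul]
    simp
  induction n generalizing a b c with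
  | zero => simp [pop]
  | succ n ih =>
    have h1 := ih (a / 2) (b / 2) ((a % 2 + b % 2 + c) / 2) (by omega)
    have h2 : (a + b + c) / 2 = a / 2 + b / 2 + (a % 2 + b % 2 + c) / 2 := by omega
    rw [hs, hs, hs, h2]
    omega

theorem pop_succ_le (n x : ℕ) : pop n (x + 1) ≤ pop n x + 1 := by
  have := pop_add n x 0 1 le_rfl
  have h0 : pop n 0 = 0 := by simp [pop, bt]
  simpa [h0] using this

/-! ### The lowest set bit and jumps between masks. -/

/-- `l` is the lowest set bit of `x` among the positions below `n`, or `2 ^ n`. -/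
def IsLow (n x l : ℕ) : Prop :=
  ∃ t ≤ n, l = 2 ^ t ∧ (∀ i < t, bt x i = 0) ∧ (t < n → bt x t = 1)

theorem isLow_zero (x : ℕ) : IsLow 0 x 1 := ⟨0, le_rfl, rfl, by simp, by simp⟩

/-- One round of `popC`: the candidate doubles as long as no set bit has been met. -/
theorem isLow_succ {n x l : ℕ} (h : IsLow n x l) :
    IsLow (n + 1) x (l * (1 + (1 - pop n x) * (1 - bt x n))) := by
  obtain ⟨t, ht, rfl, h0, h1⟩ := h
  rcases ht.lt_or_eq with hlt | rfl
  · have hpos : 1 ≤ pop n x := by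
      rw [← h1 hlt]
      exact Finset.single_le_sum (f := bt x) (fun _ _ => Nat.zero_le _) (Finset.mem_range.mpr hlt)
    exact ⟨t, by omega, by simp [Nat.sub_eq_zero_of_le hpos], h0, fun _ => h1 hlt⟩
  · have hpop : pop t x = 0 := Finset.sum_eq_zero fun i hi => h0 i (Finset.mem_range.mp hi)
    rcases Nat.le_one_iff_eq_zero_or_eq_one.mp (bt_le x t) with hb | hb
    · refine ⟨t + 1, le_rfl, by simp [hpop, hb, pow_succ], fun i hi => ?_, by simp⟩
      rcases Nat.lt_succ_iff_lt_or_eq.mp hi with h | h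
      · exact h0 i h
      · rw [h]; exact hb
    · exact ⟨t, by omega, by simp [hpop, hb], h0, fun _ => hb⟩

theorem IsLow.le {n x l : ℕ} (h : IsLow n x l) : 1 ≤ l ∧ l ≤ 2 ^ n := by
  obtain ⟨t, ht, rfl, -, -⟩ := h
  exact ⟨Nat.one_le_two_pow, Nat.pow_le_pow_right (by norm_num) ht⟩

/-- All bits of `x` below the lowest set one are zero, so adding less than `l` changes nothing above
them. This shows that a jump omits no mask with few bits. -/
theorem IsLow.pop_le {n x l z : ℕ} (h : IsLow n x l) (h1 : x ≤ z) (h2 : z < x + l) :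
    pop n x ≤ pop n z := by
  obtain ⟨t, ht, rfl, h0, -⟩ := h
  have hx : x % 2 ^ t = 0 := by
    rw [← sum_bt]
    exact Finset.sum_eq_zero fun i hi => by simp [h0 i (Finset.mem_range.mp hi)]
  have hz : z / 2 ^ t = x / 2 ^ t := by
    obtain ⟨q, rfl⟩ := Nat.dvd_of_mod_eq_zero hx
    rw [Nat.mul_div_cancel_left _ (by positivity)]
    exact Nat.div_eq_of_lt_le (by linarith) (by linarith)
  refine Finset.sum_le_sum fun i _ => ?_
  by_cases hi : i < t
  · simp [h0 i hi]
  · have : ∀ y, bt y i = y / 2 ^ t / 2 ^ (i - t) % 2 := fun y => by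
      rw [bt, Nat.div_div_eq_div_mul, ← pow_add, Nat.add_sub_cancel' (by omega)]
    rw [this, this, hz]

/-- The addition trades the lowest bit for a bit one position higher, and `pop_add` bounds the
effect of carries. Since `l` divides both `x` and `2 ^ n`, the sum cannot overshoot `2 ^ n`. -/
theorem IsLow.pop_add_le {n x l : ℕ} (h : IsLow n x l) (hx : x < 2 ^ n) (hpos : 0 < pop n x) :
    pop n (x + l) ≤ pop n x ∧ x + l ≤ 2 ^ n := by
  obtain ⟨t, ht, rfl, h0, h1⟩ := h
  obtain ⟨X, hX, rfl⟩ := exists_enc hx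
  have htn : t < n := by
    refine ht.lt_of_ne fun h => ?_
    subst h
    exact hpos.ne' (Finset.sum_eq_zero fun i hi => h0 i (Finset.mem_range.mp hi))
  have htX : t ∈ X := by
    have := h1 htn
    rw [bt_enc] at this
    by_contra h
    simp [h] at this
  have hmin : ∀ i ∈ X, t ≤ i := fun i hi => by
    by_contra h
    have := h0 i (by omega)
    simp [bt_enc, hi] at this
  constructor
  · have e1 : enc X + 2 ^ t = enc (X.erase t) + enc {t + 1} + 0 := by
      conv_lhs => rw [← Finset.insert_erase htX, enc_insert (Finset.notMem_erase t X)]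
      simp [enc, pow_succ]
      ring
    rw [e1]
    refine (pop_add n _ _ 0 (by omega)).trans ?_
    rw [pop_enc ((Finset.erase_subset _ _).trans hX), pop_enc hX, Finset.card_erase_of_mem htX]
    have h3 : 1 ≤ X.card := Finset.card_pos.mpr ⟨t, htX⟩
    have h4 : pop n (enc {t + 1}) ≤ 1 := by
      rw [pop, Finset.sum_congr rfl fun i _ => bt_enc _ i]
      simp only [Finset.mem_singleton, Finset.sum_ite_eq']
      split_ifs <;> omega
    omega
  · have h2 : 2 ^ t ∣ enc X := Finset.dvd_sum fun i hi => pow_dvd_pow 2 (hmin i hi)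
    obtain ⟨q, hq⟩ := h2
    obtain ⟨d, rfl⟩ := Nat.exists_eq_add_of_le ht
    rw [hq, pow_add] at hx ⊢
    have := Nat.lt_of_mul_lt_mul_left hx
    nlinarith [Nat.one_le_two_pow (n := t)]

/-- The masks with at most `m` bits below position `n`. -/
def lowMasks (n m : ℕ) : Finset ℕ := (Finset.range (2 ^ n)).filter (pop n · ≤ m)

/-- Expand `(1 + 4) ^ n` over subsets `t` as a sum of `4 ^ (n - t.card)`; each subset of size at
most `m` contributes at least `4 ^ (n - m)`. -/
theorem card_lowMasks (n m : ℕ) : (lowMasks n m).card * 4 ^ (n - m) ≤ 5 ^ n := by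
  have h1 : lowMasks n m ⊆ ((Finset.range n).powerset.filter (·.card ≤ m)).image enc := fun x hx => by
    obtain ⟨h1, h2⟩ := Finset.mem_filter.mp hx
    obtain ⟨X, hX, rfl⟩ := exists_enc (Finset.mem_range.mp h1)
    rw [pop_enc hX] at h2
    exact Finset.mem_image_of_mem _ (Finset.mem_filter.mpr ⟨Finset.mem_powerset.mpr hX, h2⟩)
  have h2 := (Finset.card_le_card h1).trans Finset.card_image_le
  have h3 := Finset.sum_pow_mul_eq_add_pow (1 : ℕ) 4 (Finset.range n)
  simp only [one_pow, one_mul, Finset.card_range] at h3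
  have h4 : ∑ t ∈ (Finset.range n).powerset.filter (·.card ≤ m), 4 ^ (n - m) ≤
      ∑ t ∈ (Finset.range n).powerset, 4 ^ (n - t.card) :=
    (Finset.sum_le_sum fun t ht => Nat.pow_le_pow_right (by norm_num)
      (Nat.sub_le_sub_left (Finset.mem_filter.mp ht).2 n)).trans
      (Finset.sum_le_sum_of_subset (Finset.filter_subset _ _))
  rw [h3, Finset.sum_const, smul_eq_mul] at h4
  exact (Nat.mul_le_mul_right _ h2).trans (by simpa using h4)

end Loop

namespace Loop

/-! ### Growing trees -/

/-- The vertices in a queue of pairs of a vertex and its parent. -/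
def verts (Q : List (ℕ × ℕ)) : Finset ℕ := (Q.map Prod.fst).toFinset

/-- Append to the queue those out-neighbours of `v` below `m` which are not yet in the queue. -/
def grow (A : ℕ → ℕ → ℕ) (Q : List (ℕ × ℕ)) (v : ℕ) : ℕ → List (ℕ × ℕ)
  | 0 => Q
  | j + 1 => if A v j = 1 ∧ j ∉ verts (grow A Q v j) then grow A Q v j ++ [(j, v)] else grow A Q v j

/-- Treat the queue vertices with the indices `h, …, h + m - 1`; the bits of `b` say which of them
are expanded, `c` counts the expanded vertices. -/
def sim (n : ℕ) (A : ℕ → ℕ → ℕ) : ℕ → ℕ → ℕ → List (ℕ × ℕ) → ℕ → List (ℕ × ℕ) × ℕ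
  | 0, _, _, Q, c => (Q, c)
  | m + 1, b, h, Q, c =>
    if hq : h < Q.length ∧ b % 2 = 1 then
      sim n A m (b / 2) (h + 1) (grow A Q (Q[h]'hq.1).1 n) (c + 1)
    else sim n A m (b / 2) (h + 1) Q c

/-- The part of `X` that is not dominated by `v`. -/
def cut (A : ℕ → ℕ → ℕ) (X : Finset ℕ) (v : ℕ) : Finset ℕ := X.filter (A v · = 0)

/-- The queue `Q` lists the vertices of a directed tree with root `r` whose inner vertices are in
`E`. -/
inductive WF (n : ℕ) (A : ℕ → ℕ → ℕ) (r : ℕ) (E : Finset ℕ) : List (ℕ × ℕ) → Prop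
  | root : WF n A r E [(r, r)]
  | snoc {Q : List (ℕ × ℕ)} {p j : ℕ} (hQ : WF n A r E Q) (hp : p ∈ verts Q) (hE : p ∈ E)
      (hj : j < n) (hA : A p j = 1) (h : j ∉ verts Q) : WF n A r E (Q ++ [(j, p)])

variable {n : ℕ} {A : ℕ → ℕ → ℕ} {r : ℕ} {E : Finset ℕ} {Q : List (ℕ × ℕ)}

theorem verts_append (Q : List (ℕ × ℕ)) (e : ℕ × ℕ) : verts (Q ++ [e]) = insert e.1 (verts Q) := by
  ext; simp [verts]

theorem mem_verts_of_mem {e : ℕ × ℕ} (h : e ∈ Q) : e.1 ∈ verts Q := by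
  simp only [verts, List.mem_toFinset, List.mem_map]; exact ⟨e, h, rfl⟩

theorem WF.mono {E' : Finset ℕ} (h : WF n A r E Q) (hE : E ⊆ E') : WF n A r E' Q := by
  induction h with
  | root => exact .root
  | snoc _ hp he hj hA h ih => exact .snoc ih hp (hE he) hj hA h

theorem WF.verts_subset (h : WF n A r E Q) (hr : r < n) : verts Q ⊆ Finset.range n := by
  induction h with
  | root => simp [verts, hr]
  | snoc _ hp he hj hA h ih =>
    rw [verts_append]; exact Finset.insert_subset (Finset.mem_range.mpr hj) ih

theorem WF.nodup (h : WF n A r E Q) : (Q.map Prod.fst).Nodup := by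
  induction h with
  | root => simp
  | snoc _ hp he hj hA h ih =>
    simp only [verts, List.mem_toFinset] at h
    rw [List.map_append, List.nodup_append]
    refine ⟨ih, by simp, fun a ha b hb => ?_⟩
    simp only [List.map_cons, List.map_nil, List.mem_singleton] at hb
    rintro rfl
    exact h (hb ▸ ha)

theorem card_verts (h : (Q.map Prod.fst).Nodup) : (verts Q).card = Q.length := by
  rw [verts, List.toFinset_card_of_nodup h, List.length_map]

theorem WF.root_mem (h : WF n A r E Q) : r ∈ verts Q := by
  induction h with
  | root => simp [verts]
  | snoc _ hp he hj hA h ih => rw [verts_append]; exact Finset.mem_insert_of_mem ih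

theorem WF.head (h : WF n A r E Q) : ∃ Q', Q = (r, r) :: Q' := by
  induction h with
  | root => exact ⟨[], rfl⟩
  | snoc _ hp he hj hA h ih => obtain ⟨Q', rfl⟩ := ih; exact ⟨_, rfl⟩

theorem WF.entry (h : WF n A r E Q) {j p : ℕ} (hm : (j, p) ∈ Q) (hj : j ≠ r) :
    p ∈ verts Q ∧ p ∈ E ∧ A p j = 1 := by
  induction h with
  | root => simp at hm; exact absurd hm.1 hj
  | snoc hQ hp he hj hA h ih =>
    rw [List.mem_append, List.mem_singleton] at hm
    rw [verts_append]
    rcases hm with hm | hm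
    · exact ⟨Finset.mem_insert_of_mem (ih hm).1, (ih hm).2⟩
    · obtain ⟨rfl, rfl⟩ := Prod.mk.inj hm
      exact ⟨Finset.mem_insert_of_mem hp, he, hA⟩

theorem WF.reach (h : WF n A r E Q) {v : ℕ} (hv : v ∈ verts Q) :
    Relation.ReflTransGen (fun i j => (j, i) ∈ Q ∧ j ≠ r) r v := by
  induction h generalizing v with
  | root => simp [verts] at hv; subst hv; exact .refl
  | @snoc Q p j hQ hp he hj hA h ih =>
    have hmono : ∀ {v}, v ∈ verts Q →
        Relation.ReflTransGen (fun i j' => (j', i) ∈ Q ++ [(j, p)] ∧ j' ≠ r) r v := fun hv =>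
      Relation.ReflTransGen.mono (fun a b hab => ⟨List.mem_append_left _ hab.1, hab.2⟩) _ _ (ih hv)
    rw [verts_append, Finset.mem_insert] at hv
    rcases hv with rfl | hv
    · exact (hmono hp).tail ⟨by simp, fun h' => h (h' ▸ hQ.root_mem)⟩
    · exact hmono hv

theorem mem_verts_grow {v m x : ℕ} :
    x ∈ verts (grow A Q v m) ↔ x ∈ verts Q ∨ (x < m ∧ A v x = 1) := by
  induction m with
  | zero => simp [grow]
  | succ m ih =>
    rw [grow]
    split_ifs with h
    · rw [verts_append, Finset.mem_insert, ih]
      constructor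
      · rintro (rfl | h1 | h1)
        · exact Or.inr ⟨by simp, h.1⟩
        · exact Or.inl h1
        · exact Or.inr ⟨by omega, h1.2⟩
      · rintro (h1 | ⟨h1, h2⟩)
        · exact Or.inr (Or.inl h1)
        · rcases Nat.lt_succ_iff_lt_or_eq.mp h1 with h3 | h3
          · exact Or.inr (Or.inr ⟨h3, h2⟩)
          · exact Or.inl h3
    · rw [ih]
      constructor
      · rintro (h1 | h1)
        · exact Or.inl h1
        · exact Or.inr ⟨by omega, h1.2⟩
      · rintro (h1 | ⟨h1, h2⟩)
        · exact Or.inl h1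
        · rcases Nat.lt_succ_iff_lt_or_eq.mp h1 with h3 | h3
          · exact Or.inr ⟨h3, h2⟩
          · subst h3
            by_contra h4
            exact h ⟨h2, fun h5 => h4 (ih.mp h5)⟩

theorem grow_prefix (A : ℕ → ℕ → ℕ) (Q : List (ℕ × ℕ)) (v m : ℕ) : Q <+: grow A Q v m := by
  induction m with
  | zero => exact List.prefix_refl _
  | succ m ih =>
    rw [grow]
    split_ifs
    · exact ih.trans (List.prefix_append _ _)
    · exact ih

theorem WF.grow (h : WF n A r E Q) {v : ℕ} (hv : v ∈ verts Q) (hE : v ∈ E) {m : ℕ} (hm : m ≤ n) :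
    WF n A r E (grow A Q v m) := by
  induction m with
  | zero => exact h
  | succ m ih =>
    rw [Loop.grow]
    split_ifs with hc
    · exact .snoc (ih (by omega)) (mem_verts_grow.mpr (Or.inl hv)) hE (by omega) hc.1 hc.2
    · exact ih (by omega)

theorem grow_eq_self {v m : ℕ} (h : ∀ j < m, A v j = 1 → j ∈ verts Q) : grow A Q v m = Q := by
  induction m with
  | zero => rfl
  | succ m ih =>
    have ih := ih fun j hj => h j (by omega)
    rw [grow, ih, if_neg]
    exact fun h' => h'.2 (h m (by omega) h'.1)

theorem range_sdiff_verts_grow (hA : ∀ i < n, ∀ j < n, A i j ≤ 1) {v : ℕ} (hv : v < n) :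
    Finset.range n \ verts (grow A Q v n) = cut A (Finset.range n \ verts Q) v := by
  ext x
  simp only [cut, Finset.mem_sdiff, Finset.mem_range, Finset.mem_filter, mem_verts_grow, not_or,
    not_and, and_assoc]
  refine and_congr_right fun hx => and_congr_right fun _ => ?_
  have := hA v hv x hx
  constructor
  · intro h; have := h hx; omega
  · intro h _; omega

/-- No assumption on the bits is needed: only queued vertices are expanded, and each expansion adds
at most one vertex to `E` while raising the counter by one. -/
theorem sim_sound (hr : r < n) : ∀ (m b h : ℕ) (Q : List (ℕ × ℕ)) (c : ℕ) (E : Finset ℕ),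
    WF n A r E Q → E.card ≤ c →
    ∃ E', WF n A r E' (sim n A m b h Q c).1 ∧ E'.card ≤ (sim n A m b h Q c).2
  | 0, b, h, Q, c, E, hw, hc => ⟨E, hw, hc⟩
  | m + 1, b, h, Q, c, E, hw, hc => by
    rw [sim]
    split_ifs with hq
    · refine sim_sound hr m _ _ _ _ (insert (Q[h]'hq.1).1 E)
        ((hw.mono (Finset.subset_insert _ _)).grow (mem_verts_of_mem (List.getElem_mem _))
          (Finset.mem_insert_self _ _) le_rfl) ((Finset.card_insert_le _ _).trans (by omega))
    · exact sim_sound hr m _ _ _ _ E hw hc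

/-- The members of `I` among the first `h` vertices of the queue. -/
def done (I : Finset ℕ) (Q : List (ℕ × ℕ)) (h : ℕ) : Finset ℕ :=
  ((Q.map Prod.fst).take h).toFinset.filter (· ∈ I)

/-- Among the first `h` vertices of the queue, exactly those in `I` have been expanded. -/
def Faithful (n : ℕ) (A : ℕ → ℕ → ℕ) (r : ℕ) (I : Finset ℕ) (h : ℕ) (Q : List (ℕ × ℕ)) (c : ℕ) :
    Prop :=
  WF n A r I Q ∧ (done I Q h).card = c ∧ ∀ v ∈ done I Q h, ∀ j < n, A v j = 1 → j ∈ verts Q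

theorem done_succ {I : Finset ℕ} {h : ℕ} (hh : h < Q.length) :
    done I Q (h + 1) = if Q[h].1 ∈ I then insert Q[h].1 (done I Q h) else done I Q h := by
  ext x
  simp only [done, List.take_add_one, List.toFinset_append, Finset.mem_filter, Finset.mem_union,
    List.getElem?_map, List.getElem?_eq_getElem hh]
  split_ifs with hI
  · simp only [Finset.mem_insert, Finset.mem_filter]
    simp
    constructor
    · rintro ⟨h1 | h1, h2⟩
      · exact Or.inr ⟨h1, h2⟩
      · exact Or.inl h1
    · rintro (h1 | ⟨h1, h2⟩)
      · exact ⟨Or.inr h1, h1 ▸ hI⟩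
      · exact ⟨Or.inl h1, h2⟩
  · simp
    rintro h1
    exact fun h2 => absurd (h2 ▸ h1) hI

theorem done_of_le {I : Finset ℕ} {h : ℕ} (hh : Q.length ≤ h) :
    done I Q h = (verts Q).filter (· ∈ I) := by
  rw [done, List.take_of_length_le (by simpa using hh)]; rfl

theorem done_prefix {I : Finset ℕ} {Q' : List (ℕ × ℕ)} {h : ℕ} (hp : Q <+: Q')
    (hh : h ≤ Q.length) : done I Q' h = done I Q h := by
  obtain ⟨l, rfl⟩ := hp
  rw [done, List.map_append, List.take_append_of_le_length (by simpa using hh)]; rfl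

/-- Each bit copies the membership in `I` of the vertex whose turn it is. Appending to the queue
does not alter the positions already treated, so `done` is stable. -/
theorem exists_faithful {I : Finset ℕ} (m : ℕ) : ∀ (h : ℕ) (Q : List (ℕ × ℕ)) (c : ℕ),
    Faithful n A r I h Q c →
    ∃ b < 2 ^ m, Faithful n A r I (h + m) (sim n A m b h Q c).1 (sim n A m b h Q c).2 := by
  induction m with
  | zero => exact fun h Q c hf => ⟨0, by norm_num, hf⟩
  | succ m ih =>
    intro h Q c ⟨hw, hc, hcl⟩
    by_cases hq : h < Q.length ∧ Q[h]!.1 ∈ I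
    · obtain ⟨hq1, hq2⟩ := hq
      rw [getElem!_pos Q h hq1] at hq2
      have hv : Q[h].1 ∈ verts Q := mem_verts_of_mem (List.getElem_mem _)
      have hp := grow_prefix A Q Q[h].1 n
      have hd : done I (grow A Q Q[h].1 n) (h + 1) = insert Q[h].1 (done I Q h) := by
        rw [done_prefix hp hq1, done_succ hq1, if_pos hq2]
      have hf : Faithful n A r I (h + 1) (grow A Q Q[h].1 n) (c + 1) := by
        refine ⟨hw.grow hv hq2 le_rfl, ?_, ?_⟩
        · rw [hd, Finset.card_insert_of_notMem, hc]
          -- The queue has no repetitions, so the vertex at index `h` is not among the earlier ones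
          -- and the count rises by exactly one.
          intro hm
          have hm := (Finset.mem_filter.mp hm).1
          rw [List.mem_toFinset, List.mem_take_iff_getElem] at hm
          obtain ⟨i, hi, he⟩ := hm
          have hlen : (Q.map Prod.fst).length = Q.length := List.length_map _
          have := (hw.nodup.getElem_inj_iff (hi := by omega) (hj := by omega)).mp
            (he.trans (List.getElem_map (h := by omega) Prod.fst).symm)
          omega
        · intro v hv' j hj hvj
          rw [hd, Finset.mem_insert] at hv'
          rw [mem_verts_grow]
          rcases hv' with rfl | hv'
          · exact Or.inr ⟨hj, hvj⟩
          · exact Or.inl (hcl v hv' j hj hvj)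
      obtain ⟨b, hb, hfb⟩ := ih _ _ _ hf
      refine ⟨2 * b + 1, by rw [pow_succ]; omega, ?_⟩
      rw [sim, dif_pos ⟨hq1, by omega⟩, show (2 * b + 1) / 2 = b by omega,
        show h + (m + 1) = h + 1 + m by omega]
      exact hfb
    · have hd : done I Q (h + 1) = done I Q h := by
        by_cases hq1 : h < Q.length
        · rw [done_succ hq1, if_neg]
          intro h2
          exact hq ⟨hq1, by rwa [getElem!_pos Q h hq1]⟩
        · rw [done_of_le (by omega), done_of_le (by omega)]
      obtain ⟨b, hb, hfb⟩ := ih (h + 1) Q c ⟨hw, hd ▸ hc, hd ▸ hcl⟩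
      refine ⟨2 * b, by rw [pow_succ]; omega, ?_⟩
      rw [sim, dif_neg (by omega), show 2 * b / 2 = b by omega,
        show h + (m + 1) = h + 1 + m by omega]
      exact hfb

/-! ### Spanning sets, the table, and the lower bound. -/

/-- From `r`, all vertices can be reached via vertices in `I`. -/
def Spans (n : ℕ) (A : ℕ → ℕ → ℕ) (r : ℕ) (I : Finset ℕ) : Prop :=
  ∀ D ⊆ Finset.range n, r ∈ D → D ≠ Finset.range n → ∃ v ∈ I, v ∈ D ∧ ∃ j < n, j ∉ D ∧ A v j = 1

/-- The entry `T (enc X)`, for a set `X` of at most `k` vertices, is at most `n * n + n`; if it is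
less, then it codes the minimal number of vertices whose expansion dominates `X`, and the first of
these vertices. -/
def TabOK (n k : ℕ) (A : ℕ → ℕ → ℕ) (T : ℕ → ℕ) (X : Finset ℕ) : Prop :=
  X.card ≤ k → T (enc X) ≤ n * n + n ∧ (X = ∅ → T (enc X) = 0) ∧
    (∀ v < n, v ∉ X → T (enc X) / n ≤ T (enc (cut A X v)) / n + 1) ∧
    (X ≠ ∅ → T (enc X) < n * n + n → T (enc X) % n ∉ X ∧
      T (enc X) / n = T (enc (cut A X (T (enc X) % n))) / n + 1)

theorem cut_subset (X : Finset ℕ) (v : ℕ) : cut A X v ⊆ X := Finset.filter_subset _ _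

/-- Applied to the complement of a nonempty `X`, `Spans` gives a vertex of `I` outside `X` that
shrinks `X`. It has no effect on the remaining set, so it is not counted there, and strong induction
on `X` charges each step to a different vertex of `I`. -/
theorem TabOK.le_card {k : ℕ} {T : ℕ → ℕ} (hT : ∀ X ⊆ Finset.range n, TabOK n k A T X)
    {I : Finset ℕ} (hs : Spans n A r I) (hr : r < n) :
    ∀ (X : Finset ℕ), X ⊆ Finset.range n → X.card ≤ k → r ∉ X →
      T (enc X) / n ≤ (I.filter fun v => cut A X v ≠ X).card := by
  intro X
  induction X using Finset.strongInduction with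
  | H X ih =>
    intro hX hk hrX
    by_cases h0 : X = ∅
    · rw [(hT X hX hk).2.1 h0]; simp
    · obtain ⟨v, hvI, hvD, j, hj, hjD, hvj⟩ := hs (Finset.range n \ X) Finset.sdiff_subset
        (by simp [hr, hrX]) (fun h => h0 (by
          rw [Finset.sdiff_eq_self_iff_disjoint] at h
          exact Finset.disjoint_self_iff_empty X |>.mp (h.symm.mono_right hX)))
      have hjX : j ∈ X := by simpa [hj] using hjD
      obtain ⟨hvn, hvX⟩ : v < n ∧ v ∉ X := by simpa using hvD
      have hss : cut A X v ⊂ X := (cut_subset X v).ssubset_of_ne fun h => by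
        rw [← h] at hjX
        have := (Finset.mem_filter.mp hjX).2
        omega
      refine ((hT X hX hk).2.2.1 v hvn hvX).trans ?_
      have h1 := ih _ hss (hss.1.trans hX) ((Finset.card_le_card hss.1).trans hk)
        (fun h => hrX (hss.1 h))
      have h2 : insert v (I.filter fun w => cut A (cut A X v) w ≠ cut A X v) ⊆
          I.filter fun w => cut A X w ≠ X := by
        intro w hw
        rw [Finset.mem_insert, Finset.mem_filter] at hw
        rw [Finset.mem_filter]
        rcases hw with rfl | ⟨hw, hne⟩
        · exact ⟨hvI, hss.ne⟩
        · refine ⟨hw, fun h => hne ?_⟩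
          rw [cut, Finset.filter_eq_self] at h ⊢
          exact fun x hx => h x (cut_subset X v hx)
      have h3 : v ∉ I.filter fun w => cut A (cut A X v) w ≠ cut A X v := fun h => by
        refine (Finset.mem_filter.mp h).2 ?_
        simp [cut]
      have h4 := Finset.card_le_card h2
      rw [Finset.card_insert_of_notMem h3] at h4
      omega

/-- The bits follow `I`. The cost splits into the members of `I` expanded by the search and those
that still dominate something unreached; these are disjoint parts of `I`. -/
theorem exists_code {k : ℕ} {T : ℕ → ℕ} (hT : ∀ X ⊆ Finset.range n, TabOK n k A T X)
    (hA : ∀ i < n, ∀ j < n, A i j ≤ 1) {I : Finset ℕ} (hI : I ⊆ Finset.range n)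
    (hs : Spans n A r I) (hr : r < n) :
    ∃ b < 2 ^ (n - k), (Finset.range n \ verts (sim n A (n - k) b 0 [(r, r)] 0).1).card ≤ k ∧
      (sim n A (n - k) b 0 [(r, r)] 0).2 +
        T (enc (Finset.range n \ verts (sim n A (n - k) b 0 [(r, r)] 0).1)) / n ≤ I.card := by
  obtain ⟨b, hb, hf⟩ := exists_faithful (n := n) (A := A) (r := r) (I := I) (n - k) 0 [(r, r)] 0
    ⟨.root, by simp [done], by simp [done]⟩
  refine ⟨b, hb, ?_⟩
  generalize sim n A (n - k) b 0 [(r, r)] 0 = S at hf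
  obtain ⟨Q, c⟩ := S
  obtain ⟨hw, hc, hcl⟩ := hf
  simp only [zero_add] at hw hc hcl ⊢
  have hQ := hw.verts_subset hr
  have hk : (Finset.range n \ verts Q).card ≤ k := by
    rw [Finset.card_sdiff_of_subset hQ, Finset.card_range]
    by_cases hlen : n - k ≤ Q.length
    · rw [card_verts hw.nodup]; omega
    -- A short queue has been treated to its end, so no arc from a member of `I` leaves it, and
    -- `Spans` makes it everything.
    · have hall : verts Q = Finset.range n := by
        by_contra hne
        obtain ⟨v, hvI, hvD, j, hj, hjD, hvj⟩ := hs _ hQ hw.root_mem hne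
        rw [done_of_le (by omega)] at hcl
        exact hjD (hcl v (Finset.mem_filter.mpr ⟨hvD, hvI⟩) j hj hvj)
      rw [hall]; simp
  refine ⟨hk, ?_⟩
  have h1 := TabOK.le_card hT hs hr (Finset.range n \ verts Q) Finset.sdiff_subset hk
    (by simp [hw.root_mem])
  have h2 : Disjoint (done I Q (n - k))
      (I.filter fun v => cut A (Finset.range n \ verts Q) v ≠ Finset.range n \ verts Q) := by
    rw [Finset.disjoint_left]
    intro v hv hv'
    have hvn := hI (Finset.mem_filter.mp hv).2
    refine (Finset.mem_filter.mp hv').2 (Finset.filter_eq_self.mpr fun x hx => ?_)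
    rw [Finset.mem_sdiff, Finset.mem_range] at hx
    have := hA v (Finset.mem_range.mp hvn) x hx.1
    have := mt (hcl v hv x hx.1) hx.2
    omega
  have h3 := Finset.card_le_card (Finset.union_subset
    (fun v hv => (Finset.mem_filter.mp hv).2 : done I Q (n - k) ⊆ I)
    (Finset.filter_subset (fun v => cut A (Finset.range n \ verts Q) v ≠ Finset.range n \ verts Q) I))
  rw [Finset.card_union_of_disjoint h2] at h3
  omega

end Loop

namespace Loop

/-! ### Digraphs and their trees -/

variable {n : ℕ}

open Classical in
/-- The adjacency matrix. -/
noncomputable def adjMat (G : Digraph (Fin n)) (i j : ℕ) : ℕ :=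
  if ∃ (hi : i < n) (hj : j < n), G.Adj ⟨i, hi⟩ ⟨j, hj⟩ then 1 else 0

theorem adjMat_le (G : Digraph (Fin n)) (i j : ℕ) : adjMat G i j ≤ 1 := by
  rw [adjMat]; split_ifs <;> simp

theorem adjMat_eq_one (G : Digraph (Fin n)) (i j : Fin n) : adjMat G i j = 1 ↔ G.Adj i j := by
  rw [adjMat]
  simp

open Classical in
/-- The inner vertices of a tree. -/
noncomputable def inner (T : Digraph (Fin n)) : Finset ℕ :=
  (Finset.univ.filter fun v => ∃ w, T.Adj v w).map Fin.valEmbedding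

theorem mem_inner {T : Digraph (Fin n)} {x : ℕ} : x ∈ inner T ↔ ∃ v w, T.Adj v w ∧ v.val = x := by
  simp [inner]

theorem inner_subset (T : Digraph (Fin n)) : inner T ⊆ Finset.range n := fun x hx => by
  obtain ⟨v, -, rfl⟩ := Finset.mem_map.mp hx
  exact Finset.mem_range.mpr v.2

theorem card_inner (T : Digraph (Fin n)) : (inner T).card + (treeLeaves T).ncard = n := by
  classical
  have h : treeLeaves T = ↑(Finset.univ.filter fun v => ¬ ∃ w, T.Adj v w) := by
    ext v; simp [treeLeaves]
  rw [h, Set.ncard_coe_finset, inner, Finset.card_map, Finset.card_filter_add_card_filter_not]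
  simp

/-- The tail of a tree arc is an inner vertex, so a set containing the root that no such vertex
leaves contains everything reachable in the tree. -/
theorem _root_.IsOutBranching.spans {G T : Digraph (Fin n)} {r : Fin n} (h : IsOutBranching G T r) :
    Spans n (adjMat G) r (inner T) := by
  intro D hD hr hne
  by_contra hcon
  refine hne (hD.antisymm fun x hx => ?_)
  have key : ∀ v : Fin n, Relation.ReflTransGen T.Adj r v → (v : ℕ) ∈ D := fun v hv => by
    induction hv with
    | refl => exact hr
    | @tail b c _ hbc ih =>
      by_contra hc
      refine hcon ⟨b, ?_, ih, c, c.2, hc, (adjMat_eq_one G b c).mpr (h.arcs_subset _ _ hbc)⟩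
      exact mem_inner.mpr ⟨b, c, hbc, rfl⟩
  exact key ⟨x, Finset.mem_range.mp hx⟩ (h.reachable _)

/-- The tree given by a queue. -/
def treeOf (n r : ℕ) (Q : List (ℕ × ℕ)) : Digraph (Fin n) where
  Adj i j := (j.val, i.val) ∈ Q ∧ j.val ≠ r

theorem WF.parent_unique {A : ℕ → ℕ → ℕ} {r : ℕ} {E : Finset ℕ} {Q : List (ℕ × ℕ)}
    (h : WF n A r E Q) {j p p' : ℕ} (h1 : (j, p) ∈ Q) (h2 : (j, p') ∈ Q) : p = p' :=
  congrArg Prod.snd (List.inj_on_of_nodup_map h.nodup h1 h2 rfl)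

theorem WF.isOutBranching {G : Digraph (Fin n)} {r : ℕ} {E : Finset ℕ} {Q : List (ℕ × ℕ)}
    (h : WF n (adjMat G) r E Q) (hr : r < n) (hall : verts Q = Finset.range n) :
    IsOutBranching G (treeOf n r Q) ⟨r, hr⟩ where
  arcs_subset u v huv := (adjMat_eq_one G u v).mp (h.entry huv.1 huv.2).2.2
  root_no_parent u hu := hu.2 rfl
  unique_parent v hv := by
    have hv' : v.val ≠ r := fun h => hv (Fin.ext h)
    have hm : v.val ∈ verts Q := by rw [hall]; simp
    simp only [verts, List.mem_toFinset, List.mem_map] at hm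
    obtain ⟨⟨j, p⟩, he, hj⟩ := hm
    simp only at hj
    subst hj
    have hp := (h.entry he hv').1
    rw [hall, Finset.mem_range] at hp
    exact ⟨⟨p, hp⟩, ⟨he, hv'⟩, fun u hu => Fin.ext (h.parent_unique hu.1 he)⟩
  reachable v := by
    have hm : v.val ∈ verts Q := by rw [hall]; simp
    have key : ∀ x, Relation.ReflTransGen (fun i j => (j, i) ∈ Q ∧ j ≠ r) r x → ∀ hx : x < n,
        Relation.ReflTransGen (treeOf n r Q).Adj ⟨r, hr⟩ ⟨x, hx⟩ := fun x hx => by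
      induction hx with
      | refl => exact fun _ => .refl
      | @tail b c _ hbc ih =>
        intro hc
        have hb := (h.entry hbc.1 hbc.2).1
        rw [hall, Finset.mem_range] at hb
        exact (ih hb).tail hbc
    exact key _ (h.reach hm) v.2

/-- Inner vertices of the tree lie in `E`, which is no larger than the inner set of any competitor;
inner vertices and leaves add up to `n`. -/
theorem WF.isMax {G : Digraph (Fin n)} {r : ℕ} {E : Finset ℕ} {Q : List (ℕ × ℕ)}
    (h : WF n (adjMat G) r E Q) (hr : r < n) (hall : verts Q = Finset.range n)
    (hmin : ∀ r < n, ∀ I ⊆ Finset.range n, Spans n (adjMat G) r I → E.card ≤ I.card) :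
    IsMaxLeafOutBranching G (treeOf n r Q) := by
  refine ⟨⟨_, h.isOutBranching hr hall⟩, fun T' r' hT' => ?_⟩
  have h1 := hmin r' r'.2 _ (inner_subset T') hT'.spans
  have h2 : inner (treeOf n r Q) ⊆ E := fun x hx => by
    obtain ⟨v, w, hw, rfl⟩ := mem_inner.mp hx
    exact (h.entry hw.1 hw.2).2.1
  have h3 := Finset.card_le_card h2
  have h4 := card_inner T'
  have h5 := card_inner (treeOf n r Q)
  omega

end Loop

namespace Loop

/-! ### The program -/

instance : Add Ex := ⟨.bin .add⟩
instance : Sub Ex := ⟨.bin .sub⟩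
instance : Mul Ex := ⟨.bin .mul⟩
instance : Div Ex := ⟨.bin .div⟩
instance (c : ℕ) : OfNat Ex c := ⟨.num c⟩

@[simp] theorem Ex.eval_add (s : St) (a b : Ex) : (a + b).eval s = a.eval s + b.eval s := rfl
@[simp] theorem Ex.eval_sub (s : St) (a b : Ex) : (a - b).eval s = a.eval s - b.eval s := rfl
@[simp] theorem Ex.eval_mul (s : St) (a b : Ex) : (a * b).eval s = a.eval s * b.eval s := rfl
@[simp] theorem Ex.eval_div (s : St) (a b : Ex) : (a / b).eval s = a.eval s / b.eval s := rfl
@[simp] theorem Ex.eval_ofNat (s : St) (c : ℕ) : (OfNat.ofNat c : Ex).eval s = c := rfl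
@[simp] theorem Ex.ok_add (S : Finset ℕ) (s : St) (a b : Ex) :
    (a + b).ok S s ↔ a.ok S s ∧ b.ok S s := Iff.rfl
@[simp] theorem Ex.ok_sub (S : Finset ℕ) (s : St) (a b : Ex) :
    (a - b).ok S s ↔ a.ok S s ∧ b.ok S s := Iff.rfl
@[simp] theorem Ex.ok_mul (S : Finset ℕ) (s : St) (a b : Ex) :
    (a * b).ok S s ↔ a.ok S s ∧ b.ok S s := Iff.rfl
@[simp] theorem Ex.ok_div (S : Finset ℕ) (s : St) (a b : Ex) :
    (a / b).ok S s ↔ a.ok S s ∧ b.ok S s := Iff.rfl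
@[simp] theorem Ex.ok_ofNat (S : Finset ℕ) (s : St) (c : ℕ) : (OfNat.ofNat c : Ex).ok S s := trivial

/-- The remainder of `a` modulo `b`. -/
def Ex.mod (a b : Ex) : Ex := a - b * (a / b)

@[simp] theorem Ex.eval_mod (s : St) (a b : Ex) : (a.mod b).eval s = a.eval s % b.eval s := by
  simp only [mod, eval_sub, eval_mul, eval_div]
  have := Nat.div_add_mod (a.eval s) (b.eval s)
  omega

@[simp] theorem Ex.ok_mod (S : Finset ℕ) (s : St) (a b : Ex) :
    (a.mod b).ok S s ↔ a.ok S s ∧ b.ok S s := by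
  simp only [mod, ok_sub, ok_mul, ok_div]; tauto

open Ex Cmd

/-- Sequential composition. -/
infixr:60 " ;; " => Cmd.seq

/-! Variables: `0` the number `n` of vertices, `1` the number `2 ^ n`, `2` the bound `n / 6` for the
masks in the table, `3` the number `2 ^ (n - n / 6)`, `4` the address of the table, `5` and `6` the
addresses of the queue and of the parents of its vertices, `7` the number of codes. -/

/-- Set `9` to the number of bits of `e`, and `10` to its lowest set bit. -/
def popC (e : Ex) : Cmd :=
  assign 11 e ;; assign 9 0 ;; assign 10 1 ;;
  rep false (var 0)
    (assign 10 (var 10 * (1 + (1 - var 9) * (1 - (var 11).mod 2))) ;;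
     assign 9 (var 9 + (var 11).mod 2) ;;
     assign 11 (var 11 / 2))

/-- Append the new out-neighbours of `12` to the queue of length `22` with vertex set `21`. -/
def expandC : Cmd :=
  assign 15 0 ;; assign 16 1 ;;
  rep false (var 0)
    -- Variable `26` is `1` if the vertex is a new out-neighbour and `0` otherwise. The entry is
    -- written behind the queue in either case, and counts only if the length grows.
    (assign 26 (load (1 + var 12 * var 0 + var 15) * (1 - (var 21 / var 16).mod 2)) ;;
     store (var 5 + var 22) (var 15) ;;
     store (var 6 + var 22) (var 12) ;;
     assign 22 (var 22 + var 26) ;;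
     assign 21 (var 21 + var 26 * var 16) ;;
     assign 15 (var 15 + 1) ;;
     assign 16 (var 16 * 2))

/-- Grow a tree as the code `19` says; `24` is the number of expanded vertices. -/
def simC : Cmd :=
  assign 20 (var 19 / var 0) ;; assign 12 ((var 19).mod (var 0)) ;; assign 16 1 ;;
  rep false (var 12) (assign 16 (var 16 * 2)) ;;
  assign 21 (var 16) ;;
  store (var 5) (var 12) ;; store (var 6) (var 12) ;;
  assign 22 1 ;; assign 24 0 ;; assign 23 0 ;;
  rep false (var 0 - var 2)
    -- Nonzero exactly if the index lies inside the queue and the current bit is set.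
    (cond ((var 22 - var 23) * (var 20).mod 2)
      (assign 12 (load (var 5 + var 23)) ;; expandC ;; assign 24 (var 24 + 1)) ;;
     assign 20 (var 20 / 2) ;;
     assign 23 (var 23 + 1))

/-- Fill the table entry of the mask `8`. -/
def fillC : Cmd :=
  -- The empty set starts with `0`, every other set with `n * n + n`, which stands for infinity.
  store (var 4 + var 8) ((var 0 * var 0 + var 0) * (1 - (1 - var 8))) ;;
  assign 12 0 ;; assign 13 1 ;;
  rep false (var 0)
    (assign 14 0 ;; assign 15 0 ;; assign 16 1 ;;
     rep false (var 0)
      (assign 14 (var 14 + (var 8 / var 16).mod 2 * (1 - load (1 + var 12 * var 0 + var 15)) *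
         var 16) ;;
       assign 15 (var 15 + 1) ;; assign 16 (var 16 * 2)) ;;
     -- In truncated subtraction, `a - (a - b)` is the minimum. A vertex inside the set is ruled out
     -- by adding `n * n + n`.
     store (var 4 + var 8) (load (var 4 + var 8) - (load (var 4 + var 8) -
       ((load (var 4 + var 14) / var 0 + 1) * var 0 + var 12 +
        (var 8 / var 13).mod 2 * (var 0 * var 0 + var 0)))) ;;
     assign 12 (var 12 + 1) ;; assign 13 (var 13 * 2))

/-- Compute the constants. -/
def initC : Cmd :=
  assign 0 (load 0) ;; assign 1 1 ;; rep false (var 0) (assign 1 (var 1 * 2)) ;;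
  assign 2 (var 0 / 6) ;; assign 3 1 ;; rep false (var 0 - var 2) (assign 3 (var 3 * 2)) ;;
  -- Both queue arrays have `n + 1` cells, because `expandC` also writes behind a full queue.
  assign 5 (var 0 * var 0 + 1) ;; assign 6 (var 5 + var 0 + 1) ;; assign 4 (var 6 + var 0 + 1) ;;
  assign 7 (var 0 * var 3)

/-- Fill the table for all masks with at most `n / 6` bits. -/
def tableC : Cmd :=
  assign 8 0 ;;
  rep true (4 * var 3)
    (cond (var 1 - var 8)
      (popC (var 8) ;;
       -- A mask with a table entry is followed by its successor; any other mask is left by adding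
       -- its lowest set bit.
       cond (var 2 + 1 - var 9) (fillC ;; assign 10 1) ;;
       assign 8 (var 8 + var 10)))

/-- Find the best code; `17` is the value of the best solution times the number of codes, plus the
code of the solution. -/
def searchC : Cmd :=
  assign 17 ((var 0 + 1) * var 7) ;; assign 19 0 ;;
  rep true (var 7)
    (simC ;; assign 28 (var 1 - 1 - var 21) ;; popC (var 28) ;;
     cond (var 2 + 1 - var 9)
      (assign 17 (var 17 - (var 17 - ((var 24 + load (var 4 + var 28) / var 0) * var 7 +
        var 19)))) ;;
     assign 19 (var 19 + 1))

/-- Write the adjacency matrix of the tree in the queue. -/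
def writeC : Cmd :=
  assign 15 1 ;;
  rep false (var 0) (rep false (var 0) (store (var 15) 0 ;; assign 15 (var 15 + 1))) ;;
  -- Index `0` is the root, whose entry is not an arc.
  assign 23 1 ;;
  rep false (var 0 - 1)
    (store (1 + load (var 6 + var 23) * var 0 + load (var 5 + var 23)) 1 ;;
     assign 23 (var 23 + 1))

/-- Output a best solution. -/
def outputC : Cmd :=
  store 0 0 ;;
  cond ((var 0 + 1) * var 7 - var 17)
    (assign 19 ((var 17).mod (var 7)) ;; simC ;;
     -- Surplus rounds are harmless: once all vertices are reached, an expansion appends nothing.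
     rep false (var 0)
      (assign 12 ((load (var 4 + (var 1 - 1 - var 21))).mod (var 0)) ;; expandC) ;;
     writeC ;; store 0 1)

/-- The algorithm. -/
def mainC : Cmd := initC ;; tableC ;; searchC ;; outputC

theorem mainC_wf : mainC.wf 0 = true := by decide

theorem mainC_depth : mainC.depth false = 2 ∧ mainC.depth true = 1 := by decide

theorem mainC_weight : mainC.weight ≤ 2000 := by decide

end Loop

namespace Loop

open Ex Cmd

/-! ### Specifications of the commands -/

/-- The limits for the algorithm on digraphs with `n` vertices. -/
def lim (n : ℕ) : Lim where
  M := (2 ^ n) ^ 8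
  S := Finset.range (n * n + 2 * n + 3) ∪
    (lowMasks n (n / 6)).image (n * n + 2 * n + 3 + ·)
  -- A common bound for the `4 * 2 ^ (n - n / 6)` rounds of the walk through the masks and the `n *
  -- 2 ^ (n - n / 6)` rounds of the search.
  bd tag := if tag then 4 * (n * 2 ^ (n - n / 6)) else n

/-- The states `s` and `s'` agree except for the variables in `l`. -/
def Frame (l : List ℕ) (s' s : St) : Prop := ∀ x, x ∉ l → s'.reg x = s.reg x

/-- The constants have been computed. -/
structure Env (n : ℕ) (s : St) : Prop where
  r0 : s.reg 0 = n
  r1 : s.reg 1 = 2 ^ n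
  r2 : s.reg 2 = n / 6
  r3 : s.reg 3 = 2 ^ (n - n / 6)
  r4 : s.reg 4 = n * n + 2 * n + 3
  r5 : s.reg 5 = n * n + 1
  r6 : s.reg 6 = n * n + n + 2
  r7 : s.reg 7 = n * 2 ^ (n - n / 6)

/-- The input is still in the memory. -/
def MatOK (n : ℕ) (A : ℕ → ℕ → ℕ) (s : St) : Prop :=
  ∀ i < n, ∀ j < n, s.mem (1 + i * n + j) = A i j

/-- The memory is the same except for the queue. -/
def SameMem (n : ℕ) (s' s : St) : Prop :=
  ∀ a, a ≤ n * n ∨ n * n + 2 * n + 3 ≤ a → s'.mem a = s.mem a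

variable {n : ℕ} {A : ℕ → ℕ → ℕ}

theorem Frame.refl (l : List ℕ) (s : St) : Frame l s s := fun _ _ => rfl

theorem Frame.trans {l l' : List ℕ} {s s' s'' : St} (h' : Frame l' s'' s') (h : Frame l s' s)
    (hl : l' ⊆ l := by simp) : Frame l s'' s :=
  fun x hx => (h' x fun h => hx (hl h)).trans (h x hx)

theorem Frame.mono {l l' : List ℕ} {s s' : St} (h : Frame l' s' s) (hl : l' ⊆ l := by simp) :
    Frame l s' s := h.trans (Frame.refl l s) hl

theorem Frame.update {l : List ℕ} {s' s : St} (h : Frame l s' s) (x v : ℕ) (m : ℕ → ℕ)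
    (hx : x ∈ l := by simp) : Frame l ⟨Function.update s'.reg x v, m⟩ s := fun y hy =>
  (Function.update_of_ne (fun e : y = x => hy (e ▸ hx)) _ _).trans (h y hy)

theorem Env.frame {s s' : St} {l : List ℕ} (h : Env n s) (hf : Frame l s' s)
    (hl : ∀ x ∈ l, 8 ≤ x := by simp) : Env n s' := by
  have : ∀ x < 8, s'.reg x = s.reg x := fun x hx => hf x fun hm => by have := hl x hm; omega
  constructor <;> rw [this _ (by norm_num)]
  exacts [h.r0, h.r1, h.r2, h.r3, h.r4, h.r5, h.r6, h.r7]

theorem MatOK.same {s s' : St} (h : MatOK n A s) (hs : SameMem n s' s) : MatOK n A s' :=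
  fun i hi j hj => by
    rw [hs _ (Or.inl (by nlinarith)), h i hi j hj]

theorem SameMem.trans {s s' s'' : St} (h' : SameMem n s'' s') (h : SameMem n s' s) :
    SameMem n s'' s := fun a ha => (h' a ha).trans (h a ha)

/-- Numerical facts about the limits. -/
theorem lim_facts (hn : 2 ≤ n) : n < 2 ^ n ∧ 4 ≤ 2 ^ n ∧ 2 ^ (n - n / 6) ≤ 2 ^ n ∧
    n * n ≤ 2 ^ n * 2 ^ n ∧ 4 * 2 ^ n ≤ 2 ^ n * 2 ^ n ∧
    16 * (2 ^ n * 2 ^ n) ≤ (lim n).M ∧ 16 * (2 ^ n * 2 ^ n * 2 ^ n) ≤ (lim n).M := by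
  have h1 : n < 2 ^ n := Nat.lt_two_pow_self
  have h2 : 2 ^ 2 ≤ 2 ^ n := Nat.pow_le_pow_right (by norm_num) hn
  have h3 : 2 ^ (n - n / 6) ≤ 2 ^ n := Nat.pow_le_pow_right (by norm_num) (Nat.sub_le _ _)
  have h4 : 2 ^ n * 2 ^ n * (2 ^ n * 2 ^ n) ≤ (lim n).M := by
    rw [lim, show 2 ^ n * 2 ^ n * (2 ^ n * 2 ^ n) = (2 ^ n) ^ 4 by ring]
    exact Nat.pow_le_pow_right (by positivity) (by norm_num)
  have h5 : 2 ^ n * 2 ^ n * 2 ^ n * 16 ≤ (lim n).M := by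
    rw [lim, show 2 ^ n * 2 ^ n * 2 ^ n = (2 ^ n) ^ 3 by ring]
    calc (2 ^ n) ^ 3 * 16 = (2 ^ n) ^ 3 * 4 ^ 2 := by norm_num
      _ ≤ (2 ^ n) ^ 3 * (2 ^ n) ^ 2 := Nat.mul_le_mul_left _ (Nat.pow_le_pow_left h2 2)
      _ = (2 ^ n) ^ 5 := by ring
      _ ≤ _ := Nat.pow_le_pow_right (by positivity) (by norm_num)
  generalize 2 ^ n = P at *
  refine ⟨h1, h2, h3, Nat.mul_le_mul h1.le h1.le, Nat.mul_le_mul_right _ h2, ?_, by omega⟩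
  nlinarith [Nat.mul_le_mul_left (P * P) (show 4 ≤ P from h2)]

theorem mem_lim_of_lt {a : ℕ} (h : a < n * n + 2 * n + 3) : a ∈ (lim n).S :=
  Finset.mem_union_left _ (Finset.mem_range.mpr h)

theorem mem_lim_table {X : Finset ℕ} (h : X ⊆ Finset.range n) (hX : X.card ≤ n / 6) :
    n * n + 2 * n + 3 + enc X ∈ (lim n).S :=
  Finset.mem_union_right _ (Finset.mem_image_of_mem _ (Finset.mem_filter.mpr
    ⟨Finset.mem_range.mpr (enc_lt h), by rwa [pop_enc h]⟩))

/-- Loops that double a variable. -/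
theorem wp_pow (hn : 2 ≤ n) {e : Ex} {d m : ℕ} {s : St} {Q : St → Prop} (he : e.eval s = m)
    (hok : e.ok (lim n).S s) (hm : m ≤ n) (hd : s.reg d = 1)
    (hQ : Q ⟨Function.update s.reg d (2 ^ m), s.mem⟩) :
    (rep false e (assign d (var d * 2))).wp (lim n) s Q := by
  obtain ⟨f1, f2, f3, f4, f5, f6, f7⟩ := lim_facts hn
  refine wp_rep he hok hm (fun i s' => s' = ⟨Function.update s.reg d (2 ^ i), s.mem⟩) ?_ ?_ ?_
  · simp [← hd]
  · rintro i s' hi rfl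
    have hp : 2 ^ (i + 1) ≤ 2 ^ n := Nat.pow_le_pow_right (by norm_num) (by omega)
    refine ⟨by simp, ?_, ?_⟩
    · simp [← pow_succ]; omega
    · simp [← pow_succ]
  · rintro s' rfl
    exact hQ

theorem wp_pop (hn : 2 ≤ n) {e : Ex} {x : ℕ} {s : St} {Q : St → Prop} (he : Env n s)
    (hx : e.eval s = x) (hok : e.ok (lim n).S s) (hxn : x < 2 ^ n)
    (hQ : ∀ s', Frame [9, 10, 11] s' s → s'.mem = s.mem → s'.reg 9 = pop n x →
      IsLow n x (s'.reg 10) → Q s') : (popC e).wp (lim n) s Q := by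
  obtain ⟨f1, f2, f3, f4, f5, f6, f7⟩ := lim_facts hn
  refine ⟨hok, by omega, ⟨by simp, by simp, ⟨by simp, by simp; omega, ?_⟩⟩⟩
  refine wp_rep (N := n) (by simp [he.r0]) (by simp) (by simp [lim])
    (fun i s' => Frame [9, 10, 11] s' s ∧ s'.mem = s.mem ∧ s'.reg 9 = pop i x ∧
      IsLow i x (s'.reg 10) ∧ s'.reg 11 = x / 2 ^ i) ?_ ?_ ?_
  · refine ⟨(((Frame.refl _ s).update 11 _ _).update 9 _ _).update 10 _ _, rfl, ?_, ?_, ?_⟩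
    · simp [pop]
    · simpa using isLow_zero x
    · simpa using hx
  · rintro i s' hi ⟨g1, g2, g3, g4, g5⟩
    have hl := isLow_succ g4
    have hp : pop (i + 1) x ≤ i + 1 := by
      have := Finset.sum_le_card_nsmul (Finset.range (i + 1)) (bt x) 1 fun j _ => bt_le x j
      simpa [pop] using this
    have hpe : pop (i + 1) x = pop i x + bt x i := Finset.sum_range_succ _ _
    have hle := hl.le.2.trans (Nat.pow_le_pow_right (by norm_num) (by omega : i + 1 ≤ n))
    have hb : bt x i = x / 2 ^ i % 2 := rfl
    have hdiv : x / 2 ^ i / 2 = x / 2 ^ (i + 1) := by rw [Nat.div_div_eq_div_mul, pow_succ]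
    have hdle := Nat.div_le_self x (2 ^ (i + 1))
    refine ⟨by simp, ?_, by simp, ?_, by simp, ?_, ?_⟩
    · simp [g3, g5, ← hb]; omega
    · simp [g3, g5, ← hb, ← hpe]; omega
    · simp [g5, hdiv]; omega
    · refine ⟨((g1.update 10 _ _).update 9 _ _).update 11 _ _, g2, ?_, ?_, ?_⟩
      · simp [g3, g5, ← hb, ← hpe]
      · simpa [g3, g5, ← hb] using hl
      · simp [g5, hdiv]
  · rintro s' ⟨g1, g2, g3, g4, -⟩
    exact hQ s' g1 g2 g3 g4

/-- The queue is in the memory. -/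
structure Rep (n : ℕ) (s : St) (Q : List (ℕ × ℕ)) : Prop where
  d : s.reg 21 = enc (verts Q)
  t : s.reg 22 = Q.length
  q : ∀ i v p, Q[i]? = some (v, p) →
    s.mem (n * n + 1 + i) = v ∧ s.mem (n * n + n + 2 + i) = p

/-- The queue contains every vertex at most once. -/
def Good (n : ℕ) (Q : List (ℕ × ℕ)) : Prop :=
  (Q.map Prod.fst).Nodup ∧ verts Q ⊆ Finset.range n

theorem Good.length_le {Q : List (ℕ × ℕ)} (h : Good n Q) : Q.length ≤ n := by
  rw [← card_verts h.1]
  simpa using Finset.card_le_card h.2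

theorem Good.grow {Q : List (ℕ × ℕ)} (h : Good n Q) (v : ℕ) {m : ℕ} (hm : m ≤ n) :
    Good n (grow A Q v m) := by
  induction m with
  | zero => exact h
  | succ m ih =>
    rw [Loop.grow]
    split_ifs with hc
    · obtain ⟨i1, i2⟩ := ih (by omega)
      refine ⟨?_, ?_⟩
      · have hc2 := hc.2
        simp only [verts, List.mem_toFinset] at hc2
        rw [List.map_append, List.nodup_append]
        refine ⟨i1, by simp, fun a ha b hb => ?_⟩
        simp only [List.map_cons, List.map_nil, List.mem_singleton] at hb
        rintro rfl
        exact hc2 (hb ▸ ha)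
      · rw [verts_append]
        exact Finset.insert_subset (Finset.mem_range.mpr (by omega)) i2
    · exact ih (by omega)

theorem wp_expand (hn : 2 ≤ n) (hA : ∀ i j, A i j ≤ 1) {s : St} {Q : List (ℕ × ℕ)} {v : ℕ}
    (he : Env n s) (hm : MatOK n A s) (hg : Good n Q) (hr : Rep n s Q) (hv : s.reg 12 = v)
    (hvn : v < n) {R : St → Prop}
    (hR : ∀ s', Frame [15, 16, 21, 22, 26] s' s → SameMem n s' s → Rep n s' (grow A Q v n) → R s') :
    expandC.wp (lim n) s R := by
  obtain ⟨f1, f2, f3, f4, f5, f6, f7⟩ := lim_facts hn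
  refine ⟨by simp, by simp, ⟨by simp, by simp; omega, ?_⟩⟩
  refine wp_rep (N := n) (by simp [he.r0]) (by simp) (by simp [lim])
    (fun i s' => Frame [15, 16, 21, 22, 26] s' s ∧ SameMem n s' s ∧ Rep n s' (grow A Q v i) ∧
      s'.reg 15 = i ∧ s'.reg 16 = 2 ^ i) ?_ ?_ ?_
  · refine ⟨((Frame.refl _ s).update 15 _ _).update 16 _ _, fun _ _ => rfl, ⟨?_, ?_, hr.q⟩, ?_, ?_⟩
    · simpa [grow] using hr.d
    · simpa [grow] using hr.t
    · simp
    · simp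
  · rintro i s' hi ⟨g1, g2, g3, g4, g5⟩
    have he' := he.frame g1
    have hg' := hg.grow (A := A) v hi.le
    have hlen := hg'.length_le
    have h12 : s'.reg 12 = v := (g1 12 (by simp)).trans hv
    have haddr : 1 + v * n + i ≤ n * n := by nlinarith
    have hmat : s'.mem (1 + v * n + i) = A v i := (hm.same g2) v hvn i hi
    have hb : enc (verts (grow A Q v i)) / 2 ^ i % 2 = if i ∈ verts (grow A Q v i) then 1 else 0 :=
      bt_enc _ _
    have hp : 2 ^ (i + 1) ≤ 2 ^ n := Nat.pow_le_pow_right (by norm_num) (by omega)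
    have hpp : 2 ^ i ≤ 2 ^ n := Nat.pow_le_pow_right (by norm_num) (by omega)
    have hd := enc_lt hg'.2
    have hnew : s'.mem (1 + v * n + i) * (1 - enc (verts (grow A Q v i)) / 2 ^ i % 2) =
        if A v i = 1 ∧ i ∉ verts (grow A Q v i) then 1 else 0 := by
      rw [hmat, hb]
      rcases Nat.le_one_iff_eq_zero_or_eq_one.mp (hA v i) with h1 | h1 <;>
        by_cases h2 : i ∈ verts (grow A Q v i) <;> simp [h1, h2]
    generalize hT : grow A Q v i = T at *
    set new := if A v i = 1 ∧ i ∉ verts T then 1 else 0 with hnewd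
    have hnew1 : new ≤ 1 := by rw [hnewd]; split_ifs <;> omega
    have hnm : new * 2 ^ i ≤ 2 ^ i := by nlinarith [Nat.one_le_two_pow (n := i)]
    have hgrow : grow A Q v (i + 1) = if A v i = 1 ∧ i ∉ verts T then T ++ [(i, v)] else T := by
      rw [grow, hT]
    refine ⟨?_, ?_, ?_, ?_, ?_, ?_, ?_, ?_, ?_, ?_, ?_, ?_, ?_, ?_, ?_, ?_, ?_, ?_, ?_, ?_⟩
    · simp [h12, he'.r0, g4]; exact mem_lim_of_lt (by omega)
    · simp [h12, he'.r0, g4, g5, g3.d, hnew]; omega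
    · simp
    · simp
    · simp [he'.r5, g3.t]; exact mem_lim_of_lt (by omega)
    · simp [g4]; omega
    · simp
    · simp
    · simp [he'.r6, g3.t]; exact mem_lim_of_lt (by omega)
    · simp [h12]; omega
    · simp
    · simp [h12, he'.r0, g4, g5, g3.d, g3.t, hnew]; omega
    · simp
    · simp [h12, he'.r0, g4, g5, g3.d, g3.t, hnew]; omega
    · simp
    · simp [g4]; omega
    · simp
    · simp [g5, ← pow_succ]; omega
    · refine Frame.update (Frame.update (Frame.update (Frame.update (Frame.update g1 26 _ s'.mem) 22 _
        s'.mem) 21 _ s'.mem) 15 _ s'.mem) 16 _ _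
    · refine ⟨fun a ha => ?_, ⟨?_, ?_, fun j w p hj => ?_⟩, ?_, ?_⟩
      · simp [he'.r5, he'.r6, g3.t]
        rw [Function.update_of_ne (by omega), Function.update_of_ne (by omega)]
        exact g2 a ha
      · simp [h12, he'.r0, g4, g5, g3.d, g3.t, hnew]
        rw [hgrow, hnewd]
        split_ifs with hc
        · rw [verts_append, enc_insert hc.2]; simp
        · simp
      · simp [h12, he'.r0, g4, g5, g3.d, g3.t, hnew]
        rw [hgrow, hnewd]
        split_ifs with hc <;> simp
      · simp [h12, he'.r0, he'.r5, he'.r6, g4, g3.t]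
        rw [hgrow] at hj
        have hcase : (T[j]? = some (w, p)) ∨ (j = T.length ∧ w = i ∧ p = v) := by
          split_ifs at hj with hc
          · rw [List.getElem?_append] at hj
            split_ifs at hj with hlt
            · exact Or.inl hj
            · obtain ⟨h1, h2⟩ := List.getElem?_eq_some_iff.mp hj
              simp at h1 h2
              exact Or.inr ⟨by omega, h2.1.symm, h2.2.symm⟩
          · exact Or.inl hj
        rcases hcase with hj | ⟨rfl, rfl, rfl⟩
        · have hjl := (List.getElem?_eq_some_iff.mp hj).1
          obtain ⟨q1, q2⟩ := g3.q j w p hj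
          constructor
          · rw [Function.update_of_ne (by omega), Function.update_of_ne (by omega), q1]
          · rw [Function.update_of_ne (by omega), Function.update_of_ne (by omega), q2]
        · constructor
          · rw [Function.update_of_ne (by omega)]; simp
          · simp
      · simp [g4]
      · simp [g5, pow_succ]
  · rintro s' ⟨g1, g2, g3, -, -⟩
    exact hR s' g1 g2 g3

end Loop

/-! ### Running the search for one code. -/

namespace Loop

open Ex Cmd

variable {n : ℕ} {A : ℕ → ℕ → ℕ}

/-- The queue and the number of expanded vertices for a code. -/
def simCode (n : ℕ) (A : ℕ → ℕ → ℕ) (code : ℕ) : List (ℕ × ℕ) × ℕ :=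
  sim n A (n - n / 6) (code / n) 0 [(code % n, code % n)] 0

theorem wp_sim (hn : 2 ≤ n) (hA : ∀ i j, A i j ≤ 1) {s : St} {code : ℕ}
    (he : Env n s) (hm : MatOK n A s) (hc : s.reg 19 = code) (hcn : code < n * 2 ^ (n - n / 6))
    {R : St → Prop}
    (hR : ∀ s', Frame [12, 15, 16, 20, 21, 22, 23, 24, 26] s' s → SameMem n s' s →
      Rep n s' (simCode n A code).1 → Good n (simCode n A code).1 →
      s'.reg 24 = (simCode n A code).2 → (simCode n A code).2 ≤ n → R s') :
    simC.wp (lim n) s R := by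
  obtain ⟨f1, f2, f3, f4, f5, f6, f7⟩ := lim_facts hn
  have hrn : code % n < n := Nat.mod_lt _ (by omega)
  have hrp : 2 ^ (code % n) ≤ 2 ^ n := Nat.pow_le_pow_right (by norm_num) hrn.le
  have hcb : code ≤ 2 ^ n * 2 ^ n := hcn.le.trans (Nat.mul_le_mul f1.le f3)
  have hcd := Nat.div_le_self code n
  refine ⟨by simp, by simp [hc, he.r0]; omega, ⟨by simp, by simp [hc, he.r0]; omega,
    ⟨by simp, by simp; omega, ?_⟩⟩⟩
  refine wp_pow (m := code % n) hn (by simp [hc, he.r0]) (by simp) hrn.le (by simp) ?_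
  refine ⟨by simp, by simp; omega, by simp, by simp, ?_, ?_, by simp, by simp, ?_, ?_, by simp,
    by simp; omega, by simp, by simp, by simp, by simp, ?_⟩
  · simp [he.r5]; exact mem_lim_of_lt (by omega)
  · simp [hc, he.r0]; omega
  · simp [he.r6]; exact mem_lim_of_lt (by omega)
  · simp [hc, he.r0]; omega
  -- The invariant says that completing the simulation from the current queue, counter and remaining
  -- bits gives the final result.
  refine wp_rep (N := n - n / 6) (by simp [he.r0, he.r2]) (by simp) (by simp [lim])
    (fun i s' => Frame [12, 15, 16, 20, 21, 22, 23, 24, 26] s' s ∧ SameMem n s' s ∧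
      s'.reg 23 = i ∧ ∃ Q c b, Rep n s' Q ∧ Good n Q ∧ s'.reg 24 = c ∧ s'.reg 20 = b ∧ c ≤ i ∧
        b ≤ code ∧ sim n A (n - n / 6 - i) b i Q c = simCode n A code) ?_ ?_ ?_
  · refine ⟨?_, ?_, by simp, [(code % n, code % n)], 0, code / n, ⟨?_, ?_, ?_⟩, ⟨?_, ?_⟩, ?_, ?_,
      le_rfl, hcd, rfl⟩
    · refine ((((((((Frame.refl _ s).update 20 _ s.mem).update 12 _ s.mem).update 16 _ s.mem).update
        16 _ s.mem).update 21 _ s.mem).update 22 _ s.mem).update 24 _ s.mem).update 23 _ _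
    · intro a ha
      simp [he.r5, he.r6]
      rw [Function.update_of_ne (by omega), Function.update_of_ne (by omega)]
    · simp [verts, enc]
    · simp
    · intro i v p hi
      obtain ⟨h1, h2⟩ := List.getElem?_eq_some_iff.mp hi
      simp at h1 h2
      subst h1
      simp [he.r5, he.r6, he.r0, hc]
      rw [Function.update_of_ne (by omega)]
      simp [h2]; omega
    · simp
    · simp [verts, hrn]
    · simp
    · simp [hc, he.r0]
  · rintro i s' hi ⟨g1, g2, g3, Q, c, b, g4, g5, g6, g7, g8, g9, g10⟩
    have he' := he.frame g1
    obtain ⟨m, hmm⟩ : ∃ m, n - n / 6 - i = m + 1 := ⟨n - n / 6 - i - 1, by omega⟩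
    rw [hmm, sim] at g10
    have hlast : ∀ s1 Q1 c1, Frame [12, 15, 16, 20, 21, 22, 23, 24, 26] s1 s → SameMem n s1 s →
        s1.reg 23 = i → s1.reg 20 = b → Rep n s1 Q1 → Good n Q1 → s1.reg 24 = c1 → c1 ≤ i + 1 →
        sim n A m (b / 2) (i + 1) Q1 c1 = simCode n A code →
        (assign 20 (var 20 / 2) ;; assign 23 (var 23 + 1)).wp (lim n) s1 (fun s' =>
          Frame [12, 15, 16, 20, 21, 22, 23, 24, 26] s' s ∧ SameMem n s' s ∧
          s'.reg 23 = i + 1 ∧ ∃ Q c b, Rep n s' Q ∧ Good n Q ∧ s'.reg 24 = c ∧ s'.reg 20 = b ∧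
          c ≤ i + 1 ∧ b ≤ code ∧ sim n A (n - n / 6 - (i + 1)) b (i + 1) Q c = simCode n A code) := by
      intro s1 Q1 c1 k1 k2 k3 k4 k5 k6 k7 k8 k9
      refine ⟨by simp, by simp [k4]; omega, by simp, by simp [k3]; omega,
        (k1.update 20 _ s1.mem).update 23 _ _, k2, by simp [k3], Q1, c1, b / 2,
        ⟨by simpa using k5.d, by simpa using k5.t, k5.q⟩, k6, by simpa using k7, by simp [k4], k8,
        by omega, ?_⟩
      rw [show n - n / 6 - (i + 1) = m by omega]; exact k9
    refine ⟨by simp, fun h0 => ?_, fun h0 => ?_⟩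
    · have hcond : ¬ (i < Q.length ∧ b % 2 = 1) := fun ⟨h1, h2⟩ => by
        simp [g4.t, g3, g7] at h0
        omega
      rw [dif_neg hcond] at g10
      exact hlast s' Q c g1 g2 g3 g7 g4 g5 g6 (by omega) g10
    · have hcond : i < Q.length ∧ b % 2 = 1 := by
        simp [g4.t, g3, g7] at h0
        omega
      rw [dif_pos hcond] at g10
      have hlen := g5.length_le
      have hq := (g4.q i (Q[i]'hcond.1).1 (Q[i]'hcond.1).2 (by simp [hcond.1])).1
      have hvn : (Q[i]'hcond.1).1 < n :=
        Finset.mem_range.mp (g5.2 (mem_verts_of_mem (List.getElem_mem hcond.1)))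
      generalize (Q[i]'hcond.1).1 = v at *
      refine ⟨?_, ?_, ?_⟩
      · simp [he'.r5, g3]; exact mem_lim_of_lt (by omega)
      · simp [he'.r5, g3, hq]; omega
      have g1' := g1.update 12 v s'.mem
      simp only [Ex.eval, Op.ap, he'.r5, g3, hq]
      refine wp_expand (v := v) hn hA (he.frame g1') (hm.same g2) g5
        ⟨by simpa using g4.d, by simpa using g4.t, g4.q⟩ (by simp) hvn ?_
      intro s2 k1 k2 k3
      have k4 := (k1.mono (l := [12, 15, 16, 20, 21, 22, 23, 24, 26])).trans g1'
      have k5 : SameMem n s2 s := k2.trans g2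
      have e23 : s2.reg 23 = i := by rw [k1 23 (by simp)]; simpa using g3
      have e24 : s2.reg 24 = c := by rw [k1 24 (by simp)]; simpa using g6
      have e20 : s2.reg 20 = b := by rw [k1 20 (by simp)]; simpa using g7
      refine ⟨by simp, by simp [e24]; omega, ?_⟩
      refine hlast _ (grow A Q v n) (c + 1) (k4.update 24 _ _) k5 (by simpa using e23)
        (by simpa using e20) ⟨by simpa using k3.d, by simpa using k3.t, k3.q⟩
        (g5.grow v le_rfl) (by simp [e24]) (by omega) g10
  · rintro s' ⟨g1, g2, g3, Q, c, b, g4, g5, g6, g7, g8, g9, g10⟩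
    rw [Nat.sub_self, sim] at g10
    rw [← g10] at hR
    exact hR s' g1 g2 g4 g5 g6 (by simp; omega)

end Loop

/-! ### Computing one table entry. -/

namespace Loop

open Ex Cmd

variable {n : ℕ} {A : ℕ → ℕ → ℕ}

theorem enc_le_of_subset {X Y : Finset ℕ} (h : X ⊆ Y) : enc X ≤ enc Y :=
  Finset.sum_le_sum_of_subset h

theorem enc_cut_lt {X : Finset ℕ} {v : ℕ} (h : cut A X v ≠ X) : enc (cut A X v) < enc X :=
  (enc_le_of_subset (cut_subset X v)).lt_of_ne fun e => h (enc_injective e)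

/-- Only entries of subsets of `X` matter, and their masks are at most that of `X`; so filling
larger masks later does no harm. -/
theorem TabOK.congr {k : ℕ} {T T' : ℕ → ℕ} {X : Finset ℕ} (h : TabOK n k A T X)
    (hT : ∀ z ≤ enc X, T' z = T z) : TabOK n k A T' X := fun hX => by
  have hc := fun v => hT _ (enc_le_of_subset (cut_subset (A := A) X v))
  rw [hT _ le_rfl]
  simp only [hc]
  exact h hX

/-- The table in the memory. -/
def tab (n : ℕ) (s : St) (z : ℕ) : ℕ := s.mem (n * n + 2 * n + 3 + z)

theorem wp_fill (hn : 2 ≤ n) (hA : ∀ i j, A i j ≤ 1) {s : St} {X : Finset ℕ}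
    (he : Env n s) (hm : MatOK n A s) (hx : s.reg 8 = enc X) (hX : X ⊆ Finset.range n)
    (hk : X.card ≤ n / 6)
    {R : St → Prop}
    (hR : ∀ s', Frame [12, 13, 14, 15, 16] s' s →
      (∀ a, a ≠ n * n + 2 * n + 3 + enc X → s'.mem a = s.mem a) →
      TabOK n (n / 6) A (tab n s') X → R s') :
    fillC.wp (lim n) s R := by
  obtain ⟨f1, f2, f3, f4, f5, f6, f7⟩ := lim_facts hn
  have hxn := enc_lt hX
  refine ⟨by simp, by simp, ?_, ?_, by simp, by simp, by simp, by simp; omega, ?_⟩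
  · simp [he.r4, hx]; exact mem_lim_table hX hk
  · have : (n * n + n) * (1 - (1 - enc X)) ≤ n * n + n := by
      nlinarith [Nat.sub_le 1 (1 - enc X)]
    simp [he.r0, hx]; omega
  refine wp_rep (N := n) (by simp [he.r0]) (by simp) (by simp [lim])
    (fun i s' => Frame [12, 13, 14, 15, 16] s' s ∧
      (∀ a, a ≠ n * n + 2 * n + 3 + enc X → s'.mem a = s.mem a) ∧ s'.reg 12 = i ∧
      s'.reg 13 = 2 ^ i ∧ ∃ w, s'.mem (n * n + 2 * n + 3 + enc X) = w ∧ w ≤ n * n + n ∧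
      (X = ∅ → w = 0) ∧
      (∀ v < i, v ∉ X → cut A X v ≠ X → w / n ≤ tab n s (enc (cut A X v)) / n + 1) ∧
      (X ≠ ∅ → w < n * n + n → w % n ∉ X ∧ cut A X (w % n) ≠ X ∧
        w / n = tab n s (enc (cut A X (w % n))) / n + 1)) ?_ ?_ ?_
  · refine ⟨((Frame.refl _ s).update 12 _ s.mem).update 13 _ _, fun a ha => ?_, by simp, by simp,
      (n * n + n) * (1 - (1 - enc X)), ?_, ?_, ?_, by simp, ?_⟩
    · simp [he.r4, hx, ha]
    · simp [he.r4, hx, he.r0]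
    · nlinarith [Nat.sub_le 1 (1 - enc X)]
    · rintro rfl; simp [enc]
    · intro h0 h1
      have : 1 ≤ enc X := Nat.one_le_iff_ne_zero.mpr fun h => h0 (enc_injective (h.trans rfl))
      rw [Nat.sub_eq_zero_of_le this] at h1
      simp at h1
  · rintro i s' hi ⟨g1, g2, g3, g4, w, g5, g6, g7, g8, g9⟩
    have he' := he.frame g1
    have hx' : s'.reg 8 = enc X := (g1 8 (by simp)).trans hx
    refine ⟨by simp, by simp, by simp, by simp, by simp, by simp; omega, ?_⟩
    have hm' : MatOK n A s' := fun a ha b hb => by rw [g2 _ (by nlinarith), hm a ha b hb]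
    refine wp_rep (N := n) (by simp [he'.r0]) (by simp) (by simp [lim])
      (fun j s2 => Frame [14, 15, 16] s2 s' ∧ s2.mem = s'.mem ∧ s2.reg 15 = j ∧ s2.reg 16 = 2 ^ j ∧
        s2.reg 14 = ∑ l ∈ Finset.range j, bt (enc X) l * (1 - A i l) * 2 ^ l) ?_ ?_ ?_
    · exact ⟨(((Frame.refl _ s').update 14 _ s.mem).update 15 _ s.mem).update 16 _ _, rfl, by simp,
        by simp, by simp⟩
    · rintro j s2 hj ⟨k1, k2, k3, k4, k5⟩
      have he2 := he'.frame k1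
      have h12 : s2.reg 12 = i := (k1 12 (by simp)).trans g3
      have h8 : s2.reg 8 = enc X := (k1 8 (by simp)).trans hx'
      have haddr : 1 + i * n + j ≤ n * n := by nlinarith
      have hmat : s2.mem (1 + i * n + j) = A i j := by rw [k2]; exact hm' i hi j hj
      have hp : 2 ^ (j + 1) ≤ 2 ^ n := Nat.pow_le_pow_right (by norm_num) (by omega)
      have hb : enc X / 2 ^ j % 2 = bt (enc X) j := rfl
      have hsum : ∑ l ∈ Finset.range (j + 1), bt (enc X) l * (1 - A i l) * 2 ^ l ≤ enc X := by
        refine le_trans (Finset.sum_le_sum fun l _ => ?_)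
          ((sum_bt (enc X) (j + 1)).le.trans (Nat.mod_le _ _))
        exact Nat.mul_le_mul_right _ (mul_le_of_le_one_right (Nat.zero_le _) (Nat.sub_le _ _))
      rw [Finset.sum_range_succ] at hsum
      refine ⟨?_, ?_, by simp, ?_, by simp, ?_, ?_⟩
      · simp [h12, he2.r0, k3]; exact mem_lim_of_lt (by omega)
      · simp [h12, he2.r0, k3, k4, k5, h8, hmat, hb]; omega
      · simp [k3]; omega
      · simp [k4, ← pow_succ]; omega
      · refine ⟨((k1.update 14 _ s.mem).update 15 _ s.mem).update 16 _ _, k2, by simp [k3],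
          by simp [k4, pow_succ], ?_⟩
        simp [h12, he2.r0, k3, k4, k5, h8, hmat, hb, Finset.sum_range_succ]
    · rintro s2 ⟨k1, k2, k3, k4, k5⟩
      rw [enc_filter hX _ (fun l _ => hA i l)] at k5
      change s2.reg 14 = enc (cut A X i) at k5
      have hcs := cut_subset (A := A) X i
      have he2 := he'.frame k1
      have k12 : s2.reg 12 = i := (k1 12 (by simp)).trans g3
      have k13 : s2.reg 13 = 2 ^ i := (k1 13 (by simp)).trans g4
      have k8 : s2.reg 8 = enc X := (k1 8 (by simp)).trans hx'
      have kw : s2.mem (n * n + 2 * n + 3 + enc X) = w := by rw [k2, g5]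
      have hyS := mem_lim_table (hcs.trans hX) ((Finset.card_le_card hcs).trans hk)
      have hxS := mem_lim_table hX hk
      have hp : 2 ^ (i + 1) ≤ 2 ^ n := Nat.pow_le_pow_right (by norm_num) (by omega)
      obtain ⟨y, hy⟩ : ∃ y, s2.mem (n * n + 2 * n + 3 + enc (cut A X i)) = y := ⟨_, rfl⟩
      have hyne : cut A X i ≠ X → y = tab n s (enc (cut A X i)) := fun h => by
        rw [← hy, k2, g2 _ (by have := enc_cut_lt h; omega)]; rfl
      have hyeq : cut A X i = X → y = w := fun h => by rw [← hy, h, kw]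
      have hb : enc X / 2 ^ i % 2 = if i ∈ X then 1 else 0 := bt_enc X i
      have hval : w - (w - ((y / n + 1) * n + i + enc X / 2 ^ i % 2 * (n * n + n))) ≤ w :=
        Nat.sub_le _ _
      set cand := (y / n + 1) * n + i + enc X / 2 ^ i % 2 * (n * n + n) with hcand
      refine ⟨?_, ?_, ?_, ?_, by simp, ?_, by simp, ?_, ?_⟩
      · simp
      · simp [he2.r4, k8, k5]; tauto
      · simp [he2.r4, k8]; exact hxS
      · simp [he2.r4, he2.r0, k8, k5, kw, hy, k12, k13]; omega
      · simp [k12]; omega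
      · simp [k13, ← pow_succ]; omega
      · refine ⟨((k1.mono (l := [12, 13, 14, 15, 16])).trans g1 |>.update 12 _ s.mem).update 13 _ _,
          fun a ha => ?_, by simp [k12], by simp [k13, pow_succ], w - (w - cand), ?_, by omega,
          fun h => by rw [g7 h]; simp, ?_, ?_⟩
        · simp [he2.r4, k8, ha]
          rw [k2, g2 a ha]
        · simp [he2.r4, he2.r0, k8, k5, kw, hy, k12, k13, hcand]
        · intro v hv hvX hvc
          have hdiv : (w - (w - cand)) / n ≤ w / n := Nat.div_le_div_right hval
          rcases Nat.lt_succ_iff_lt_or_eq.mp hv with h | rfl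
          · exact hdiv.trans (g8 v h hvX hvc)
          · have h1 : (w - (w - cand)) / n ≤ cand / n := Nat.div_le_div_right (by omega)
            have h2 : cand / n = y / n + 1 := by
              rw [hcand, hb, if_neg hvX, zero_mul, add_zero, add_comm, Nat.add_mul_div_right _ _ (by omega),
                Nat.div_eq_of_lt hi, zero_add]
            rw [← hyne hvc]
            omega
        · intro h0 h1
          by_cases hcw : cand < w
          · have hiX : i ∉ X := fun h => by
              rw [hb, if_pos h] at hcand; omega
            -- If `i` dominates nothing in `X`, the entry read is the current `w` itself, and `(w /
            -- n + 1) * n` exceeds `w`; such a candidate never wins.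
            have hcX : cut A X i ≠ X := fun h => by
              rw [hyeq h] at hcand
              have := Nat.lt_div_mul_add (a := w) (b := n) (by omega)
              rw [Nat.add_mul] at hcand
              omega
            have hw' : w - (w - cand) = (y / n + 1) * n + i := by
              rw [hb, if_neg hiX] at hcand; omega
            have hmod : (w - (w - cand)) % n = i := by
              rw [hw', Nat.mul_add_mod', Nat.mod_eq_of_lt hi]
            have hdiv : (w - (w - cand)) / n = y / n + 1 := by
              rw [hw', add_comm, Nat.add_mul_div_right _ _ (by omega), Nat.div_eq_of_lt hi, zero_add]
            rw [hmod, hdiv]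
            exact ⟨hiX, hcX, by rw [hyne hcX]⟩
          · have hw' : w - (w - cand) = w := by omega
            rw [hw'] at h1 ⊢
            exact g9 h0 h1
  · rintro s' ⟨g1, g2, g3, g4, w, g5, g6, g7, g8, g9⟩
    refine hR s' g1 g2 fun _ => ?_
    have hw : tab n s' (enc X) = w := g5
    have hcut : ∀ v, cut A X v ≠ X → tab n s' (enc (cut A X v)) = tab n s (enc (cut A X v)) :=
      fun v hv => g2 _ (by have := enc_cut_lt hv; omega)
    rw [hw]
    refine ⟨g6, g7, fun v hv hvX => ?_, fun h0 h1 => ?_⟩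
    · by_cases hc : cut A X v = X
      · rw [hc, hw]; omega
      · rw [hcut v hc]; exact g8 v hv hvX hc
    · obtain ⟨h2, h3, h4⟩ := g9 h0 h1
      exact ⟨h2, by rw [hcut _ h3]; exact h4⟩

end Loop

/-! ### Walking through the masks and searching the codes. -/

namespace Loop

open Ex Cmd

variable {n : ℕ} {A : ℕ → ℕ → ℕ}

/-- Otherwise `card_lowMasks` would give `8 ^ (n - n / 6) ≤ 5 ^ n`, and sixth powers contradict this
because `5 ^ 6 < 8 ^ 5`. -/
theorem card_lowMasks_lt (hn : 2 ≤ n) :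
    (lowMasks n (n / 6 + 1)).card < 4 * 2 ^ (n - n / 6) := by
  by_contra hcon
  have h1 := (Nat.mul_le_mul_right (4 ^ (n - (n / 6 + 1))) (not_lt.mp hcon)).trans
    (card_lowMasks n (n / 6 + 1))
  have h2 : 4 * 2 ^ (n - n / 6) * 4 ^ (n - (n / 6 + 1)) = 8 ^ (n - n / 6) := by
    obtain ⟨d, hd⟩ : ∃ d, n - n / 6 = d + 1 := ⟨n - n / 6 - 1, by omega⟩
    rw [show n - (n / 6 + 1) = d by omega, hd, show (8 : ℕ) = 2 * 4 by norm_num, mul_pow, pow_succ 4]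
    ring
  rw [h2] at h1
  have h3 : (8 : ℕ) ^ (5 * n) ≤ (8 ^ (n - n / 6)) ^ 6 := by
    rw [← pow_mul]
    exact Nat.pow_le_pow_right (by norm_num) (by omega)
  have h4 := h3.trans (Nat.pow_le_pow_left h1 6)
  rw [← pow_mul, mul_comm n 6, pow_mul, pow_mul] at h4
  exact absurd h4 (not_le.mpr (Nat.pow_lt_pow_left (by norm_num) (by omega)))

theorem wp_init (hn : 2 ≤ n) {s : St} (h0 : s.mem 0 = n) {R : St → Prop}
    (hR : ∀ s', Env n s' → s'.mem = s.mem → R s') : initC.wp (lim n) s R := by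
  obtain ⟨f1, f2, f3, f4, f5, f6, f7⟩ := lim_facts hn
  have hnp : n * 2 ^ (n - n / 6) ≤ 2 ^ n * 2 ^ n := Nat.mul_le_mul f1.le f3
  refine ⟨by simp; exact mem_lim_of_lt (by omega), by simp [h0]; omega, by simp, by simp; omega, ?_⟩
  refine wp_pow (m := n) hn (by simp [h0]) (by simp) le_rfl (by simp) ?_
  refine ⟨by simp, by simp [h0]; omega, by simp, by simp; omega, ?_⟩
  refine wp_pow (m := n - n / 6) hn (by simp [h0]) (by simp) (Nat.sub_le _ _) (by simp) ?_
  refine ⟨by simp, by simp [h0]; omega, by simp, by simp [h0]; omega, by simp, by simp [h0]; omega,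
    by simp, by simp [h0]; omega, hR _ ⟨?_, ?_, ?_, ?_, ?_, ?_, ?_, ?_⟩ rfl⟩
  all_goals simp [h0]
  all_goals omega

/-- Until the walk reaches `2 ^ n`, each round passes a new mask with at most `n / 6 + 1` bits.
There are fewer such masks than rounds, so the walk does reach the end. -/
theorem wp_table (hn : 2 ≤ n) (hA : ∀ i j, A i j ≤ 1) {s : St}
    (he : Env n s) (hm : MatOK n A s) {R : St → Prop}
    (hR : ∀ s', Env n s' → MatOK n A s' →
      (∀ X ⊆ Finset.range n, TabOK n (n / 6) A (tab n s') X) → R s') :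
    tableC.wp (lim n) s R := by
  obtain ⟨f1, f2, f3, f4, f5, f6, f7⟩ := lim_facts hn
  refine ⟨by simp, by simp, ?_⟩
  refine wp_rep (N := 4 * 2 ^ (n - n / 6)) (by simp [he.r3]) (by simp)
    (by simp only [lim, if_true]; nlinarith [Nat.one_le_two_pow (n := n - n / 6)])
    (fun i s' => Env n s' ∧ MatOK n A s' ∧ ∃ x, s'.reg 8 = x ∧ x ≤ 2 ^ n ∧
      (x < 2 ^ n → pop n x ≤ n / 6 + 1) ∧
      (∀ Y ⊆ Finset.range n, enc Y < x → TabOK n (n / 6) A (tab n s') Y) ∧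
      (i ≤ ((Finset.range x).filter (pop n · ≤ n / 6 + 1)).card ∨ x = 2 ^ n)) ?_ ?_ ?_
  · refine ⟨he.frame ((Frame.refl [8] s).update 8 _ _), hm, 0, by simp, by omega, fun _ => ?_,
      by simp, by simp⟩
    simp [pop, bt]
  · rintro i s1 hi ⟨e1, m1, x, hx, hxn, hpx, hT, hcount⟩
    refine ⟨by simp, fun h0 => ?_, fun h0 => ?_⟩
    · simp [e1.r1, hx] at h0
      have hx2 : x = 2 ^ n := by omega
      exact ⟨e1, m1, x, hx, hxn, hpx, hT, Or.inr hx2⟩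
    simp [e1.r1, hx] at h0
    have hxlt : x < 2 ^ n := by omega
    obtain ⟨X, hX, hXx⟩ := exists_enc hxlt
    have hpX : pop n x = X.card := by rw [← hXx, pop_enc hX]
    refine wp_pop (x := x) hn e1 (by simp [hx]) (by simp) hxlt fun s2 k1 k2 k3 k4 => ?_
    have e2 := e1.frame k1
    have m2 : MatOK n A s2 := fun a ha b hb => by rw [k2]; exact m1 a ha b hb
    have hx2 : s2.reg 8 = x := (k1 8 (by simp)).trans hx
    have hT2 : ∀ Y ⊆ Finset.range n, enc Y < x → TabOK n (n / 6) A (tab n s2) Y := fun Y hY hYx =>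
      (hT Y hY hYx).congr fun z _ => by rw [tab, k2, tab]
    have hfinal : ∀ s3 l, Env n s3 → MatOK n A s3 → s3.reg 8 = x → s3.reg 10 = l → 1 ≤ l →
        x + l ≤ 2 ^ n → pop n (x + l) ≤ n / 6 + 1 →
        (∀ Y ⊆ Finset.range n, enc Y < x + l → TabOK n (n / 6) A (tab n s3) Y) →
        (assign 8 (var 8 + var 10)).wp (lim n) s3 (fun s' => Env n s' ∧ MatOK n A s' ∧
          ∃ x, s'.reg 8 = x ∧ x ≤ 2 ^ n ∧ (x < 2 ^ n → pop n x ≤ n / 6 + 1) ∧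
          (∀ Y ⊆ Finset.range n, enc Y < x → TabOK n (n / 6) A (tab n s') Y) ∧
          (i + 1 ≤ ((Finset.range x).filter (pop n · ≤ n / 6 + 1)).card ∨ x = 2 ^ n)) := by
      intro s3 l e3 m3 hx3 hl3 hl hle hpop hT3
      refine ⟨by simp, by simp [hx3, hl3]; omega, e3.frame ((Frame.refl [8] s3).update 8 _ _), m3,
        x + l, by simp [hx3, hl3], hle, fun _ => hpop, hT3, Or.inl ?_⟩
      have hi' := hcount.resolve_right hxlt.ne
      have hsub : insert x ((Finset.range x).filter (pop n · ≤ n / 6 + 1)) ⊆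
          (Finset.range (x + l)).filter (pop n · ≤ n / 6 + 1) := by
        intro z hz
        rw [Finset.mem_insert, Finset.mem_filter, Finset.mem_range] at hz
        rw [Finset.mem_filter, Finset.mem_range]
        rcases hz with rfl | hz
        · exact ⟨by omega, hpx hxlt⟩
        · exact ⟨by omega, hz.2⟩
      have := Finset.card_le_card hsub
      rw [Finset.card_insert_of_notMem (by simp)] at this
      omega
    refine ⟨by simp, fun h1 => ?_, fun h1 => ?_⟩
    · simp [e2.r2, k3] at h1
      have hp := k4.pop_add_le hxlt (by omega)
      refine hfinal s2 _ e2 m2 hx2 rfl k4.le.1 hp.2 (hp.1.trans (hpx hxlt)) fun Y hY hYx => ?_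
      by_cases hlt : enc Y < x
      · exact hT2 Y hY hlt
      -- The jump starts from more than `n / 6` bits and no mask passed over has fewer, so `Y` needs
      -- no entry.
      · intro hYk
        have := k4.pop_le (not_lt.mp hlt) hYx
        rw [pop_enc hY] at this
        omega
    · simp [e2.r2, k3] at h1
      refine wp_fill hn hA e2 m2 (hx2.trans hXx.symm) hX (by omega) ?_
      intro s3 q1 q2 q3
      have e3 := e2.frame q1
      have m3 : MatOK n A s3 := fun a ha b hb => by rw [q2 _ (by nlinarith)]; exact m2 a ha b hb
      refine ⟨by simp, by simp; omega, ?_⟩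
      refine hfinal _ 1 (e3.frame ((Frame.refl [10] s3).update 10 _ _)) m3 ?_ (by simp) le_rfl
        (by omega) ((pop_succ_le n x).trans (by omega)) fun Y hY hYx => ?_
      · simp; rw [q1 8 (by simp)]; exact hx2
      · rcases Nat.lt_succ_iff_lt_or_eq.mp hYx with h | h
        · exact (hT2 Y hY h).congr fun z hz => q2 _ (by omega)
        · rw [enc_injective (h.trans hXx.symm)]; exact q3
  · rintro s' ⟨e1, m1, x, hx, hxn, hpx, hT, hcount⟩
    refine hR s' e1 m1 fun X hX => hT X hX ((enc_lt hX).trans_le (le_of_eq ?_))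
    rcases hcount with h | h
    · exfalso
      have h1 : (Finset.range x).filter (pop n · ≤ n / 6 + 1) ⊆ lowMasks n (n / 6 + 1) :=
        Finset.filter_subset_filter _ (Finset.range_subset_range.mpr hxn)
      have := Finset.card_le_card h1
      have := card_lowMasks_lt hn
      omega
    · exact h.symm

/-- The set of vertices not reached with a code. -/
def rest (n : ℕ) (A : ℕ → ℕ → ℕ) (code : ℕ) : Finset ℕ :=
  Finset.range n \ verts (simCode n A code).1

/-- The value of the solution with a given code. -/
def val (n : ℕ) (A : ℕ → ℕ → ℕ) (T : ℕ → ℕ) (code : ℕ) : ℕ :=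
  (simCode n A code).2 + T (enc (rest n A code)) / n

/-- Among the first `m` codes, `best` represents the best solution. -/
def Best (n : ℕ) (A : ℕ → ℕ → ℕ) (T : ℕ → ℕ) (m best : ℕ) : Prop :=
  best ≤ (n + 1) * (n * 2 ^ (n - n / 6)) ∧
  (∀ code < m, (rest n A code).card ≤ n / 6 →
    best / (n * 2 ^ (n - n / 6)) ≤ val n A T code) ∧
  (best < (n + 1) * (n * 2 ^ (n - n / 6)) →
    (rest n A (best % (n * 2 ^ (n - n / 6)))).card ≤ n / 6 ∧
    best / (n * 2 ^ (n - n / 6)) = val n A T (best % (n * 2 ^ (n - n / 6))))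

theorem tab_same {s s' : St} (h : SameMem n s' s) : tab n s' = tab n s :=
  funext fun z => h _ (Or.inr (by omega))

theorem wp_search (hn : 2 ≤ n) (hA : ∀ i j, A i j ≤ 1) {s : St} (he : Env n s) (hm : MatOK n A s)
    {R : St → Prop} (hR : ∀ s', Env n s' → SameMem n s' s →
      Best n A (tab n s) (n * 2 ^ (n - n / 6)) (s'.reg 17) → R s') :
    searchC.wp (lim n) s R := by
  obtain ⟨f1, f2, f3, f4, f5, f6, f7⟩ := lim_facts hn
  have hC1 : (n + 1) * (n * 2 ^ (n - n / 6)) ≤ 2 ^ n * 2 ^ n * 2 ^ n := by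
    rw [mul_assoc]
    exact Nat.mul_le_mul f1 (Nat.mul_le_mul f1.le f3)
  have hC2 : n * 2 ^ (n - n / 6) ≤ 2 ^ n * 2 ^ n := Nat.mul_le_mul f1.le f3
  have hC0 : 0 < n * 2 ^ (n - n / 6) := by positivity
  obtain ⟨C, hC⟩ : ∃ C, n * 2 ^ (n - n / 6) = C := ⟨_, rfl⟩
  have hC3 : (n + 1) * C ≤ 2 ^ n * 2 ^ n * 2 ^ n := hC ▸ hC1
  refine ⟨by simp, by simp [he.r0, he.r7]; omega, by simp, by simp, ?_⟩
  refine wp_rep (N := C) (by simp [he.r7, hC]) (by simp)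
    (by simp only [lim, if_true]; omega)
    (fun i s' => Env n s' ∧ SameMem n s' s ∧ s'.reg 19 = i ∧ Best n A (tab n s) i (s'.reg 17))
    ?_ ?_ ?_
  · refine ⟨he.frame (((Frame.refl [17, 19] s).update 17 _ s.mem).update 19 _ _), fun _ _ => rfl,
      by simp, ?_⟩
    refine ⟨?_, by simp, ?_⟩
    · simp [he.r0, he.r7]
    · simp [he.r0, he.r7]
  · rintro i s1 hi ⟨e1, m1, h19, hb⟩
    refine wp_sim (code := i) hn hA e1 (hm.same m1) h19 (by omega) ?_
    intro s2 k1 k2 k3 k4 k5 k6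
    have e2 := e1.frame k1
    have h17 : s2.reg 17 = s1.reg 17 := k1 17 (by simp)
    have hR : 2 ^ n - 1 - enc (verts (simCode n A i).1) = enc (rest n A i) := enc_sdiff k4.2
    have hRs : rest n A i ⊆ Finset.range n := Finset.sdiff_subset
    have hRl := enc_lt hRs
    have h28 : s2.reg 1 - 1 - s2.reg 21 = enc (rest n A i) := by rw [e2.r1, k3.d, hR]
    refine ⟨by simp, by simp [h28]; omega, ?_⟩
    have e3 := e2.frame ((Frame.refl [28] s2).update 28 ((var 1 - 1 - var 21).eval s2) s2.mem)
    refine wp_pop (x := enc (rest n A i)) hn e3 (by simp [h28]) (by simp) hRl ?_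
    intro s4 q1 q2 q3 q4
    have e4 := e3.frame q1
    have m4 : SameMem n s4 s := fun a ha => by
      rw [q2]; exact (k2.trans m1) a ha
    have h4_17 : s4.reg 17 = s1.reg 17 := by rw [q1 17 (by simp)]; simpa using h17
    have h4_19 : s4.reg 19 = i := by rw [q1 19 (by simp)]; simpa [k1 19] using h19
    have h4_24 : s4.reg 24 = (simCode n A i).2 := by rw [q1 24 (by simp)]; simpa using k5
    have h4_28 : s4.reg 28 = enc (rest n A i) := by rw [q1 28 (by simp)]; simp [h28]
    rw [pop_enc hRs] at q3
    obtain ⟨b1, b2, b3⟩ := hb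
    rw [hC] at b1 b2 b3
    refine ⟨by simp, fun h0 => ?_, fun h0 => ?_⟩
    · simp [e4.r2, q3] at h0
      refine ⟨by simp, by simp [h4_19]; omega, e4.frame ((Frame.refl [19] s4).update 19 _ _), m4,
        by simp [h4_19], ?_⟩
      simp only [Best, hC]
      refine ⟨by simpa [h4_17] using b1, fun code hcode hk => ?_, by simpa [h4_17] using b3⟩
      rcases Nat.lt_succ_iff_lt_or_eq.mp hcode with h | rfl
      · simpa [h4_17] using b2 code h hk
      · omega
    · simp [e4.r2, q3] at h0
      have hk : (rest n A i).card ≤ n / 6 := by omega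
      have htab : s4.mem (n * n + 2 * n + 3 + enc (rest n A i)) = tab n s (enc (rest n A i)) :=
        m4 _ (Or.inr (by omega))
      have hval : (simCode n A i).2 + tab n s (enc (rest n A i)) / n = val n A (tab n s) i := rfl
      have hS := mem_lim_table hRs hk
      refine ⟨?_, ?_, by simp, ?_, ?_, ?_, ?_, ?_⟩
      · simp [e4.r4, h4_28]; exact hS
      · simp [h4_17]; omega
      · simp [h4_19]; omega
      · exact e4.frame (((Frame.refl [17, 19] s4).update 17 _ s4.mem).update 19 _ _)
      · exact m4
      · simp [h4_19]
      · simp [h4_17, h4_19, h4_24, h4_28, e4.r4, e4.r0, e4.r7, htab, hval, hC]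
        generalize s1.reg 17 = w at *
        -- Since `i < C`, quotient and remainder by `C` recover value and code, and comparing these
        -- numbers compares values first.
        set cand := val n A (tab n s) i * C + i with hcand
        have hCpos : 0 < C := by omega
        have hcd : cand / C = val n A (tab n s) i := by
          rw [hcand, add_comm, Nat.add_mul_div_right _ _ hCpos, Nat.div_eq_of_lt hi, zero_add]
        have hcm : cand % C = i := by
          rw [hcand, Nat.mul_add_mod', Nat.mod_eq_of_lt hi]
        have hd : (w - (w - cand)) / C ≤ w / C := Nat.div_le_div_right (Nat.sub_le _ _)
        simp only [Best, hC]
        refine ⟨(Nat.sub_le _ _).trans b1, fun code hcode hk' => ?_, fun hlt => ?_⟩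
        · rcases Nat.lt_succ_iff_lt_or_eq.mp hcode with h | rfl
          · exact hd.trans (b2 code h hk')
          · rw [← hcd]; exact Nat.div_le_div_right (by omega)
        · by_cases hcw : cand < w
          · rw [show w - (w - cand) = cand by omega, hcd, hcm]
            exact ⟨hk, rfl⟩
          · rw [show w - (w - cand) = w by omega] at hlt ⊢
            exact b3 hlt
  · rintro s' ⟨e1, m1, h19, hb⟩
    exact hR s' e1 m1 (hC ▸ hb)

end Loop

/-! ### Reconstructing and writing the optimal tree. -/

namespace Loop

open Ex Cmd

variable {n : ℕ} {A : ℕ → ℕ → ℕ}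

theorem index_inj {i j i' j' : ℕ} (hj : j < n) (hj' : j' < n)
    (h : 1 + i * n + j = 1 + i' * n + j') : i = i' ∧ j = j' := by
  have h1 : (j + i * n) % n = (j' + i' * n) % n := by congr 1; omega
  rw [Nat.add_mul_mod_self_right, Nat.add_mul_mod_self_right, Nat.mod_eq_of_lt hj,
    Nat.mod_eq_of_lt hj'] at h1
  subst h1
  exact ⟨Nat.eq_of_mul_eq_mul_right (by omega : 0 < n) (by omega), rfl⟩

theorem wp_write (hn : 2 ≤ n) {s : St} {Q : List (ℕ × ℕ)} (he : Env n s) (hr : Rep n s Q)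
    (hlen : Q.length = n) (hQ : ∀ t v u : ℕ, Q[t]? = some (v, u) → v < n ∧ u < n) {R : St → Prop}
    (hR : ∀ s', (∀ u < n, ∀ v < n, ((∃ t : ℕ, 1 ≤ t ∧ Q[t]? = some (v, u)) → s'.mem (1 + u * n + v) = 1) ∧
      ((¬ ∃ t : ℕ, 1 ≤ t ∧ Q[t]? = some (v, u)) → s'.mem (1 + u * n + v) = 0)) → R s') :
    writeC.wp (lim n) s R := by
  obtain ⟨f1, f2, f3, f4, f5, f6, f7⟩ := lim_facts hn
  refine ⟨by simp, by simp; omega, ?_⟩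
  refine wp_rep (N := n) (by simp [he.r0]) (by simp) (by simp [lim])
    (fun i s1 => Frame [15] s1 s ∧ s1.reg 15 = 1 + i * n ∧ (∀ a, n * n < a → s1.mem a = s.mem a) ∧
      ∀ a, 1 ≤ a → a < 1 + i * n → s1.mem a = 0) ?_ ?_ ?_
  · exact ⟨(Frame.refl _ s).update 15 _ _, by simp, fun _ _ => rfl, fun a h1 h2 => by omega⟩
  · rintro i s1 hi ⟨g1, g2, g3, g4⟩
    have hin : i * n + n ≤ n * n := by nlinarith
    refine wp_rep (N := n) (by simp [(he.frame g1).r0]) (by simp) (by simp [lim])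
      (fun j s2 => Frame [15] s2 s ∧ s2.reg 15 = 1 + i * n + j ∧
        (∀ a, n * n < a → s2.mem a = s.mem a) ∧
        ∀ a, 1 ≤ a → a < 1 + i * n + j → s2.mem a = 0) ⟨g1, g2, g3, g4⟩ ?_ ?_
    · rintro j s2 hj ⟨k1, k2, k3, k4⟩
      refine ⟨by simp, by simp, ?_, by simp, by simp, by simp [k2]; omega, k1.update 15 _ _,
        by simp [k2]; omega, fun a ha => ?_, fun a h1 h2 => ?_⟩
      · simp [k2]; exact mem_lim_of_lt (by omega)
      · simp [k2]
        rw [Function.update_of_ne (by omega)]; exact k3 a ha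
      · simp [k2]
        by_cases h : a = 1 + i * n + j
        · simp [h]
        · rw [Function.update_of_ne h]; exact k4 a h1 (by omega)
    · rintro s2 ⟨k1, k2, k3, k4⟩
      rw [Nat.add_mul, one_mul, ← Nat.add_assoc]
      exact ⟨k1, k2, k3, k4⟩
  rintro s1 ⟨g1, g2, g3, g4⟩
  have e1 := he.frame g1
  refine ⟨by simp, by simp; omega, ?_⟩
  refine wp_rep (N := n - 1) (by simp [e1.r0]) (by simp) (by simp [lim])
    (fun i s2 => Frame [15, 23] s2 s ∧ s2.reg 23 = 1 + i ∧ (∀ a, n * n < a → s2.mem a = s.mem a) ∧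
      ∀ u < n, ∀ v < n, ((∃ t : ℕ, 1 ≤ t ∧ t < 1 + i ∧ Q[t]? = some (v, u)) → s2.mem (1 + u * n + v) = 1) ∧
      ((¬ ∃ t : ℕ, 1 ≤ t ∧ t < 1 + i ∧ Q[t]? = some (v, u)) → s2.mem (1 + u * n + v) = 0)) ?_ ?_ ?_
  · refine ⟨(g1.mono).update 23 _ _, by simp, g3, fun u hu v hv => ⟨?_, fun _ => ?_⟩⟩
    · rintro ⟨t, h1, h2, -⟩; omega
    · exact g4 _ (by omega) (by nlinarith)
  · rintro i s2 hi ⟨k1, k2, k3, k4⟩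
    have e2 := he.frame k1
    obtain ⟨v, u, hvu⟩ : ∃ v u, Q[1 + i]? = some (v, u) :=
      ⟨_, _, List.getElem?_eq_getElem (by omega)⟩
    obtain ⟨hv, hu⟩ := hQ _ _ _ hvu
    obtain ⟨q1, q2⟩ := hr.q _ _ _ hvu
    rw [← k3 _ (by omega)] at q1 q2
    have haddr : 1 + u * n + v ≤ n * n := by nlinarith
    refine ⟨?_, by simp, ?_, by simp; omega, by simp, by simp [k2]; omega, k1.update 23 _ _,
      by simp [k2]; omega, fun a ha => ?_, fun u' hu' v' hv' => ?_⟩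
    · simp [e2.r5, e2.r6, k2]
      exact ⟨mem_lim_of_lt (by omega), mem_lim_of_lt (by omega)⟩
    · simp [e2.r5, e2.r6, e2.r0, k2, q1, q2]; exact mem_lim_of_lt (by omega)
    · simp [e2.r5, e2.r6, e2.r0, k2, q1, q2]
      rw [Function.update_of_ne (by omega)]; exact k3 a ha
    · simp only [Ex.eval, Op.ap, Ex.eval_add, Ex.eval_mul, e2.r5, e2.r6, e2.r0, k2, q1,
        q2]
      by_cases heq : 1 + u' * n + v' = 1 + u * n + v
      · obtain ⟨rfl, rfl⟩ := index_inj hv' hv heq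
        simp only [Function.update_self, true_and, implies_true]
        intro hne
        exact absurd ⟨1 + i, by omega, by omega, hvu⟩ hne
      · rw [Function.update_of_ne heq]
        obtain ⟨p1, p2⟩ := k4 u' hu' v' hv'
        constructor
        · rintro ⟨t, h1, h2, h3⟩
          refine p1 ⟨t, h1, ?_, h3⟩
          rcases Nat.lt_succ_iff_lt_or_eq.mp (show t < (1 + i) + 1 by omega) with h | rfl
          · exact h
          · rw [hvu] at h3
            obtain ⟨rfl, rfl⟩ := Prod.mk.inj (Option.some.inj h3)
            exact absurd rfl heq
        · intro hne
          exact p2 fun ⟨t, h1, h2, h3⟩ => hne ⟨t, h1, by omega, h3⟩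
  · rintro s2 ⟨k1, k2, k3, k4⟩
    refine hR s2 fun u hu v hv => ?_
    obtain ⟨p1, p2⟩ := k4 u hu v hv
    constructor
    · rintro ⟨t, h1, h2⟩
      have := (List.getElem?_eq_some_iff.mp h2).1
      exact p1 ⟨t, h1, by omega, h2⟩
    · intro hne
      exact p2 fun ⟨t, h1, _, h2⟩ => hne ⟨t, h1, h2⟩

/-- The root occurs only at index `0`, so skipping this index drops exactly the entry that is no arc
of `treeOf`. -/
theorem WF.mem_tail_iff {r : ℕ} {E : Finset ℕ} {Q : List (ℕ × ℕ)} (h : WF n A r E Q) (u v : ℕ) :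
    (∃ t : ℕ, 1 ≤ t ∧ Q[t]? = some (v, u)) ↔ (v, u) ∈ Q ∧ v ≠ r := by
  obtain ⟨Q', hQ'⟩ := h.head
  have hnd := h.nodup
  rw [hQ'] at hnd ⊢
  have hr : r ∉ Q'.map Prod.fst := (List.nodup_cons.mp hnd).1
  constructor
  · rintro ⟨t, h1, h2⟩
    obtain ⟨t, rfl⟩ : ∃ t', t = t' + 1 := ⟨t - 1, by omega⟩
    rw [List.getElem?_cons_succ] at h2
    have hm := List.mem_of_getElem? h2
    refine ⟨List.mem_cons_of_mem _ hm, fun hv => hr ?_⟩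
    exact List.mem_map.mpr ⟨_, hm, hv⟩
  · rintro ⟨h1, h2⟩
    rcases List.mem_cons.mp h1 with h1 | h1
    · exact absurd (Prod.mk.inj h1).1 h2
    · obtain ⟨t, ht⟩ := List.mem_iff_getElem?.mp h1
      exact ⟨t + 1, by omega, by simpa using ht⟩

theorem Best.le_card {T : ℕ → ℕ} {best r : ℕ} {I : Finset ℕ}
    (hb : Best n A T (n * 2 ^ (n - n / 6)) best)
    (hT : ∀ X ⊆ Finset.range n, TabOK n (n / 6) A T X) (hA : ∀ i j, A i j ≤ 1) (hr : r < n)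
    (hI : I ⊆ Finset.range n) (hs : Spans n A r I) :
    best / (n * 2 ^ (n - n / 6)) ≤ I.card := by
  obtain ⟨b, hb1, hb2, hb3⟩ := exists_code hT (fun i _ j _ => hA i j) hI hs hr
  have hmod : (b * n + r) % n = r := by rw [Nat.mul_add_mod', Nat.mod_eq_of_lt hr]
  have hdiv : (b * n + r) / n = b := by
    rw [add_comm, Nat.add_mul_div_right _ _ (by omega), Nat.div_eq_of_lt hr, zero_add]
  have hsim : simCode n A (b * n + r) = sim n A (n - n / 6) b 0 [(r, r)] 0 := by
    rw [simCode, hmod, hdiv]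
  have hlt : b * n + r < n * 2 ^ (n - n / 6) := by nlinarith
  refine (hb.2.1 _ hlt ?_).trans ?_
  · rw [rest, hsim]; exact hb2
  · rw [val, rest, hsim]; exact hb3

theorem wp_output (hn : 2 ≤ n) {G : Digraph (Fin n)} {s : St} (he : Env n s)
    (hm : MatOK n (adjMat G) s)
    (hT : ∀ X ⊆ Finset.range n, TabOK n (n / 6) (adjMat G) (tab n s) X)
    (hb : Best n (adjMat G) (tab n s) (n * 2 ^ (n - n / 6)) (s.reg 17)) :
    outputC.wp (lim n) s fun s' => IsCorrectAnswer G s'.mem := by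
  obtain ⟨f1, f2, f3, f4, f5, f6, f7⟩ := lim_facts hn
  have hA := adjMat_le G
  have hC0 : 0 < n * 2 ^ (n - n / 6) := by positivity
  have hC2 : n * 2 ^ (n - n / 6) ≤ 2 ^ n * 2 ^ n := Nat.mul_le_mul f1.le f3
  refine ⟨by simp, by simp, ?_, by simp, ?_⟩
  · simp; exact mem_lim_of_lt (by omega)
  set s1 : St := ⟨s.reg, Function.update s.mem (Ex.eval s 0) (Ex.eval s 0)⟩ with hs1
  have hmem0 : s1.mem 0 = 0 := by simp [hs1]
  have hmem : ∀ a, a ≠ 0 → s1.mem a = s.mem a := fun a ha => by simp [hs1, ha]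
  have e1 : Env n s1 := he.frame (Frame.refl [] s)
  have m1 : MatOK n (adjMat G) s1 := fun i hi j hj => by
    rw [hmem _ (by omega)]; exact hm i hi j hj
  have ht1 : tab n s1 = tab n s := funext fun z => hmem _ (by omega)
  have h17 : s1.reg 17 = s.reg 17 := rfl
  clear_value s1
  refine ⟨by simp, fun h0 => ?_, fun h0 => ?_⟩
  · simp [e1.r0, e1.r7, h17] at h0
    refine Or.inl ⟨hmem0, fun ⟨T, r, h⟩ => ?_⟩
    have h1 := hb.le_card hT hA r.2 (inner_subset T) h.spans
    have h2 := Finset.card_le_card (inner_subset T)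
    rw [Finset.card_range] at h2
    -- An untouched initial value means a best value of at least `n + 1`, more than the inner
    -- vertices of any tree.
    have h3 := (Nat.le_div_iff_mul_le hC0).mpr (Nat.sub_eq_zero_iff_le.mp h0)
    omega
  · simp [e1.r0, e1.r7, h17] at h0
    have hlt : s.reg 17 < (n + 1) * (n * 2 ^ (n - n / 6)) := by omega
    obtain ⟨hk, hval⟩ := hb.2.2 hlt
    have hmin := fun r hr I hI hs => hb.le_card (r := r) (I := I) hT hA hr hI hs
    have hv0 : s.reg 17 / (n * 2 ^ (n - n / 6)) ≤ n := by
      have := (Nat.div_lt_iff_lt_mul hC0).mpr hlt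
      omega
    have hcode : s.reg 17 % (n * 2 ^ (n - n / 6)) < n * 2 ^ (n - n / 6) := Nat.mod_lt _ hC0
    have hevc : (Ex.mod (var 17) (var 7)).eval s1 = s.reg 17 % (n * 2 ^ (n - n / 6)) := by
      simp [e1.r7, h17]
    generalize s.reg 17 / (n * 2 ^ (n - n / 6)) = v0 at *
    generalize s.reg 17 % (n * 2 ^ (n - n / 6)) = code at *
    refine ⟨by simp, by omega, ?_⟩
    rw [hevc]
    refine wp_sim (A := adjMat G) (code := code) hn hA
      (e1.frame ((Frame.refl [19] s1).update 19 _ _)) m1 (by simp) hcode ?_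
    intro s2 k1 k2 k3 k4 k5 k6
    have e2 : Env n s2 := (e1.frame ((Frame.refl [19] s1).update 19 code s1.mem)).frame k1
    have m2 : MatOK n (adjMat G) s2 := MatOK.same (s := s1) m1 k2
    have t2 : tab n s2 = tab n s := (tab_same (s := s1) k2).trans ht1
    have hrn : code % n < n := Nat.mod_lt _ (by omega)
    obtain ⟨E0, hw0, hE0⟩ := sim_sound (A := adjMat G) hrn (n - n / 6) (code / n) 0 _ 0 ∅ .root
      (by simp)
    change WF n (adjMat G) (code % n) E0 (simCode n (adjMat G) code).1 at hw0
    change E0.card ≤ (simCode n (adjMat G) code).2 at hE0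
    unfold val rest at hval
    unfold rest at hk
    generalize simCode n (adjMat G) code = S at *
    generalize code % n = r at *
    -- While vertices are missing, a round lowers the table value by one and adds at most one vertex
    -- to `E`, so the total stays within `v0`. The bound `n - i` on the table value forces
    -- completion after `n` rounds.
    refine wp_rep (N := n) (by simp [e2.r0]) (by simp) (by simp [lim])
      (fun i s3 => Env n s3 ∧ MatOK n (adjMat G) s3 ∧ tab n s3 = tab n s ∧ ∃ Q E, Rep n s3 Q ∧
        Good n Q ∧ WF n (adjMat G) r E Q ∧ (Finset.range n \ verts Q).card ≤ n / 6 ∧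
        E.card + tab n s (enc (Finset.range n \ verts Q)) / n ≤ v0 ∧
        tab n s (enc (Finset.range n \ verts Q)) / n ≤ n - i) ?_ ?_ ?_
    · exact ⟨e2, m2, t2, S.1, E0, k3, k4, hw0, hk, by omega, by omega⟩
    · rintro i s3 hi ⟨e3, m3, t3, Q, E, g1, g2, g3, g4, g5, g6⟩
      have hR : 2 ^ n - 1 - enc (verts Q) = enc (Finset.range n \ verts Q) := enc_sdiff g2.2
      have hRs : Finset.range n \ verts Q ⊆ Finset.range n := Finset.sdiff_subset
      have htab : s3.mem (n * n + 2 * n + 3 + enc (Finset.range n \ verts Q)) =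
          tab n s (enc (Finset.range n \ verts Q)) := congrFun t3 _
      have hTR := hT _ hRs g4
      have hvn : tab n s (enc (Finset.range n \ verts Q)) % n < n := Nat.mod_lt _ (by omega)
      have hS := mem_lim_table hRs g4
      refine ⟨?_, ?_, ?_⟩
      · simp [e3.r4, e3.r1, g1.d, hR]; exact hS
      · simp [e3.r4, e3.r1, e3.r0, g1.d, hR, htab]; omega
      have hev : (Ex.mod (load (var 4 + (var 1 - 1 - var 21))) (var 0)).eval s3 =
          tab n s (enc (Finset.range n \ verts Q)) % n := by
        simp [e3.r4, e3.r1, e3.r0, g1.d, hR, htab]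
      obtain ⟨v, hv⟩ : ∃ v, tab n s (enc (Finset.range n \ verts Q)) % n = v := ⟨_, rfl⟩
      rw [hv] at hvn hev
      rw [hev]
      have e3' := e3.frame ((Frame.refl [12] s3).update 12 v s3.mem)
      refine wp_expand (A := adjMat G) hn hA e3' m3 g2
        ⟨by simpa using g1.d, by simpa using g1.t, g1.q⟩ (by simp) hvn ?_
      intro s4 p1 p2 p3
      refine ⟨e3'.frame p1, MatOK.same (s := s3) m3 p2, (tab_same (s := s3) p2).trans t3,
        grow (adjMat G) Q v n, ?_⟩
      rw [range_sdiff_verts_grow (fun i _ j _ => hA i j) hvn]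
      by_cases hemp : Finset.range n \ verts Q = ∅
      · have hall : grow (adjMat G) Q v n = Q :=
          grow_eq_self fun j hj _ => by
            have := Finset.sdiff_eq_empty_iff_subset.mp hemp
            exact this (Finset.mem_range.mpr hj)
        rw [hall] at p3 ⊢
        have h0 := hTR.2.1 hemp
        rw [hemp] at g4 g5 h0 ⊢
        have hcut : ∀ v, cut (adjMat G) ∅ v = ∅ := fun v => by simp [cut]
        rw [hcut]
        exact ⟨E, p3, g2, g3, g4, g5, by rw [h0]; simp⟩
      -- The table value is at most `n`, whereas infinity has value `n + 1`; so the entry names a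
      -- genuine vertex to expand.
      · obtain ⟨q1, q2⟩ := hTR.2.2.2 hemp (by
          have : tab n s (enc (Finset.range n \ verts Q)) / n < n + 1 := by omega
          rw [Nat.div_lt_iff_lt_mul (by omega)] at this
          nlinarith)
        rw [hv] at q1 q2
        have hvQ : v ∈ verts Q := by
          by_contra h
          exact q1 (Finset.mem_sdiff.mpr ⟨Finset.mem_range.mpr hvn, h⟩)
        refine ⟨insert v E, p3, g2.grow v le_rfl, (g3.mono (Finset.subset_insert _ _)).grow hvQ
          (Finset.mem_insert_self _ _) le_rfl, (Finset.card_le_card (cut_subset _ _)).trans g4, ?_,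
          by omega⟩
        have := Finset.card_insert_le v E
        omega
    · rintro s3 ⟨e3, m3, t3, Q, E, g1, g2, g3, g4, g5, g6⟩
      have hemp : Finset.range n \ verts Q = ∅ := by
        by_contra hne
        have := (hT _ Finset.sdiff_subset g4).2.2.2 hne (by
          have : tab n s (enc (Finset.range n \ verts Q)) / n < n + 1 := by omega
          rw [Nat.div_lt_iff_lt_mul (by omega)] at this
          nlinarith)
        rw [this.2, Nat.sub_self] at g6
        exact absurd g6 (Nat.not_succ_le_zero _)
      have hall : verts Q = Finset.range n :=
        g2.2.antisymm (Finset.sdiff_eq_empty_iff_subset.mp hemp)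
      have hlen : Q.length = n := by rw [← card_verts g2.1, hall, Finset.card_range]
      have hQ : ∀ t v u : ℕ, Q[t]? = some (v, u) → v < n ∧ u < n := fun t v u h => by
        have hmem := List.mem_of_getElem? h
        have hv : v < n := Finset.mem_range.mp (g2.2 (mem_verts_of_mem hmem))
        refine ⟨hv, ?_⟩
        by_cases hvr : v = r
        · have h1 : (r, r) ∈ Q := by
            obtain ⟨Q', rfl⟩ := g3.head
            simp
          rw [g3.parent_unique hmem (hvr ▸ h1)]
          exact hv
        · exact Finset.mem_range.mp (g2.2 (g3.entry hmem hvr).1)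
      refine wp_write hn e3 g1 hlen hQ fun s4 hs4 => ?_
      refine ⟨by simp, by simp, ?_, by simp; omega, Or.inr ⟨by simp, treeOf n r Q, ?_, fun i j => ?_⟩⟩
      · simp; exact mem_lim_of_lt (by omega)
      · refine g3.isMax hrn hall fun r' hr' I hI hs => ?_
        exact (Nat.le_add_right _ _).trans (g5.trans (hmin r' hr' I hI hs))
      · obtain ⟨p1, p2⟩ := hs4 i i.2 j j.2
        rw [g3.mem_tail_iff] at p1 p2
        have hne : 1 + (i : ℕ) * n + j ≠ 0 := by omega
        have hup : Function.update s4.mem (Ex.eval s4 0) (Ex.eval s4 1) (1 + i * n + j) =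
            s4.mem (1 + i * n + j) := Function.update_of_ne hne _ _
        exact ⟨fun h => hup.trans (p1 h), fun h => hup.trans (p2 h)⟩

end Loop

/-! ### The input format and the numerical estimates. -/

namespace Loop

open Cmd

variable {n : ℕ}

theorem getElem?_flatMap_block {α β : Type*} {g : α → List β} {m : ℕ} (hg : ∀ a, (g a).length = m)
    (l : List α) {i j : ℕ} (hj : j < m) :
    (l.flatMap g)[i * m + j]? = l[i]?.bind fun a => (g a)[j]? := by
  induction l generalizing i with
  | nil => simp
  | cons a l ih =>
    rw [List.flatMap_cons]
    cases i with
    | zero => rw [zero_mul, zero_add, List.getElem?_append_left (by rw [hg]; exact hj)]; simp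
    | succ i =>
      rw [List.getElem?_append_right (by rw [hg]; nlinarith), hg,
        show (i + 1) * m + j - m = i * m + j by rw [Nat.add_mul]; omega, ih]
      simp

theorem length_encodeDigraph (G : Digraph (Fin n)) : (encodeDigraph G).length = n * n + 1 := by
  simp [encodeDigraph, List.length_flatMap]

theorem encodeDigraph_le (G : Digraph (Fin n)) (hn : 2 ≤ n) : ∀ v ∈ encodeDigraph G, v ≤ n := by
  intro v hv
  simp only [encodeDigraph, List.mem_cons, List.mem_flatMap, List.mem_map] at hv
  rcases hv with rfl | ⟨i, -, j, -, rfl⟩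
  · exact le_rfl
  · split_ifs <;> omega

theorem getD_encodeDigraph (G : Digraph (Fin n)) {i j : ℕ} (hi : i < n) (hj : j < n) :
    (encodeDigraph G).getD (1 + i * n + j) 0 = adjMat G i j := by
  rw [encodeDigraph, show 1 + i * n + j = i * n + j + 1 by ring, List.getD_cons_succ,
    List.getD_eq_getElem?_getD, getElem?_flatMap_block (by simp) _ hj]
  have e : (List.finRange n)[j]'(by simpa using hj) = ⟨j, hj⟩ := Fin.ext (by simp)
  by_cases h : G.Adj ⟨i, hi⟩ ⟨j, hj⟩ <;> simp [hi, hj, adjMat, h, e]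

/-- The algorithm is correct. -/
theorem wp_main (hn : 2 ≤ n) (G : Digraph (Fin n)) :
    mainC.wp (lim n) ⟨fun _ => 0, fun a => (encodeDigraph G).getD a 0⟩
      fun s => IsCorrectAnswer G s.mem := by
  refine wp_init hn (by simp [encodeDigraph]) fun s1 e1 h1 => ?_
  have m1 : MatOK n (adjMat G) s1 := fun i hi j hj => by rw [h1]; exact getD_encodeDigraph G hi hj
  refine wp_table hn (adjMat_le G) e1 m1 fun s2 e2 m2 t2 => ?_
  refine wp_search hn (adjMat_le G) e2 m2 fun s3 e3 h3 b3 => ?_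
  refine wp_output hn e3 (m2.same h3) ?_ ?_
  · rw [tab_same h3]; exact t2
  · rw [tab_same h3]; exact b3

/-- The constant `1.1027` satisfies `1.1027 * 1.8139 ≥ 2` and `1.1027 ^ 6 ≤ 2`; the factor `2` pays
for rounding `n / 6` down. -/
theorem two_pow_le (n : ℕ) : (2 : ℝ) ^ (n - n / 6) ≤ 2 * 1.8139 ^ n := by
  have h1 : (2 : ℝ) ^ n = 2 ^ (n - n / 6) * 2 ^ (n / 6) := by
    rw [← pow_add]; congr 1; omega
  have h2 : (2 : ℝ) ^ n ≤ 1.1027 ^ n * 1.8139 ^ n := by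
    rw [← mul_pow]; exact pow_le_pow_left₀ (by norm_num) (by norm_num) n
  have h3 : (1.1027 : ℝ) ^ n ≤ 2 ^ (n / 6 + 1) := by
    calc (1.1027 : ℝ) ^ n ≤ 1.1027 ^ (6 * (n / 6 + 1)) :=
          pow_le_pow_right₀ (by norm_num) (by omega)
      _ = (1.1027 ^ 6) ^ (n / 6 + 1) := pow_mul _ _ _
      _ ≤ 2 ^ (n / 6 + 1) := pow_le_pow_left₀ (by norm_num) (by norm_num) _
  have h4 : (0 : ℝ) < 2 ^ (n / 6) := by positivity
  have h5 : (0 : ℝ) < 1.8139 ^ n := by positivity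
  refine le_of_mul_le_mul_right ?_ h4
  rw [← h1]
  calc (2 : ℝ) ^ n ≤ 2 ^ (n / 6 + 1) * 1.8139 ^ n :=
        h2.trans (mul_le_mul_of_nonneg_right h3 h5.le)
    _ = 2 * 1.8139 ^ n * 2 ^ (n / 6) := by rw [pow_succ]; ring

/-- Here `1.32504` is `1.6563 * 4 / 5`, and its sixth power exceeds `4`. -/
theorem card_lowMasks_le (n : ℕ) : ((lowMasks n (n / 6)).card : ℝ) ≤ 1.6563 ^ n := by
  have h1 : ((lowMasks n (n / 6)).card : ℝ) * 4 ^ (n - n / 6) ≤ 5 ^ n := by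
    exact_mod_cast card_lowMasks n (n / 6)
  have h2 : (4 : ℝ) ^ n = 4 ^ (n - n / 6) * 4 ^ (n / 6) := by
    rw [← pow_add]; congr 1; omega
  have h3 : (4 : ℝ) ^ (n / 6) ≤ 1.32504 ^ n := by
    calc (4 : ℝ) ^ (n / 6) ≤ (1.32504 ^ 6) ^ (n / 6) :=
          pow_le_pow_left₀ (by norm_num) (by norm_num) _
      _ = 1.32504 ^ (6 * (n / 6)) := (pow_mul _ _ _).symm
      _ ≤ 1.32504 ^ n := pow_le_pow_right₀ (by norm_num) (by omega)
  have h4 : (0 : ℝ) < 4 ^ n := by positivity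
  refine le_of_mul_le_mul_right ?_ h4
  calc ((lowMasks n (n / 6)).card : ℝ) * 4 ^ n
      = (lowMasks n (n / 6)).card * 4 ^ (n - n / 6) * 4 ^ (n / 6) := by rw [h2]; ring
    _ ≤ 5 ^ n * 1.32504 ^ n := mul_le_mul h1 h3 (by positivity) (by positivity)
    _ = 1.6563 ^ n * 4 ^ n := by rw [← mul_pow, ← mul_pow]; norm_num

theorem size_lim (n : ℕ) : ((lim n).M ^ 64).size = 512 * n + 1 := by
  rw [lim, ← pow_mul, ← pow_mul, Nat.size_pow]
  ring

theorem card_lim_le (n : ℕ) :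
    (lim n).S.card ≤ n * n + 2 * n + 3 + (lowMasks n (n / 6)).card := by
  refine (Finset.card_union_le _ _).trans ?_
  rw [Finset.card_range]
  exact Nat.add_le_add_left Finset.card_image_le _

theorem le_of_mem_lim (hn : 2 ≤ n) {a : ℕ} (ha : a ∈ (lim n).S) : a ≤ (lim n).M := by
  obtain ⟨f1, f2, f3, f4, f5, f6, f7⟩ := lim_facts hn
  simp only [lim, lowMasks, Finset.mem_union, Finset.mem_range, Finset.mem_image,
    Finset.mem_filter] at ha
  rcases ha with ha | ⟨z, ⟨hz, -⟩, rfl⟩ <;> omega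

end Loop

open Loop in
theorem mainTheorem2 :
    ∃ (m : ℕ) (P : RAM.Program m) (p q : Polynomial ℕ),
      SolvesDMLST P
        (fun n => ((p.eval n : ℕ) : ℝ) * (1.8139 : ℝ) ^ n)
        (fun n => ((q.eval n : ℕ) : ℝ) * (1.6563 : ℝ) ^ n) := by
  -- In the time bound, `2000` bounds the weight, `(X + 1) ^ 2` comes from the nested loops of `n`
  -- rounds and `8 * X + 1` from the long loop. The factor `1024 * X + 3` bounds the cost of a step
  -- and the size of a used cell. In the space bound, `84` counts `80` registers, three constant
  -- cells and one for the table.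
  refine ⟨80, mainC.prog,
    2000 * (Polynomial.X + 1) ^ 2 * (8 * Polynomial.X + 1) * (1024 * Polynomial.X + 3),
    (Polynomial.X * Polynomial.X + 2 * Polynomial.X + 84) * (1024 * Polynomial.X + 3),
    fun n hn G => ?_⟩
  obtain ⟨f1, f2, f3, f4, f5, f6, f7⟩ := lim_facts hn
  obtain ⟨k, h1, h2, h3, h4⟩ := mainC.prog_spec (K := lim n) (by omega) mainC_wf (encodeDigraph G)
    (fun v hv => (encodeDigraph_le G hn v hv).trans (by omega))
    (fun a ha => mem_lim_of_lt (by
      rw [length_encodeDigraph, Finset.mem_range] at ha; omega))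
    (fun a ha => le_of_mem_lim hn ha) (IsCorrectAnswer G) (wp_main hn G)
  refine ⟨k, h1, h2, ?_, ?_⟩
  · have ht := mainC.time_le (lim n).bd
    rw [mainC_depth.1, mainC_depth.2, pow_one] at ht
    have ht' := h3.trans (Nat.mul_le_mul_right _ (ht.trans (Nat.mul_le_mul_right _ mainC_weight)))
    rw [size_lim] at ht'
    simp only [lim, if_true, Bool.false_eq_true, if_false] at ht'
    have hp := two_pow_le n
    have h1n : (1 : ℝ) ≤ 1.8139 ^ n := one_le_pow₀ (by norm_num)
    have hb : 4 * ((n : ℝ) * 2 ^ (n - n / 6)) + 1 ≤ (8 * n + 1) * 1.8139 ^ n := by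
      nlinarith [mul_le_mul_of_nonneg_left hp (Nat.cast_nonneg (α := ℝ) n)]
    calc (RAM.time mainC.prog (encodeDigraph G) k : ℝ)
        ≤ 2000 * (((n : ℝ) + 1) ^ 2 * (4 * ((n : ℝ) * 2 ^ (n - n / 6)) + 1)) *
          (1 + 2 * (512 * n + 1)) := by exact_mod_cast ht'
      _ ≤ 2000 * (((n : ℝ) + 1) ^ 2 * ((8 * n + 1) * 1.8139 ^ n)) * (1 + 2 * (512 * n + 1)) := by
        gcongr
      _ = _ := by simp; ring
  · have hc := card_lim_le n
    rw [size_lim] at h4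
    have hl := card_lowMasks_le n
    have h1n : (1 : ℝ) ≤ 1.6563 ^ n := one_le_pow₀ (by norm_num)
    have hb : 80 + ((n : ℝ) * n + 2 * n + 3 + (lowMasks n (n / 6)).card) ≤
        (n * n + 2 * n + 84) * 1.6563 ^ n := by
      nlinarith [mul_le_mul_of_nonneg_left h1n (by positivity : (0 : ℝ) ≤ n * n + 2 * n + 83)]
    calc (RAM.space mainC.prog (encodeDigraph G) k : ℝ)
        ≤ (80 + ((n : ℝ) * n + 2 * n + 3 + (lowMasks n (n / 6)).card)) *
          (1 + 2 * (512 * n + 1)) := by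
            exact_mod_cast h4.trans (Nat.mul_le_mul_right _ (Nat.add_le_add_left hc 80))
      _ ≤ ((n * n + 2 * n + 84) * 1.6563 ^ n) * (1 + 2 * (512 * n + 1)) := by gcongr
      _ = _ := by simp; ring
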